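/- Let $m\ge 1$. Write points of $\mathbb{R}^{2m}$ as $x=(x_1^0,\dots,x_m^0,x_1^1,\dots,x_m^1)^T$, let $Q$ be the set of all functions $j:\{1,\dots,m\}\to\{0,1\}$, and for $j\in Q$ let $\Pi_j:\mathbb{R}^{2m}\to\mathbb{R}^m$ be the projection $$\Pi_j x=(x_1^{j(1)},x_2^{j(2)},\dots,x_m^{j(m)})^T .$$ For $N\ge 0$, a Calderón–Zygmund kernel of order $N$ on $\mathbb{R}^m$ is a tempered distribution $K$ on $\mathbb{R}^m$ whose Fourier transform $\widehat K$ is a measurable function, of class $C^N$ on $\mathbb{R}^m\setminus\{0\}$, with $$|\partial^\alpha\widehat K(\xi)|\le|\xi|^{-|\alpha|}\qquad\text{for all }\xi\ne 0\text{ and all multi-indices }\alpha\text{ with }|\alpha|\le N .$$ For a surjective linear map $\Pi:\mathbb{R}^{2m}\to\mathbb{R}^m$, Schwartz functions $F_j:\mathbb{R}^m\to\mathbb{C}$ $(j\in Q)$ and a tempered distribution $K$ on $\mathbb{R}^m$, the expression $$\int_{\mathbb{R}^{2m}}\Big(\prod_{j\in Q}F_j(\Pi_jx)\Big)K(\Pi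 x)\,dx$$ denotes the pull-back $K\circ\Pi$, a tempered distribution on $\mathbb{R}^{2m}$, applied to the Schwartz function $x\mapsto\prod_{j\in Q}F_j(\Pi_jx)$. Here $(K\circ\Pi)(\varphi)=K(\Pi_*\varphi)$, where $\Pi_*\varphi$ is the Schwartz function on $\mathbb{R}^m$ with $\int_{\mathbb{R}^m} (\Pi_*\varphi)\,g=\int_{\mathbb{R}^{2m}}\varphi\,(g\circ\Pi)$ for all Schwartz functions $g$ on $\mathbb{R}^m$. **Theorem.** Given $m\ge 1$, there is an $N\ge 0$ such that for all surjective linear maps $\Pi:\mathbb{R}^{2m}\to\mathbb{R}^m$ the following are equivalent. 1. For all subspaces $V\subseteq\ker\Pi$ we have $$\dim(V)\le\sum_{j\in Q}2^{-m}\dim(\Pi_j V),$$ with equality if $V=\ker\Pi$. 2. For all $j\in Q$, the composed map $\Pi\,\Pi_j^T:\mathbb{R}^m\to\mathbb{R}^m$ is invertible. 3. There is a constant $C$ such that for all Calderón–Zygmund kernels $K$ of order $N$ on $\mathbb{R}^m$ and all tuples of Schwartz functions $(F_j)_{j\in Q}$ on $\mathbb{R}^m$ we have $$\Big|\int_{\mathbb{R}^{2m}}\Big(\prod_{j\in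 Q}F_j(\Pi_jx)\Big)K(\Pi x)\,dx\Big|\le C\prod_{j\in Q}\|F_j\|_{L^{2^m}(\mathbb{R}^m)} .$$ -/

import Mathlib

open MeasureTheory FourierTransform
open scoped SchwartzMap

noncomputable section

namespace SingularBL

/-- The vertices of the discrete cube: functions `j : {1, …, m} → {0, 1}`. -/
abbrev Cube (m : ℕ) : Type := Fin m → Fin 2

/-- `ℝ^m` with its Euclidean structure and Lebesgue measure. -/
abbrev Rm (m : ℕ) : Type := EuclideanSpace ℝ (Fin m)

/-- `ℝ^{2m}` with its Euclidean structure and Lebesgue measure; the coordinate `x_i^a`,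
for `a ∈ {0, 1}` and `1 ≤ i ≤ m`, is `x (a, i)`. -/
abbrev R2m (m : ℕ) : Type := EuclideanSpace ℝ (Fin 2 × Fin m)

/-- The cubical projection `x ↦ (x_1^{j(1)}, …, x_m^{j(m)})`. -/
def cubeProj {m : ℕ} (j : Cube m) : R2m m →ₗ[ℝ] Rm m where
  toFun x := WithLp.toLp 2 fun i => x (j i, i)
  map_add' _ _ := rfl
  map_smul' _ _ := rfl

@[simp] theorem cubeProj_apply {m : ℕ} (j : Cube m) (x : R2m m) (i : Fin m) :
    cubeProj j x i = x (j i, i) := rfl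

/-! ### The function `x ↦ ∏ j, F j (Π_j x)` is a Schwartz function -/

theorem exists_norm_le_cubeProj {m : ℕ} (x : R2m m) :
    ∃ j : Cube m, ‖x‖ ≤ 2 * ‖cubeProj j x‖ := by
  have h (i : Fin m) : ∃ a : Fin 2, ∀ b : Fin 2, ‖x (b, i)‖ ≤ ‖x (a, i)‖ :=
    Finite.exists_max fun a => ‖x (a, i)‖
  choose j hj using h
  refine ⟨j, ?_⟩
  refine le_of_sq_le_sq ?_ (by positivity)
  rw [mul_pow, EuclideanSpace.norm_sq_eq, EuclideanSpace.norm_sq_eq, Fintype.sum_prod_type,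
    Fin.sum_univ_two, Finset.mul_sum, ← Finset.sum_add_distrib]
  refine Finset.sum_le_sum fun i _ => ?_
  have h0 := pow_le_pow_left₀ (norm_nonneg _) (hj i 0) 2
  have h1 := pow_le_pow_left₀ (norm_nonneg _) (hj i 1) 2
  have h2 := sq_nonneg ‖x (j i, i)‖
  simp only [cubeProj_apply]
  linarith

theorem norm_le_prod_cubeProj {m : ℕ} (x : R2m m) :
    ‖x‖ ≤ 2 * ∏ j : Cube m, (1 + ‖cubeProj j x‖) := by
  obtain ⟨j, hj⟩ := exists_norm_le_cubeProj x
  refine hj.trans ?_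
  have h1 : 1 + ‖cubeProj j x‖ ≤ ∏ j : Cube m, (1 + ‖cubeProj j x‖) := by
    rw [← Finset.mul_prod_erase _ _ (Finset.mem_univ j)]
    refine le_mul_of_one_le_right (by positivity) ?_
    exact Finset.prod_induction _ (fun r : ℝ => 1 ≤ r) (fun _ _ => one_le_mul_of_one_le_of_one_le)
      le_rfl fun _ _ => by simp
  linarith

theorem cubeProd_decay {m : ℕ} (F : Cube m → 𝓢(Rm m, ℂ)) (k n : ℕ) :
    ∃ C : ℝ, ∀ x : R2m m,
      ‖x‖ ^ k * ‖iteratedFDeriv ℝ n (fun x : R2m m => ∏ j, F j (cubeProj j x)) x‖ ≤ C := by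
  classical
  let P (j : Cube m) : R2m m →L[ℝ] Rm m := LinearMap.toContinuousLinearMap (cubeProj j)
  have hsmooth (j : Cube m) : ContDiff ℝ n fun x : R2m m => F j (P j x) :=
    ((F j).smooth n).comp (P j).contDiff
  -- decay of the derivatives of each single factor
  have hfac (j : Cube m) (i : ℕ) : ∃ C : ℝ, ∀ x : R2m m,
      (1 + ‖P j x‖) ^ k * ‖iteratedFDeriv ℝ i (fun x : R2m m => F j (P j x)) x‖ ≤ C := by
    refine ⟨(2 ^ k * (Finset.Iic (k, i)).sup (fun q => SchwartzMap.seminorm ℝ q.1 q.2) (F j))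
      * ‖P j‖ ^ i, fun x => ?_⟩
    have h1 : iteratedFDeriv ℝ i (fun x : R2m m => F j (P j x)) x =
        (iteratedFDeriv ℝ i (F j) (P j x)).compContinuousLinearMap fun _ => P j :=
      (P j).iteratedFDeriv_comp_right ((F j).smooth i) x le_rfl
    have h2 := ContinuousMultilinearMap.norm_compContinuousLinearMap_le
      (iteratedFDeriv ℝ i (F j) (P j x)) (fun _ : Fin i => P j)
    rw [← h1, Finset.prod_const, Finset.card_univ, Fintype.card_fin] at h2
    have h3 := SchwartzMap.one_add_le_sup_seminorm_apply (𝕜 := ℝ) (m := (k, i)) le_rfl le_rfl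
      (F j) (P j x)
    calc (1 + ‖P j x‖) ^ k * ‖iteratedFDeriv ℝ i (fun x : R2m m => F j (P j x)) x‖
        ≤ (1 + ‖P j x‖) ^ k * (‖iteratedFDeriv ℝ i (F j) (P j x)‖ * ‖P j‖ ^ i) := by gcongr
      _ = ((1 + ‖P j x‖) ^ k * ‖iteratedFDeriv ℝ i (F j) (P j x)‖) * ‖P j‖ ^ i := by ring
      _ ≤ _ := by gcongr
  choose C hC using hfac
  refine ⟨∑ p ∈ (Finset.univ : Finset (Cube m)).sym n, ((p : Multiset (Cube m)).countPerms : ℝ) *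
    (2 ^ k * ∏ j, C j ((p : Multiset (Cube m)).count j)), fun x => ?_⟩
  have hleib := norm_iteratedFDeriv_prod_le (𝕜 := ℝ) (u := Finset.univ)
    (f := fun (j : Cube m) (x : R2m m) => F j (P j x)) (N := n) (fun j _ => hsmooth j)
    (x := x) (n := n) le_rfl
  have hx : ‖x‖ ^ k ≤ 2 ^ k * ∏ j : Cube m, (1 + ‖P j x‖) ^ k := by
    rw [Finset.prod_pow, ← mul_pow]
    exact pow_le_pow_left₀ (norm_nonneg _) (norm_le_prod_cubeProj x) k
  refine (mul_le_mul_of_nonneg_left hleib (by positivity)).trans ?_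
  rw [Finset.mul_sum]
  refine Finset.sum_le_sum fun p _ => ?_
  rw [mul_left_comm]
  refine mul_le_mul_of_nonneg_left ?_ (by positivity)
  refine (mul_le_mul_of_nonneg_right hx (by positivity)).trans ?_
  rw [mul_assoc, ← Finset.prod_mul_distrib]
  refine mul_le_mul_of_nonneg_left ?_ (by positivity)
  exact Finset.prod_le_prod (fun _ _ => by positivity) fun j _ => hC j _ x

/-- The Schwartz function `x ↦ ∏_j F_j (Π_j x)` on `ℝ^{2m}`. -/
def cubeProd {m : ℕ} (F : Cube m → 𝓢(Rm m, ℂ)) : 𝓢(R2m m, ℂ) where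
  toFun x := ∏ j, F j (cubeProj j x)
  smooth' := contDiff_prod fun j _ =>
    ((F j).smooth _).comp (LinearMap.toContinuousLinearMap (cubeProj j)).contDiff
  decay' := cubeProd_decay F

@[simp] theorem cubeProd_apply {m : ℕ} (F : Cube m → 𝓢(Rm m, ℂ)) (x : R2m m) :
    cubeProd F x = ∏ j, F j (cubeProj j x) := rfl

/-! ### The pull-back `K ∘ L` of a tempered distribution under a surjective linear map -/

section Pullback

variable {E G : Type*}
  [NormedAddCommGroup E] [InnerProductSpace ℝ E] [FiniteDimensional ℝ E]
  [NormedAddCommGroup G] [InnerProductSpace ℝ G] [FiniteDimensional ℝ G]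

/-- The transpose `L^T`, as a continuous linear map. -/
def transposeCLM (L : E →ₗ[ℝ] G) : G →L[ℝ] E :=
  LinearMap.toContinuousLinearMap (LinearMap.adjoint L)

theorem inner_transposeCLM (L : E →ₗ[ℝ] G) (x : E) (ξ : G) :
    inner ℝ x (transposeCLM L ξ) = inner ℝ (L x) ξ :=
  LinearMap.adjoint_inner_right L x ξ

theorem transposeCLM_upper (L : E →ₗ[ℝ] G) (hL : Function.Surjective L) :
    ∃ (k : ℕ) (C : ℝ), ∀ ξ, ‖ξ‖ ≤ C * (1 + ‖transposeCLM L ξ‖) ^ k := by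
  have hinj : Function.Injective (LinearMap.adjoint L) := by
    rw [injective_iff_map_eq_zero]
    intro ξ hξ
    obtain ⟨x, rfl⟩ := hL ξ
    have h := LinearMap.adjoint_inner_right L x (L x)
    rw [hξ, inner_zero_right] at h
    exact inner_self_eq_zero.mp h.symm
  obtain ⟨c, -, hc⟩ :=
    (LinearMap.adjoint L).exists_antilipschitzWith (LinearMap.ker_eq_bot.mpr hinj)
  refine ⟨1, c, fun ξ => ?_⟩
  have h := hc.le_mul_dist ξ 0
  rw [map_zero, dist_zero_right, dist_zero_right] at h
  rw [pow_one]
  refine h.trans (mul_le_mul_of_nonneg_left ?_ c.2)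
  change ‖LinearMap.adjoint L ξ‖ ≤ 1 + ‖LinearMap.adjoint L ξ‖
  linarith

variable [MeasurableSpace E] [BorelSpace E] [MeasurableSpace G] [BorelSpace G]

/-- The push-forward `L_* φ` of a Schwartz function `φ` under a surjective linear map `L`, i.e. the
Schwartz function that satisfies `∫ (L_* φ)(y) g(y) dy = ∫ φ(x) g(L x) dx` (see
`integral_pushforward_mul`). Its Fourier transform is `(𝓕 φ) ∘ L^T`. -/
def pushforward (L : E →ₗ[ℝ] G) (hL : Function.Surjective L) : 𝓢(E, ℂ) →L[ℂ] 𝓢(G, ℂ) :=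
  fourierInvCLM ℂ 𝓢(G, ℂ) ∘L
    (SchwartzMap.compCLM ℂ (transposeCLM L).hasTemperateGrowth (transposeCLM_upper L hL)) ∘L
      fourierCLM ℂ 𝓢(E, ℂ)

theorem fourier_pushforward (L : E →ₗ[ℝ] G) (hL : Function.Surjective L) (φ : 𝓢(E, ℂ)) (ξ : G) :
    𝓕 (pushforward L hL φ) ξ = 𝓕 φ (transposeCLM L ξ) := by
  have h : pushforward L hL φ = 𝓕⁻ (SchwartzMap.compCLM ℂ (transposeCLM L).hasTemperateGrowth
    (transposeCLM_upper L hL) (𝓕 φ)) := rfl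
  rw [h, FourierTransform.fourier_fourierInv_eq]
  rfl

/-- The defining property of the push-forward. -/
theorem integral_pushforward_mul (L : E →ₗ[ℝ] G) (hL : Function.Surjective L)
    (φ : 𝓢(E, ℂ)) (g : 𝓢(G, ℂ)) :
    ∫ y, pushforward L hL φ y * g y = ∫ x, φ x * g (L x) := by
  let B : E →ₗ[ℝ] G →ₗ[ℝ] ℝ := (innerₗ G) ∘ₗ L
  have hB : Continuous fun p : E × G => B p.1 p.2 := by
    have hLc : Continuous L := L.continuous_of_finiteDimensional
    change Continuous fun p : E × G => inner ℝ (L p.1) p.2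
    fun_prop
  have h1 (ξ : G) : VectorFourier.fourierIntegral Real.fourierChar volume B φ ξ =
      𝓕 (pushforward L hL φ) ξ := by
    rw [fourier_pushforward, SchwartzMap.fourier_coe, Real.fourier_eq]
    refine integral_congr_ae (Filter.Eventually.of_forall fun x => ?_)
    simp only [inner_transposeCLM]
    rfl
  let h : 𝓢(G, ℂ) := 𝓕⁻ g
  have hg : 𝓕 h = g := FourierTransform.fourier_fourierInv_eq g
  have h2 (x : E) : VectorFourier.fourierIntegral Real.fourierChar volume B.flip h x =
      g (L x) := by
    rw [← hg, SchwartzMap.fourier_coe, Real.fourier_eq]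
    refine integral_congr_ae (Filter.Eventually.of_forall fun ξ => ?_)
    simp only [real_inner_comm (L x) ξ]
    rfl
  have h4 := VectorFourier.integral_fourierIntegral_smul_eq_flip (μ := volume) (ν := volume)
    Real.continuous_fourierChar hB φ.integrable h.integrable
  simp only [h1, h2, smul_eq_mul] at h4
  rw [← h4, SchwartzMap.integral_fourier_mul_eq, hg]

/-- The pull-back `K ∘ L` of a tempered distribution `K` under a surjective linear map `L`:
`(K ∘ L)(φ) = K (L_* φ)`. -/
def pullback (L : E →ₗ[ℝ] G) (hL : Function.Surjective L) (K : 𝓢'(G, ℂ)) : 𝓢'(E, ℂ) :=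
  PointwiseConvergenceCLM.precomp ℂ (pushforward L hL) K

theorem pullback_apply (L : E →ₗ[ℝ] G) (hL : Function.Surjective L) (K : 𝓢'(G, ℂ))
    (φ : 𝓢(E, ℂ)) : pullback L hL K φ = K (pushforward L hL φ) := rfl

/-- If `K` is a function, then so is `K ∘ L`. -/
theorem pullback_coe (L : E →ₗ[ℝ] G) (hL : Function.Surjective L) (g : 𝓢(G, ℂ)) (φ : 𝓢(E, ℂ)) :
    pullback L hL (g : 𝓢'(G, ℂ)) φ = ∫ x, φ x * g (L x) := by
  rw [pullback_apply, ← integral_pushforward_mul L hL]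
  simp

end Pullback

/-- `∫_{ℝ^{2m}} (∏_j F_j (Π_j x)) K(Π x) dx`: the tempered distribution `K ∘ Π` on `ℝ^{2m}`
applied to the Schwartz function `x ↦ ∏_j F_j (Π_j x)`. -/
def singularForm {m : ℕ} (L : R2m m →ₗ[ℝ] Rm m) (hL : Function.Surjective L)
    (K : 𝓢'(Rm m, ℂ)) (F : Cube m → 𝓢(Rm m, ℂ)) : ℂ :=
  pullback L hL K (cubeProd F)

/-- `K` is a Calderón–Zygmund kernel on `ℝ^m` whose symbol estimates hold up to order `N`: the
Fourier transform of `K` is (integration against) a measurable function `k`, of class `C^N` away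
from the origin, with `|∂^α k(ξ)| ≤ |ξ|^{-|α|}` for all `ξ ≠ 0` and all `|α| ≤ N`. The partial
derivatives `∂^α` of order `n` are written as `∂_{β 0} ⋯ ∂_{β (n - 1)}`. -/
def IsCZKernel {m : ℕ} (N : ℕ) (K : 𝓢'(Rm m, ℂ)) : Prop :=
  ∃ k : Rm m → ℂ, Measurable k ∧
    (∀ φ : 𝓢(Rm m, ℂ), 𝓕 K φ = ∫ ξ, k ξ * φ ξ) ∧
    ContDiffOn ℝ N k {0}ᶜ ∧
    ∀ n ≤ N, ∀ β : Fin n → Fin m, ∀ ξ : Rm m, ξ ≠ 0 →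
      ‖iteratedFDeriv ℝ n k ξ fun s => EuclideanSpace.single (β s) 1‖ ≤ (‖ξ‖ ^ n)⁻¹

end SingularBL

end

noncomputable section

namespace SingularBL

/-! ### Schwartz functions of product type on `ℝ^κ` -/

section Tensor

variable {κ : Type*} [Fintype κ]

/-! Conditions 1 and 2 are linear algebra: each says that every `cubeProj j` is injective on ker Π
(`dimension_condition_iff`, `forall_bijective_iff`). For 3 ⇒ 1 take K = δ, whose Fourier transform
is 1. The form is then, up to a positive constant, the integral of ∏ F_j ∘ Π_j over ker Π. If
Π_j(ker Π) is a proper subspace with normal vector w, multiplying F_j by exp(-n⟨w, y⟩²) leaves the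
form unchanged and sends the norm of F_j to 0 (`ker_injective_of_bound`).

For 1 ⇒ 3 write τ = Π^T ξ, a frequency orthogonal to ker Π. Each F_j ∘ Π_j sees only one of x_i^0,
x_i^1. With the other variables fixed, the product of these functions is therefore a function of
x_i^0 times a function of x_i^1. So Cauchy–Schwarz applies to the multiplier τ_i^0 τ_i^1 exp(-4π² v
|τ|²), which comes from heat kernels differentiated in x_i^0 and x_i^1. It replaces the data by data
frozen in the direction i: F_j no longer depends on j(i), and ker Π becomes a subspace on which
x_i^0 = x_i^1. For frozen data the form is an integral of squares (`Frame.abs_spatialForm_le`,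
`Frame.spatialForm_nonneg`).

The core is the square function estimate `squareBound`: for data symmetric in the directions of S,
the nonnegative forms with multiplier -τ_i^0 τ_i^1 times the Gaussian, i ∈ S, have integrals over
all times v that are bounded uniformly. It is proved by downward induction on S. Because -2 τ_i^0
τ_i^1 = (τ_i^0)² + (τ_i^1)² - (τ_i^0 + τ_i^1)², the sum over S is the full energy minus an error.
The energy is a time derivative of the heat flow and integrates to two boundary terms without
cancellation, which are trivially bounded. By orthogonality to the kernel, τ_i^0 + τ_i^1 for i ∈ S
is a combination of frequencies outside S, so the error consists of quadratic monomials in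
directions outside S.

Such a monomial reduces to the induction hypothesis for S ∪ {i} as soon as it contains both τ_i^0
and τ_i^1 (`SquareBound.monoBound_pair`). If it does not, its degree is raised by writing its
Gaussian as a superposition of Gaussians with stretched scales (`MonoBound.lower`). Once the degree
exceeds m, the relations between opposite vertices of the cube and the pigeonhole principle produce
a pair (`monoBound_of_card_lt`).

A general symbol is cut into annular pieces at all scales. The products τ_i^0 τ_i^1 have no common
zero for ξ ≠ 0, so each piece is a combination of these products times a Gaussian, with smooth
localized coefficients. Expanding the coefficients in Fourier integrals produces shifts, which cost
(1 + |y|)^(2m). Decay of order 3m + 1 pays for them and leaves an integrable power in dimension m,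
whence N = 3m + 1. -/

theorem norm_le_card_mul_prod (x : EuclideanSpace ℝ κ) :
    ‖x‖ ≤ Fintype.card κ * ∏ c, (1 + ‖x c‖) := by
  have h0 : ‖x‖ ≤ ∑ c, ‖x c‖ := by
    rw [EuclideanSpace.norm_eq]
    refine Real.sqrt_le_iff.mpr ⟨by positivity, ?_⟩
    exact Finset.sum_sq_le_sq_sum_of_nonneg fun c _ => norm_nonneg _
  refine h0.trans ?_
  have h1 (c : κ) : ‖x c‖ ≤ ∏ c, (1 + ‖x c‖) := by
    classical
    have h2 : 1 + ‖x c‖ ≤ ∏ c, (1 + ‖x c‖) := by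
      rw [← Finset.mul_prod_erase _ _ (Finset.mem_univ c)]
      refine le_mul_of_one_le_right (by positivity) ?_
      exact Finset.prod_induction _ (fun r : ℝ => 1 ≤ r)
        (fun _ _ => one_le_mul_of_one_le_of_one_le) le_rfl fun _ _ => by simp
    linarith
  refine (Finset.sum_le_sum fun c _ => h1 c).trans ?_
  simp

/-- By the Leibniz rule each term is a product of derivatives of the factors. Each factor can absorb
a power of 1 + |x_c|, and the product of these dominates the same power of the full norm. -/
theorem tensor_decay (φ : κ → 𝓢(ℝ, ℂ)) (k n : ℕ) :
    ∃ C : ℝ, ∀ x : EuclideanSpace ℝ κ,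
      ‖x‖ ^ k * ‖iteratedFDeriv ℝ n (fun x : EuclideanSpace ℝ κ => ∏ c, φ c (x c)) x‖ ≤ C := by
  classical
  let P (c : κ) : EuclideanSpace ℝ κ →L[ℝ] ℝ := EuclideanSpace.proj c
  have hsmooth (c : κ) : ContDiff ℝ n fun x : EuclideanSpace ℝ κ => φ c (P c x) :=
    ((φ c).smooth n).comp (P c).contDiff
  have hfac (c : κ) (i : ℕ) : ∃ C : ℝ, ∀ x : EuclideanSpace ℝ κ,
      (1 + ‖P c x‖) ^ k * ‖iteratedFDeriv ℝ i (fun x => φ c (P c x)) x‖ ≤ C := by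
    refine ⟨(2 ^ k * (Finset.Iic (k, i)).sup (fun q => SchwartzMap.seminorm ℝ q.1 q.2) (φ c))
      * ‖P c‖ ^ i, fun x => ?_⟩
    have h1 : iteratedFDeriv ℝ i (fun x => φ c (P c x)) x =
        (iteratedFDeriv ℝ i (φ c) (P c x)).compContinuousLinearMap fun _ => P c :=
      (P c).iteratedFDeriv_comp_right ((φ c).smooth i) x le_rfl
    have h2 := ContinuousMultilinearMap.norm_compContinuousLinearMap_le
      (iteratedFDeriv ℝ i (φ c) (P c x)) (fun _ : Fin i => P c)
    rw [← h1, Finset.prod_const, Finset.card_univ, Fintype.card_fin] at h2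
    have h3 := SchwartzMap.one_add_le_sup_seminorm_apply (𝕜 := ℝ) (m := (k, i)) le_rfl le_rfl
      (φ c) (P c x)
    calc _ ≤ (1 + ‖P c x‖) ^ k * (‖iteratedFDeriv ℝ i (φ c) (P c x)‖ * ‖P c‖ ^ i) := by gcongr
      _ = ((1 + ‖P c x‖) ^ k * ‖iteratedFDeriv ℝ i (φ c) (P c x)‖) * ‖P c‖ ^ i := by ring
      _ ≤ _ := by gcongr
  choose C hC using hfac
  refine ⟨∑ p ∈ (Finset.univ : Finset κ).sym n, ((p : Multiset κ).countPerms : ℝ) *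
    ((Fintype.card κ : ℝ) ^ k * ∏ c, C c ((p : Multiset κ).count c)), fun x => ?_⟩
  have hleib := norm_iteratedFDeriv_prod_le (𝕜 := ℝ) (u := Finset.univ)
    (f := fun (c : κ) (x : EuclideanSpace ℝ κ) => φ c (P c x)) (N := n) (fun c _ => hsmooth c)
    (x := x) (n := n) le_rfl
  have hx : ‖x‖ ^ k ≤ (Fintype.card κ : ℝ) ^ k * ∏ c, (1 + ‖P c x‖) ^ k := by
    rw [Finset.prod_pow, ← mul_pow]
    exact pow_le_pow_left₀ (norm_nonneg _) (norm_le_card_mul_prod x) k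
  refine (mul_le_mul_of_nonneg_left hleib (by positivity)).trans ?_
  rw [Finset.mul_sum]
  refine Finset.sum_le_sum fun p _ => ?_
  rw [mul_left_comm]
  refine mul_le_mul_of_nonneg_left ?_ (by positivity)
  refine (mul_le_mul_of_nonneg_right hx (by positivity)).trans ?_
  rw [mul_assoc, ← Finset.prod_mul_distrib]
  refine mul_le_mul_of_nonneg_left ?_ (by positivity)
  exact Finset.prod_le_prod (fun _ _ => by positivity) fun c _ => hC c _ x

/-- The Schwartz function `x ↦ ∏_c φ_c (x_c)`. -/
def tensor (φ : κ → 𝓢(ℝ, ℂ)) : 𝓢(EuclideanSpace ℝ κ, ℂ) where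
  toFun x := ∏ c, φ c (x c)
  smooth' := contDiff_prod fun c _ =>
    ((φ c).smooth _).comp (EuclideanSpace.proj (𝕜 := ℝ) c).contDiff
  decay' := tensor_decay φ

@[simp] theorem tensor_apply (φ : κ → 𝓢(ℝ, ℂ)) (x : EuclideanSpace ℝ κ) :
    tensor φ x = ∏ c, φ c (x c) := rfl

theorem fourier_tensor (φ : κ → 𝓢(ℝ, ℂ)) (η : EuclideanSpace ℝ κ) :
    𝓕 (tensor φ) η = ∏ c, 𝓕 (φ c) (η c) := by
  rw [SchwartzMap.fourier_coe, Real.fourier_eq']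
  have h (c : κ) : 𝓕 (φ c) (η c) =
      ∫ t : ℝ, Complex.exp (↑(-2 * Real.pi * (t * η c)) * Complex.I) * φ c t := by
    rw [SchwartzMap.fourier_coe, Real.fourier_eq']
    simp [mul_comm]
  simp only [h]
  rw [← integral_fintype_prod_volume_eq_prod,
    ← (EuclideanSpace.volume_preserving_symm_measurableEquiv_toLp κ).integral_comp
      (MeasurableEquiv.measurableEmbedding _)]
  refine integral_congr_ae (Filter.Eventually.of_forall fun x => ?_)
  simp only [tensor_apply, smul_eq_mul, Finset.prod_mul_distrib, ← Complex.exp_sum]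
  congr 2
  simp only [PiLp.inner_apply, RCLike.inner_apply, conj_trivial, Complex.ofReal_mul, Finset.mul_sum,
    Complex.ofReal_sum, Finset.sum_mul]
  refine Finset.sum_congr rfl fun c _ => ?_
  simp
  ring

end Tensor

/-! ### The heat kernel on the line -/

theorem abs_pow_mul_exp_le (k : ℕ) (x : ℝ) :
    |x| ^ k * Real.exp (-(x ^ 2 / 2)) ≤ 1 + 2 ^ k * k.factorial := by
  have h1 : |x| ^ k ≤ 1 + (x ^ 2) ^ k := by
    rw [← sq_abs, ← pow_mul, mul_comm 2 k, pow_mul]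
    nlinarith [sq_nonneg (|x| ^ k - 1), abs_nonneg x, pow_nonneg (abs_nonneg x) k]
  have h2 : (x ^ 2) ^ k ≤ 2 ^ k * k.factorial * Real.exp (x ^ 2 / 2) := by
    have := Real.pow_div_factorial_le_exp (x ^ 2 / 2) (by positivity) k
    rw [div_le_iff₀ (by positivity), div_pow, div_le_iff₀ (by positivity)] at this
    linarith
  have h3 : Real.exp (x ^ 2 / 2) * Real.exp (-(x ^ 2 / 2)) = 1 := by
    rw [← Real.exp_add]; simp
  have h4 : Real.exp (-(x ^ 2 / 2)) ≤ 1 := Real.exp_le_one_iff.mpr (by nlinarith [sq_nonneg x])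
  have h5 := Real.exp_pos (-(x ^ 2 / 2))
  calc _ ≤ (1 + 2 ^ k * k.factorial * Real.exp (x ^ 2 / 2)) * Real.exp (-(x ^ 2 / 2)) := by
        gcongr; linarith
    _ = Real.exp (-(x ^ 2 / 2)) +
        2 ^ k * k.factorial * (Real.exp (x ^ 2 / 2) * Real.exp (-(x ^ 2 / 2))) := by ring
    _ ≤ _ := by rw [h3]; linarith

/-- The derivatives are Hermite polynomials times the Gaussian, so it suffices to bound monomials
times the Gaussian. -/
theorem gaussian_decay (k n : ℕ) : ∃ C : ℝ, ∀ x : ℝ,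
    ‖x‖ ^ k * ‖iteratedFDeriv ℝ n (fun x : ℝ => Real.exp (-(x ^ 2 / 2))) x‖ ≤ C := by
  let p : Polynomial ℝ := (Polynomial.hermite n).map (Int.castRingHom ℝ)
  have hp (x : ℝ) : Polynomial.aeval x (Polynomial.hermite n) =
      ∑ i ∈ p.support, p.coeff i * x ^ i := by
    rw [Polynomial.aeval_def, ← Polynomial.sum_def (f := fun i a => a * x ^ i),
      ← Polynomial.eval_eq_sum, Polynomial.eval_map]
    rfl
  refine ⟨∑ i ∈ p.support, |p.coeff i| * (1 + 2 ^ (k + i) * (k + i).factorial), fun x => ?_⟩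
  rw [norm_iteratedFDeriv_eq_norm_iteratedDeriv, iteratedDeriv_eq_iterate,
    Polynomial.deriv_gaussian_eq_hermite_mul_gaussian, hp, norm_mul, norm_mul, norm_pow, norm_neg,
    norm_one, one_pow, one_mul, Real.norm_eq_abs, Real.norm_eq_abs, Real.norm_eq_abs, Real.abs_exp]
  have h1 : |∑ i ∈ p.support, p.coeff i * x ^ i| ≤ ∑ i ∈ p.support, |p.coeff i| * |x| ^ i := by
    refine (Finset.abs_sum_le_sum_abs _ _).trans (Finset.sum_le_sum fun i _ => ?_)
    rw [abs_mul, abs_pow]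
  calc _ ≤ |x| ^ k * ((∑ i ∈ p.support, |p.coeff i| * |x| ^ i) * Real.exp (-(x ^ 2 / 2))) := by
        gcongr
    _ = ∑ i ∈ p.support, |p.coeff i| * (|x| ^ (k + i) * Real.exp (-(x ^ 2 / 2))) := by
        rw [Finset.sum_mul, Finset.mul_sum]
        refine Finset.sum_congr rfl fun i _ => ?_
        ring
    _ ≤ _ := by
        gcongr with i
        exact abs_pow_mul_exp_le (k + i) x

/-- The function `exp (-x² / 2)` as a Schwartz function. -/
def stdGaussian : 𝓢(ℝ, ℝ) where
  toFun x := Real.exp (-(x ^ 2 / 2))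
  smooth' := by fun_prop
  decay' := gaussian_decay

/-- The heat kernel at time `v`. -/
def heat (v x : ℝ) : ℝ := (Real.sqrt (4 * Real.pi * v))⁻¹ * Real.exp (-(x ^ 2 / (4 * v)))

/-- The derivative of the heat kernel at time `v`. -/
def heatDeriv (v x : ℝ) : ℝ := -(x / (2 * v)) * heat v x

theorem heat_nonneg (v x : ℝ) : 0 ≤ heat v x := by unfold heat; positivity

theorem hasDerivAt_heat {v : ℝ} (hv : 0 < v) (x : ℝ) :
    HasDerivAt (heat v) (heatDeriv v x) x := by
  have h : HasDerivAt (fun x : ℝ => -(x ^ 2 / (4 * v))) (-(x / (2 * v))) x := by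
    have h1 := ((hasDerivAt_pow 2 x).div_const (4 * v)).neg
    refine h1.congr_deriv ?_
    field_simp
    push_cast
    ring
  refine (h.exp.const_mul (Real.sqrt (4 * Real.pi * v))⁻¹).congr_deriv ?_
  unfold heatDeriv heat
  ring

theorem exists_schwartz_heat {v : ℝ} (hv : 0 < v) :
    ∃ φ : 𝓢(ℝ, ℂ), (∀ x, φ x = heat v x) ∧
      ∀ ξ, 𝓕 φ ξ = Real.exp (-(4 * Real.pi ^ 2 * v * ξ ^ 2)) := by
  have hs : (Real.sqrt (2 * v)) ≠ 0 := by positivity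
  -- The dilation by (2v)^(-1/2) turns exp(-x²/2) into exp(-x²/(4v)).
  let e : ℝ ≃L[ℝ] ℝ := ContinuousLinearEquiv.unitsEquivAut ℝ (Units.mk0 _ (inv_ne_zero hs))
  let φ : 𝓢(ℝ, ℂ) := ((((Real.sqrt (4 * Real.pi * v))⁻¹ : ℝ) : ℂ)) •
    (stdGaussian.compCLMOfContinuousLinearEquiv ℝ e).postcompCLM Complex.ofRealCLM
  have hφ (x : ℝ) : φ x = heat v x := by
    have he : e x = x * (Real.sqrt (2 * v))⁻¹ := rfl
    have h1 : stdGaussian (e x) = Real.exp (-(x ^ 2 / (4 * v))) := by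
      change Real.exp (-((e x) ^ 2 / 2)) = _
      rw [he, mul_pow, inv_pow, Real.sq_sqrt (by positivity)]
      congr 2
      field_simp
      norm_num
    change ((((Real.sqrt (4 * Real.pi * v))⁻¹ : ℝ) : ℂ)) * ((stdGaussian (e x) : ℝ) : ℂ) = _
    rw [h1, heat]
    push_cast
    rfl
  refine ⟨φ, hφ, fun ξ => ?_⟩
  rw [SchwartzMap.fourier_coe]
  let b : ℝ := 1 / (4 * Real.pi * v)
  have hb0 : 0 < b := by positivity
  have hb : 0 < ((b : ℝ) : ℂ).re := by rwa [Complex.ofReal_re]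
  have h := congrFun (fourier_gaussian_pi hb) ξ
  have h2 : (φ : ℝ → ℂ) = (((Real.sqrt (4 * Real.pi * v))⁻¹ : ℝ) : ℂ) •
      fun x : ℝ => Complex.exp (-Real.pi * (b : ℂ) * (x : ℂ) ^ 2) := by
    ext x
    rw [hφ, heat, Pi.smul_apply, smul_eq_mul]
    push_cast
    congr 2
    simp only [b]
    push_cast
    have : (Real.pi : ℂ) ≠ 0 := by exact_mod_cast Real.pi_ne_zero
    have : (v : ℂ) ≠ 0 := by exact_mod_cast hv.ne'
    field_simp
  have h3 : (b : ℂ) ^ (1 / 2 : ℂ) = ((Real.sqrt (4 * Real.pi * v))⁻¹ : ℝ) := by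
    rw [← Real.sqrt_inv, Real.sqrt_eq_rpow, Complex.ofReal_cpow (by positivity)]
    simp [b]
  have h4 : (Real.pi : ℂ) ≠ 0 := by exact_mod_cast Real.pi_ne_zero
  have h5 : (v : ℂ) ≠ 0 := by exact_mod_cast hv.ne'
  have h6 : (Real.sqrt (4 * Real.pi * v))⁻¹ ≠ 0 := by positivity
  rw [h2, show 𝓕 ((((Real.sqrt (4 * Real.pi * v))⁻¹ : ℝ) : ℂ) •
      fun x : ℝ => Complex.exp (-Real.pi * (b : ℂ) * (x : ℂ) ^ 2)) = _ from
      VectorFourier.fourierIntegral_const_smul _ _ _ _ _, Pi.smul_apply]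
  rw [show VectorFourier.fourierIntegral Real.fourierChar volume (innerₗ ℝ)
    (fun x : ℝ => Complex.exp (-Real.pi * (b : ℂ) * (x : ℂ) ^ 2)) ξ = _ from h, h3, smul_eq_mul,
    ← mul_assoc, mul_one_div_cancel (by exact_mod_cast h6), one_mul]
  push_cast
  congr 1
  simp only [b]
  push_cast
  field_simp

theorem exists_schwartz_heatDeriv {v : ℝ} (hv : 0 < v) :
    ∃ φ : 𝓢(ℝ, ℂ), (∀ x, φ x = heatDeriv v x) ∧
      ∀ ξ, 𝓕 φ ξ = 2 * Real.pi * Complex.I * ξ * Real.exp (-(4 * Real.pi ^ 2 * v * ξ ^ 2)) := by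
  obtain ⟨φ, h1, h2⟩ := exists_schwartz_heat hv
  have hd (x : ℝ) : HasDerivAt φ (heatDeriv v x : ℂ) x := by
    have : (φ : ℝ → ℂ) = fun x => ((heat v x : ℝ) : ℂ) := funext h1
    rw [this]
    exact (hasDerivAt_heat hv x).ofReal_comp
  refine ⟨SchwartzMap.derivCLM ℂ ℂ φ, fun x => ?_, fun ξ => ?_⟩
  · rw [SchwartzMap.derivCLM_apply, (hd x).deriv]
  · have h3 : ((SchwartzMap.derivCLM ℂ ℂ φ : 𝓢(ℝ, ℂ)) : ℝ → ℂ) = deriv φ :=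
      funext fun x => SchwartzMap.derivCLM_apply ..
    rw [SchwartzMap.fourier_coe, h3, Real.fourier_deriv φ.integrable φ.differentiable
      (by rw [← h3]; exact (SchwartzMap.derivCLM ℂ ℂ φ).integrable), ← SchwartzMap.fourier_coe]
    simp only [h2, smul_eq_mul]

theorem exists_schwartz_shift (φ : 𝓢(ℝ, ℂ)) (z : ℝ) :
    ∃ ψ : 𝓢(ℝ, ℂ), (∀ x, ψ x = φ (x - z)) ∧
      ∀ ξ, 𝓕 ψ ξ = Complex.exp (-(2 * Real.pi * Complex.I * (z * ξ : ℝ))) * 𝓕 φ ξ := by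
  refine ⟨SchwartzMap.compSubConstCLM ℂ z φ, fun x => SchwartzMap.compSubConstCLM_apply .., ?_⟩
  intro ξ
  rw [SchwartzMap.fourier_coe, SchwartzMap.fourier_coe, Real.fourier_eq', Real.fourier_eq',
    ← integral_add_right_eq_self _ z, ← integral_const_mul]
  refine integral_congr_ae (Filter.Eventually.of_forall fun x => ?_)
  simp only [SchwartzMap.compSubConstCLM_apply, add_sub_cancel_right, smul_eq_mul, ← mul_assoc,
    ← Complex.exp_add]
  congr 2
  simp
  ring

/-- From x² ≤ 2(x + c)² + 2c² the shifted Gaussian is at most e^(1/4) times the centred one at time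
2wv. Here c² ≤ wv bounds the extra exponent by 1/4, and e^(1/4) ≤ 3/√2. The ratio √(2w) of the
normalizations gives the remaining factor. A shift is thus exchanged for a wider kernel at a
polynomial cost. -/
theorem heat_add_le {v w c : ℝ} (hv : 0 < v) (hw : 1 ≤ w) (hc : c ^ 2 ≤ w * v) (x : ℝ) :
    heat v (x + c) ≤ 3 * Real.sqrt w * heat (2 * w * v) x := by
  unfold heat
  have h0 : Real.sqrt (4 * Real.pi * (2 * w * v)) =
      Real.sqrt 2 * Real.sqrt w * Real.sqrt (4 * Real.pi * v) := by
    rw [← Real.sqrt_mul (by norm_num), ← Real.sqrt_mul (by positivity)]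
    congr 1
    ring
  have h1 : -((x + c) ^ 2 / (4 * v)) ≤ 1 / 4 + -(x ^ 2 / (4 * (2 * w * v))) := by
    have h2 : x ^ 2 / (4 * (2 * w * v)) ≤ ((x + c) ^ 2 + c ^ 2) / (4 * (w * v)) := by
      rw [div_le_div_iff₀ (by positivity) (by positivity)]
      have : x ^ 2 ≤ 2 * ((x + c) ^ 2 + c ^ 2) := by nlinarith [sq_nonneg (x + 2 * c)]
      have h3 : 0 < w * v := by positivity
      nlinarith
    have h3 : (x + c) ^ 2 / (4 * (w * v)) ≤ (x + c) ^ 2 / (4 * v) := by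
      apply div_le_div_of_nonneg_left (by positivity) (by positivity)
      nlinarith
    have h4 : c ^ 2 / (4 * (w * v)) ≤ 1 / 4 := by
      rw [div_le_div_iff₀ (by positivity) (by positivity)]
      linarith
    rw [add_div] at h2
    linarith
  have h5 : Real.exp (-((x + c) ^ 2 / (4 * v))) ≤
      3 / Real.sqrt 2 * Real.exp (-(x ^ 2 / (4 * (2 * w * v)))) := by
    refine (Real.exp_le_exp.mpr h1).trans ?_
    rw [Real.exp_add]
    gcongr
    have h6 : Real.exp (1 / 4) ≤ 2 := by
      have := Real.exp_one_lt_three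
      have h7 : Real.exp (1/4) ^ 4 = Real.exp 1 := by rw [← Real.exp_nat_mul]; norm_num
      by_contra! h8
      have : (2:ℝ) ^ 4 < Real.exp (1/4) ^ 4 := by gcongr
      linarith
    have h9 : Real.sqrt 2 ≤ 3 / 2 := Real.sqrt_le_iff.mpr ⟨by norm_num, by norm_num⟩
    rw [le_div_iff₀ (by positivity)]
    nlinarith [Real.sqrt_nonneg 2, Real.exp_pos (1/4)]
  rw [h0]
  calc _ ≤ (Real.sqrt (4 * Real.pi * v))⁻¹ *
          (3 / Real.sqrt 2 * Real.exp (-(x ^ 2 / (4 * (2 * w * v))))) := by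
        gcongr
    _ = _ := by
        have : Real.sqrt 2 ≠ 0 := by positivity
        have : Real.sqrt w ≠ 0 := by positivity
        have : Real.sqrt (4 * Real.pi * v) ≠ 0 := by positivity
        field_simp

theorem continuous_heat (v : ℝ) : Continuous (heat v) := by unfold heat; fun_prop

theorem continuous_heatDeriv (v : ℝ) : Continuous (heatDeriv v) := by
  unfold heatDeriv heat; fun_prop

end SingularBL

end

noncomputable section

namespace SingularBL

/-! ### The push-forward as a fibre integral -/

/-- Uniqueness of Haar measure. Only the existence and positivity of the Jacobian are used later,
never its value. -/
theorem exists_integral_continuousLinearEquiv {A B : Type*}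
    [NormedAddCommGroup A] [NormedSpace ℝ A] [FiniteDimensional ℝ A] [MeasurableSpace A]
    [BorelSpace A] [NormedAddCommGroup B] [NormedSpace ℝ B] [FiniteDimensional ℝ B]
    [MeasurableSpace B] [BorelSpace B] (μ : Measure A) [μ.IsAddHaarMeasure]
    (ν : Measure B) [ν.IsAddHaarMeasure] (e : A ≃L[ℝ] B) :
    ∃ J : ℝ, 0 < J ∧ ∀ {V : Type} [NormedAddCommGroup V] [NormedSpace ℝ V] (f : B → V),
      ∫ b, f b ∂ν = J • ∫ a, f (e a) ∂μ := by
  have hmap : (μ.map e).IsAddHaarMeasure := e.isAddHaarMeasure_map μ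
  refine ⟨Measure.addHaarScalarFactor ν (μ.map e),
    NNReal.coe_pos.mpr (Measure.addHaarScalarFactor_pos_of_isAddHaarMeasure _ _), ?_⟩
  intro V _ _ f
  conv_lhs => rw [Measure.isAddLeftInvariant_eq_smul ν (μ.map e)]
  rw [integral_smul_nnreal_measure, NNReal.smul_def]
  congr 1
  exact e.toHomeomorph.measurableEmbedding.integral_map f

section Fibre

variable {E G H : Type*}
  [NormedAddCommGroup E] [InnerProductSpace ℝ E]
  [NormedAddCommGroup G] [InnerProductSpace ℝ G] [FiniteDimensional ℝ G]
  [NormedAddCommGroup H] [InnerProductSpace ℝ H] [FiniteDimensional ℝ H]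

/-- If `ℓ` and `σ` parametrize the kernel of `L` and a complement of it, then `(p, y) ↦ ℓ p + σ y`
is an equivalence. -/
theorem exists_fibre_equiv (L : E →ₗ[ℝ] G) (ℓ : H →ₗ[ℝ] E)
    (hℓ : Function.Injective ℓ) (hker : LinearMap.range ℓ = LinearMap.ker L) (σ : G →ₗ[ℝ] E)
    (hσ : L ∘ₗ σ = LinearMap.id) :
    ∃ e : (H × G) ≃L[ℝ] E, ∀ p y, e (p, y) = ℓ p + σ y := by
  have hLσ (y : G) : L (σ y) = y := LinearMap.congr_fun hσ y
  have hLℓ (p : H) : L (ℓ p) = 0 := LinearMap.mem_ker.mp (hker ▸ LinearMap.mem_range_self ℓ p)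
  have hbij : Function.Bijective (ℓ.coprod σ) := by
    constructor
    · rw [injective_iff_map_eq_zero]
      rintro ⟨p, y⟩ h
      rw [LinearMap.coprod_apply] at h
      have hy : y = 0 := by
        have := congrArg L h
        simpa [hLσ, hLℓ] using this
      rw [hy, map_zero, add_zero] at h
      rw [hy, (injective_iff_map_eq_zero ℓ).mp hℓ p h]
      rfl
    · intro x
      have : x - σ (L x) ∈ LinearMap.range ℓ := by
        rw [hker, LinearMap.mem_ker, map_sub, hLσ, sub_self]
      obtain ⟨p, hp⟩ := this
      exact ⟨(p, L x), by rw [LinearMap.coprod_apply, hp]; abel⟩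
  exact ⟨(LinearEquiv.ofBijective _ hbij).toContinuousLinearEquiv, fun p y => rfl⟩

variable [FiniteDimensional ℝ E]
  [MeasurableSpace E] [BorelSpace E] [MeasurableSpace G] [BorelSpace G]
  [MeasurableSpace H] [BorelSpace H]

/-- The push-forward is defined through the Fourier transform. Here it is identified pointwise with
the integral over the fibre, because both sides are continuous and have the same integrals against
all test functions. -/
theorem exists_pushforward_eq (L : E →ₗ[ℝ] G) (hL : Function.Surjective L) (ℓ : H →ₗ[ℝ] E)
    (hℓ : Function.Injective ℓ) (hker : LinearMap.range ℓ = LinearMap.ker L) :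
    ∃ J : ℝ, 0 < J ∧ ∀ (Ψ : 𝓢(E, ℂ)) (x : E),
      pushforward L hL Ψ (L x) = J * ∫ p, Ψ (x - ℓ p) := by
  obtain ⟨σ, hσ⟩ := L.exists_rightInverse_of_surjective (LinearMap.range_eq_top.mpr hL)
  have hLσ (y : G) : L (σ y) = y := LinearMap.congr_fun hσ y
  have hLℓ (p : H) : L (ℓ p) = 0 := LinearMap.mem_ker.mp (hker ▸ LinearMap.mem_range_self ℓ p)
  obtain ⟨e, he⟩ := exists_fibre_equiv L ℓ hℓ hker σ hσ
  obtain ⟨J, hJ, hint⟩ := exists_integral_continuousLinearEquiv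
    ((volume : Measure H).prod (volume : Measure G)) (volume : Measure E) e
  refine ⟨J, hJ, fun Ψ x => ?_⟩
  let Θ : 𝓢(H × G, ℂ) := Ψ.compCLMOfContinuousLinearEquiv ℝ e
  have hΘ (p : H) (y : G) : Θ (p, y) = Ψ (ℓ p + σ y) := by rw [← he]; rfl
  have hcont : Continuous fun y => ∫ p, Θ (p, y) := by
    -- A decay exponent above dim H provides an integrable majorant independent of y.
    let k : ℕ := Module.finrank ℝ H + 1
    let C : ℝ := 2 ^ k * (Finset.Iic (k, 0)).sup (fun q => SchwartzMap.seminorm ℝ q.1 q.2) Θ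
    refine continuous_of_dominated (bound := fun p => C * (1 + ‖p‖) ^ (-(k : ℝ)))
      (fun y => ?_) (fun y => ?_) ?_ ?_
    · exact (Θ.continuous.comp (by fun_prop)).aestronglyMeasurable
    · refine Filter.Eventually.of_forall fun p => ?_
      have h1 := SchwartzMap.one_add_le_sup_seminorm_apply (𝕜 := ℝ) (m := (k, 0)) le_rfl le_rfl
        Θ (p, y)
      rw [norm_iteratedFDeriv_zero] at h1
      rw [Real.rpow_neg (by positivity), Real.rpow_natCast, ← div_eq_mul_inv,
        le_div_iff₀ (by positivity), mul_comm]
      refine le_trans ?_ h1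
      gcongr
      exact norm_fst_le (p, y)
    · exact (integrable_one_add_norm (by simp [k])).const_mul C
    · exact Filter.Eventually.of_forall fun p => Θ.continuous.comp (by fun_prop)
  have hae : ∀ᵐ y : G, pushforward L hL Ψ y = J * ∫ p, Θ (p, y) := by
    refine ae_eq_of_integral_contDiff_smul_eq
      (pushforward L hL Ψ).continuous.locallyIntegrable
      (continuous_const.mul hcont).locallyIntegrable fun g hg hgs => ?_
    have hgc : ContDiff ℝ ((⊤ : ℕ∞) : WithTop ℕ∞) fun y => (g y : ℂ) :=
      Complex.ofRealCLM.contDiff.comp hg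
    have hgsc : HasCompactSupport fun y => (g y : ℂ) := hgs.comp_left Complex.ofReal_zero
    let γ : 𝓢(G, ℂ) := hgsc.toSchwartzMap hgc
    have hγ (y : G) : γ y = g y := rfl
    have h1 := integral_pushforward_mul L hL Ψ γ
    have h2 : ∫ x, Ψ x * γ (L x) =
        J • ∫ q : H × G, Θ q * γ q.2 ∂(volume.prod volume) := by
      rw [hint]
      congr 1
      refine integral_congr_ae (Filter.Eventually.of_forall fun q => ?_)
      obtain ⟨p, y⟩ := q
      simp only [he, map_add, hLσ, hLℓ, zero_add, hΘ]
    have h3 : Integrable (fun q : H × G => Θ q * γ q.2) (volume.prod volume) := by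
      refine Integrable.mul_bdd (c := SchwartzMap.seminorm ℝ 0 0 γ) Θ.integrable
        (γ.continuous.comp continuous_snd).aestronglyMeasurable ?_
      exact Filter.Eventually.of_forall fun q => γ.norm_le_seminorm ℝ _
    rw [integral_prod_symm _ h3] at h2
    calc _ = ∫ y, pushforward L hL Ψ y * γ y := by
          refine integral_congr_ae (Filter.Eventually.of_forall fun y => ?_)
          simp [hγ, mul_comm]
      _ = _ := by
          rw [h1, h2, ← integral_smul J]
          refine integral_congr_ae (Filter.Eventually.of_forall fun y => ?_)
          simp only [integral_mul_const, hγ, Complex.real_smul]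
          ring
  have heq := (Continuous.ae_eq_iff_eq volume (pushforward L hL Ψ).continuous
    (continuous_const.mul hcont)).mp hae
  rw [heq]
  simp only [hΘ]
  refine congrArg (fun r : ℂ => J * r) ?_
  have : x - σ (L x) ∈ LinearMap.range ℓ := by
    rw [hker, LinearMap.mem_ker, map_sub, hLσ, sub_self]
  obtain ⟨q, hq⟩ := this
  change ∫ p, Ψ (ℓ p + σ (L x)) = _
  -- The base point σ (L x) differs from x by the element ℓ q of the kernel; a reflection and
  -- translation of p absorbs it.
  rw [← integral_sub_left_eq_self (fun p => Ψ (ℓ p + σ (L x))) volume q]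
  refine integral_congr_ae (Filter.Eventually.of_forall fun p => ?_)
  simp only [map_sub, hq]
  congr 1
  abel

/-- The pairing of `φ` with a multiplier that is itself a Fourier transform. -/
theorem integral_fourier_mul_fourier_comp_transpose (L : E →ₗ[ℝ] G) (hL : Function.Surjective L)
    (Φ Ψ : 𝓢(E, ℂ)) :
    ∫ ξ, 𝓕 Φ (-transposeCLM L ξ) * 𝓕 Ψ (transposeCLM L ξ) =
      ∫ x, Φ x * pushforward L hL Ψ (L x) := by
  rw [← integral_pushforward_mul L hL]
  have h1 := SchwartzMap.integral_fourier_mul_eq (pushforward L hL Ψ) (𝓕⁻ (pushforward L hL Φ))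
  rw [FourierTransform.fourier_fourierInv_eq] at h1
  simp only [mul_comm (pushforward L hL Φ _), ← h1]
  refine integral_congr_ae (Filter.Eventually.of_forall fun ξ => ?_)
  simp only
  rw [fourier_pushforward, SchwartzMap.fourierInv_coe, Real.fourierInv_eq_fourier_neg,
    ← SchwartzMap.fourier_coe, fourier_pushforward,
    (transposeCLM L).map_neg, mul_comm]

end Fibre

end SingularBL

end

noncomputable section

namespace SingularBL

/-! ### Linear algebra of the cubical projections -/

section LinearAlgebra

variable {m : ℕ}

theorem inner_adjoint_cubeProj (j : Cube m) (y : Rm m) (x : R2m m) :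
    inner ℝ (LinearMap.adjoint (cubeProj j) y) x = ∑ i, y i * x (j i, i) := by
  rw [LinearMap.adjoint_inner_left, PiLp.inner_apply]
  simp [mul_comm]

theorem adjoint_cubeProj_apply (j : Cube m) (y : Rm m) (c : Fin 2 × Fin m) :
    LinearMap.adjoint (cubeProj j) y c = if c.1 = j c.2 then y c.2 else 0 := by
  have h := inner_adjoint_cubeProj j y (EuclideanSpace.single c 1)
  rw [EuclideanSpace.inner_single_right] at h
  simp only [one_mul, conj_trivial] at h
  rw [h]
  obtain ⟨a, i⟩ := c
  simp only [PiLp.single_apply, Prod.mk.injEq]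
  by_cases ha : a = j i
  · rw [if_pos ha, Finset.sum_eq_single i]
    · simp [ha]
    · intro b _ hb; simp [hb]
    · simp
  · rw [if_neg ha]
    refine Finset.sum_eq_zero fun b _ => ?_
    rw [if_neg, mul_zero]
    rintro ⟨h1, rfl⟩
    exact ha h1.symm

/-- The opposite vertex of the cube. -/
def opp (j : Cube m) : Cube m := fun i => 1 - j i

theorem fin_two_eq_or (a b : Fin 2) : a = b ∨ a = 1 - b := by omega

theorem fin_two_ne (b : Fin 2) : b ≠ 1 - b := by omega

@[simp] theorem opp_apply (j : Cube m) (i : Fin m) : opp j i = 1 - j i := rfl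

@[simp] theorem opp_opp (j : Cube m) : opp (opp j) = j := by
  funext i; simp [opp]

theorem cubeProj_adjoint (j : Cube m) (y : Rm m) :
    cubeProj j (LinearMap.adjoint (cubeProj j) y) = y := by
  ext i
  rw [cubeProj_apply, adjoint_cubeProj_apply]
  simp

theorem cubeProj_adjoint_opp (j : Cube m) (y : Rm m) :
    cubeProj (opp j) (LinearMap.adjoint (cubeProj j) y) = 0 := by
  ext i
  rw [cubeProj_apply, adjoint_cubeProj_apply]
  simp [(fin_two_ne (j i)).symm]

theorem eq_adjoint_of_cubeProj_opp_eq_zero (j : Cube m) (x : R2m m)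
    (hx : cubeProj (opp j) x = 0) : x = LinearMap.adjoint (cubeProj j) (cubeProj j x) := by
  ext ⟨a, i⟩
  rw [adjoint_cubeProj_apply]
  split_ifs with h
  · simp only at h; rw [h]; rfl
  · have h1 : a = 1 - j i := (fin_two_eq_or a (j i)).resolve_left h
    have h2 := congrArg (fun y : Rm m => y i) hx
    rw [h1]
    simpa using h2

/-- The range of Π_j^T is exactly the kernel of the projection at the opposite vertex. Injectivity
of Π Π_j^T therefore says that ker Π meets that kernel trivially, and injectivity suffices since
source and target are both ℝ^m. -/
theorem bijective_comp_adjoint_iff (L : R2m m →ₗ[ℝ] Rm m) (j : Cube m) :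
    Function.Bijective (L ∘ₗ LinearMap.adjoint (cubeProj j)) ↔
      ∀ x ∈ LinearMap.ker L, cubeProj (opp j) x = 0 → x = 0 := by
  have h : Function.Bijective (L ∘ₗ LinearMap.adjoint (cubeProj j)) ↔
      Function.Injective (L ∘ₗ LinearMap.adjoint (cubeProj j)) :=
    ⟨fun h => h.1, fun h => ⟨h, LinearMap.injective_iff_surjective.mp h⟩⟩
  rw [h, injective_iff_map_eq_zero]
  constructor
  · intro h x hx hx0
    have h1 := eq_adjoint_of_cubeProj_opp_eq_zero j x hx0
    rw [h1, h (cubeProj j x), map_zero]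
    rw [LinearMap.comp_apply, ← h1]
    exact hx
  · intro h y hy
    have h1 := h _ hy (cubeProj_adjoint_opp j y)
    rw [← cubeProj_adjoint j y, h1, map_zero]

theorem forall_bijective_iff (L : R2m m →ₗ[ℝ] Rm m) :
    (∀ j : Cube m, Function.Bijective (L ∘ₗ LinearMap.adjoint (cubeProj j))) ↔
      ∀ j : Cube m, ∀ x ∈ LinearMap.ker L, cubeProj j x = 0 → x = 0 := by
  simp only [bijective_comp_adjoint_iff]
  exact ⟨fun h j => by simpa using h (opp j), fun h j => h (opp j)⟩

theorem finrank_ker_eq (L : R2m m →ₗ[ℝ] Rm m) (hL : Function.Surjective L) :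
    Module.finrank ℝ (LinearMap.ker L) = m := by
  have h := LinearMap.finrank_range_add_finrank_ker L
  rw [LinearMap.range_eq_top.mpr hL, finrank_top, finrank_euclideanSpace, finrank_euclideanSpace]
    at h
  simp only [Fintype.card_fin, Fintype.card_prod] at h
  omega

theorem finrank_map_eq_iff (V : Submodule ℝ (R2m m)) (j : Cube m) :
    Module.finrank ℝ (V.map (cubeProj j)) = Module.finrank ℝ V ↔
      ∀ x ∈ V, cubeProj j x = 0 → x = 0 := by
  have h := LinearMap.finrank_range_add_finrank_ker ((cubeProj j).domRestrict V)
  rw [LinearMap.range_domRestrict] at h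
  constructor
  · intro h1 x hx hx0
    have h2 : LinearMap.ker ((cubeProj j).domRestrict V) = ⊥ := by
      rw [← Submodule.finrank_eq_zero (R := ℝ)]; omega
    have h3 : (⟨x, hx⟩ : V) ∈ LinearMap.ker ((cubeProj j).domRestrict V) := hx0
    rw [h2, Submodule.mem_bot] at h3
    exact congrArg Subtype.val h3
  · intro h1
    have h2 : LinearMap.ker ((cubeProj j).domRestrict V) = ⊥ := by
      rw [LinearMap.ker_eq_bot']
      intro x hx
      exact Subtype.ext (h1 x x.2 hx)
    rw [h2, finrank_bot] at h
    omega

/-- There are 2^m vertices, so the weights sum to 1, and dim Π_j V ≤ dim V. Equality for V = ker Π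
thus forces equality in every term. Conversely, injectivity on ker Π passes to all its subspaces and
gives equality for each of them. -/
theorem dimension_condition_iff (L : R2m m →ₗ[ℝ] Rm m) :
    ((∀ V : Submodule ℝ (R2m m), V ≤ LinearMap.ker L →
        (Module.finrank ℝ V : ℝ) ≤ ∑ j : Cube m,
          ((2 : ℝ) ^ m)⁻¹ * Module.finrank ℝ (V.map (cubeProj j))) ∧
      (Module.finrank ℝ (LinearMap.ker L) : ℝ) = ∑ j : Cube m,
        ((2 : ℝ) ^ m)⁻¹ * Module.finrank ℝ ((LinearMap.ker L).map (cubeProj j))) ↔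
      ∀ j : Cube m, ∀ x ∈ LinearMap.ker L, cubeProj j x = 0 → x = 0 := by
  have hsum (a : ℝ) : ∑ j : Cube m, ((2 : ℝ) ^ m)⁻¹ * a = a := by
    simp
  constructor
  · rintro ⟨-, h⟩ j
    rw [← finrank_map_eq_iff]
    rw [← hsum (Module.finrank ℝ (LinearMap.ker L) : ℝ)] at h
    have hle (j : Cube m) : ((2 : ℝ) ^ m)⁻¹ *
        Module.finrank ℝ ((LinearMap.ker L).map (cubeProj j)) ≤
        ((2 : ℝ) ^ m)⁻¹ * Module.finrank ℝ (LinearMap.ker L) := by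
      gcongr
      exact Submodule.finrank_map_le _ _
    have h1 := (Finset.sum_eq_sum_iff_of_le fun j _ => hle j).mp h.symm j (Finset.mem_univ j)
    exact_mod_cast mul_left_cancel₀ (by positivity : ((2 : ℝ) ^ m)⁻¹ ≠ 0) h1
  · intro h
    have key (V : Submodule ℝ (R2m m)) (hV : V ≤ LinearMap.ker L) :
        (Module.finrank ℝ V : ℝ) = ∑ j : Cube m,
          ((2 : ℝ) ^ m)⁻¹ * Module.finrank ℝ (V.map (cubeProj j)) := by
      have h1 (j : Cube m) : Module.finrank ℝ (V.map (cubeProj j)) = Module.finrank ℝ V :=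
        (finrank_map_eq_iff V j).mpr fun x hx => h j x (hV hx)
      simp only [h1, hsum]
    exact ⟨fun V hV => (key V hV).le, key _ le_rfl⟩

/-- The kernel of a surjective map `ℝ^{2m} → ℝ^m` can be parametrized by `ℝ^m`. -/
theorem exists_ker_param (L : R2m m →ₗ[ℝ] Rm m) (hL : Function.Surjective L) :
    ∃ ℓ : Rm m →ₗ[ℝ] R2m m, Function.Injective ℓ ∧ LinearMap.range ℓ = LinearMap.ker L := by
  have h : Module.finrank ℝ (Rm m) = Module.finrank ℝ (LinearMap.ker L) := by
    rw [finrank_ker_eq L hL]; simp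
  let e := LinearEquiv.ofFinrankEq _ _ h
  refine ⟨(LinearMap.ker L).subtype ∘ₗ e.toLinearMap, ?_, ?_⟩
  · exact (Submodule.injective_subtype _).comp e.injective
  · rw [LinearMap.range_comp, LinearEquiv.range, Submodule.map_top, Submodule.range_subtype]

end LinearAlgebra

/-! ### Necessity of the invertibility condition -/

section Necessity

variable {m : ℕ}

/-- The transform of δ is the constant 1, so δ is admissible for every order and the necessity
argument works for any N. -/
theorem isCZKernel_delta (N : ℕ) : IsCZKernel N (TemperedDistribution.delta (0 : Rm m)) := by
  refine ⟨fun _ => 1, measurable_const, fun φ => ?_, contDiffOn_const, ?_⟩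
  · rw [TemperedDistribution.fourier_delta_zero]
    simp
  · intro n _ β ξ hξ
    rcases Nat.eq_zero_or_pos n with rfl | hn
    · simp
    · rw [iteratedFDeriv_const_of_ne hn.ne']
      simp

theorem exists_schwartz_gaussian_mul (w : Rm m) (R : ℝ) (hR : 0 ≤ R) :
    ∃ F : 𝓢(Rm m, ℂ), ∀ y, F y =
      ((Real.exp (-(∑ i, y i ^ 2 / 2)) * Real.exp (-(R * (inner ℝ w y) ^ 2)) : ℝ) : ℂ) := by
  let γ : 𝓢(ℝ, ℂ) := stdGaussian.postcompCLM Complex.ofRealCLM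
  have hγ (s : ℝ) : γ s = ((Real.exp (-(s ^ 2 / 2)) : ℝ) : ℂ) := rfl
  let G : 𝓢(Rm m, ℂ) := tensor fun _ => γ
  -- The factor √(2R) compensates the 1/2 in the exponent of the standard Gaussian.
  let A : Rm m →L[ℝ] ℝ := innerSL ℝ (Real.sqrt (2 * R) • w)
  have hA : Function.HasTemperateGrowth fun y => γ (A y) :=
    γ.hasTemperateGrowth.comp A.hasTemperateGrowth
  refine ⟨SchwartzMap.smulLeftCLM ℂ (fun y => γ (A y)) G, fun y => ?_⟩
  rw [SchwartzMap.smulLeftCLM_apply_apply hA, smul_eq_mul, mul_comm]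
  have h1 : A y = Real.sqrt (2 * R) * inner ℝ w y := by
    simp [A]
  simp only [G, tensor_apply, hγ, h1, mul_pow, Real.sq_sqrt (show 0 ≤ 2 * R by positivity)]
  push_cast
  rw [← Complex.exp_sum]
  congr 2
  · simp
  · ring

theorem toReal_eLpNorm_pow (f : 𝓢(Rm m, ℂ)) :
    (eLpNorm f (2 ^ m) volume).toReal ^ (2 ^ m) = ∫ y, ‖f y‖ ^ (2 ^ m) := by
  have hp0 : (2 ^ m : ENNReal) ≠ 0 := by positivity
  have hpt : (2 ^ m : ENNReal) ≠ ⊤ := ENNReal.pow_ne_top ENNReal.ofNat_ne_top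
  have hr : (2 ^ m : ENNReal).toReal = ((2 ^ m : ℕ) : ℝ) := by simp
  rw [MemLp.eLpNorm_eq_integral_rpow_norm hp0 hpt (f.memLp _ _),
    ENNReal.toReal_ofReal (by positivity), hr, Real.rpow_inv_natCast_pow (by positivity)
    (by positivity)]
  simp only [Real.rpow_natCast]

theorem singularForm_delta (L : R2m m →ₗ[ℝ] Rm m) (hL : Function.Surjective L)
    (F : Cube m → 𝓢(Rm m, ℂ)) :
    singularForm L hL (TemperedDistribution.delta 0) F = pushforward L hL (cubeProd F) 0 := by
  rw [singularForm, pullback_apply, TemperedDistribution.delta_apply]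

/-- The integrand tends to 0 off the hyperplane orthogonal to w, which is a null set since w ≠ 0,
and the fixed Gaussian dominates it. -/
theorem tendsto_integral_gaussian_mul (w : Rm m) (hw : w ≠ 0) (q : ℕ) (hq : q ≠ 0) :
    Filter.Tendsto (fun n : ℕ => ∫ y : Rm m,
      (Real.exp (-(∑ i, y i ^ 2 / 2)) * Real.exp (-(n * (inner ℝ w y) ^ 2))) ^ q)
      Filter.atTop (nhds 0) := by
  obtain ⟨G, hG⟩ := exists_schwartz_gaussian_mul (0 : Rm m) 0 le_rfl
  have hG' (y : Rm m) : ‖G y‖ = Real.exp (-(∑ i, y i ^ 2 / 2)) := by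
    rw [hG, Complex.norm_real]
    simp
  have hzero : (0 : ℝ) = ∫ _ : Rm m, (0 : ℝ) := by simp
  rw [hzero]
  refine tendsto_integral_of_dominated_convergence (fun y => ‖G y‖) (fun n => ?_)
    G.integrable.norm (fun n => ?_) ?_
  · exact Continuous.aestronglyMeasurable (by fun_prop)
  · refine Filter.Eventually.of_forall fun y => ?_
    have h1 : Real.exp (-(∑ i, y i ^ 2 / 2)) ≤ 1 :=
      Real.exp_le_one_iff.mpr (neg_nonpos.mpr (Finset.sum_nonneg fun i _ => by positivity))
    have h2 : Real.exp (-(n * (inner ℝ w y) ^ 2)) ≤ 1 :=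
      Real.exp_le_one_iff.mpr (neg_nonpos.mpr (by positivity))
    rw [Real.norm_of_nonneg (by positivity), hG']
    refine (pow_le_of_le_one (by positivity) (mul_le_one₀ h1 (by positivity) h2) hq).trans ?_
    exact mul_le_of_le_one_right (by positivity) h2
  · have hnull : volume ((LinearMap.ker (innerₗ (Rm m) w) : Submodule ℝ (Rm m)) : Set (Rm m)) =
      0 := by
      refine Measure.addHaar_submodule _ _ fun h => hw ?_
      have : w ∈ LinearMap.ker (innerₗ (Rm m) w) := h ▸ Submodule.mem_top
      exact inner_self_eq_zero.mp (LinearMap.mem_ker.mp this)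
    have hae : ∀ᵐ y : Rm m, inner ℝ w y ≠ 0 := by
      rw [ae_iff]
      convert hnull using 2
      ext y
      simp
    filter_upwards [hae] with y hy
    have h3 : Filter.Tendsto (fun n : ℕ => Real.exp (-(n * (inner ℝ w y) ^ 2)))
        Filter.atTop (nhds 0) := by
      refine Real.tendsto_exp_neg_atTop_nhds_zero.comp ?_
      exact tendsto_natCast_atTop_atTop.atTop_mul_const (by positivity)
    have h4 := (h3.const_mul (Real.exp (-(∑ i, y i ^ 2 / 2)))).pow q
    rwa [mul_zero, zero_pow hq] at h4

/-- For K = δ the form only sees the functions on ker Π. If Π_j(ker Π) has a normal vector w,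
concentrating F_j near the hyperplane orthogonal to w does not change the form, which stays a fixed
positive number, while its L^(2^m) norm tends to 0. -/
theorem ker_injective_of_bound (N : ℕ) (L : R2m m →ₗ[ℝ] Rm m) (hL : Function.Surjective L)
    (h : ∃ C : ℝ, ∀ K : 𝓢'(Rm m, ℂ), IsCZKernel N K → ∀ F : Cube m → 𝓢(Rm m, ℂ),
      ‖singularForm L hL K F‖ ≤ C * ∏ j, (eLpNorm (F j) (2 ^ m) volume).toReal)
    (j : Cube m) : ∀ x ∈ LinearMap.ker L, cubeProj j x = 0 → x = 0 := by
  classical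
  obtain ⟨C, hC⟩ := h
  rw [← finrank_map_eq_iff, finrank_ker_eq L hL]
  by_contra hne
  have hU : ((LinearMap.ker L).map (cubeProj j))ᗮ ≠ ⊥ := by
    intro hbot
    rw [Submodule.orthogonal_eq_bot_iff] at hbot
    rw [hbot] at hne
    simp at hne
  obtain ⟨w, hwU, hw⟩ := Submodule.exists_mem_ne_zero_of_ne_bot hU
  obtain ⟨ℓ, hℓ, hker⟩ := exists_ker_param L hL
  have hwℓ (p : Rm m) : inner ℝ w (cubeProj j (ℓ p)) = 0 := by
    rw [real_inner_comm]
    refine (Submodule.mem_orthogonal _ _).mp hwU _ ⟨ℓ p, ?_, rfl⟩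
    rw [← hker]
    exact LinearMap.mem_range_self ℓ p
  obtain ⟨J, hJ, hpush⟩ := exists_pushforward_eq L hL ℓ hℓ hker
  choose G hG using fun n : ℕ => exists_schwartz_gaussian_mul w n (Nat.cast_nonneg n)
  let F (n : ℕ) : Cube m → 𝓢(Rm m, ℂ) := Function.update (fun _ => G 0) j (G n)
  -- The integrand on the kernel. It carries no n because ⟨w, Π_j ℓ p⟩ = 0.
  let g (p : Rm m) : ℝ := ∏ k : Cube m, Real.exp (-(∑ i, (cubeProj k (ℓ p)) i ^ 2 / 2)) *
    (if k = j then 1 else Real.exp (-((0 : ℕ) * (inner ℝ w (cubeProj k (ℓ p))) ^ 2)))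
  have hFg (n : ℕ) (p : Rm m) : cubeProd (F n) (0 - ℓ p) = g p := by
    rw [cubeProd_apply]
    simp only [g]
    rw [Complex.ofReal_prod]
    refine Finset.prod_congr rfl fun k _ => ?_
    by_cases hk : k = j
    · subst hk
      simp only [F, Function.update_self, hG, zero_sub, map_neg, inner_neg_right, hwℓ]
      simp
    · simp only [F, Function.update_of_ne hk, hG, zero_sub, map_neg, inner_neg_right, if_neg hk]
      simp
  have hval (n : ℕ) : singularForm L hL (TemperedDistribution.delta 0) (F n) =
      ((J * ∫ p, g p : ℝ) : ℂ) := by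
    rw [singularForm_delta, ← map_zero L, hpush]
    simp only [hFg]
    rw [integral_complex_ofReal, Complex.ofReal_mul]
  have hgint : Integrable g := by
    have hcomp : Integrable fun p => cubeProd (F 0) (0 - ℓ p) := by
      let c : 𝓢(Rm m, ℂ) := SchwartzMap.compCLMOfAntilipschitz ℂ
        (g := fun p => ℓ p) (LinearMap.toContinuousLinearMap ℓ).hasTemperateGrowth
        (ℓ.exists_antilipschitzWith (LinearMap.ker_eq_bot.mpr hℓ)).choose_spec.2 (cubeProd (F 0))
      have := c.integrable (μ := volume)
      refine (integrable_congr (Filter.Eventually.of_forall fun p => ?_)).mp this.comp_neg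
      change cubeProd (F 0) (ℓ (-p)) = cubeProd (F 0) (0 - ℓ p)
      rw [map_neg, zero_sub]
    simp only [hFg] at hcomp
    exact hcomp.re
  have hgpos : 0 < ∫ p, g p := by
    refine (integral_pos_iff_support_of_nonneg (fun p => by positivity) hgint).mpr ?_
    have : Function.support g = Set.univ := by
      refine Set.eq_univ_of_forall fun p => ?_
      refine ne_of_gt (Finset.prod_pos fun k _ => ?_)
      split_ifs <;> positivity
    rw [this]
    exact isOpen_univ.measure_pos volume Set.univ_nonempty
  have hbound (n : ℕ) : J * ∫ p, g p ≤ C * ((eLpNorm (G n) (2 ^ m) volume).toReal *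
      ∏ k ∈ Finset.univ.erase j, (eLpNorm (G 0) (2 ^ m) volume).toReal) := by
    have h1 := hC _ (isCZKernel_delta N) (F n)
    rw [hval, Complex.norm_real, Real.norm_of_nonneg (by positivity),
      ← Finset.mul_prod_erase _ _ (Finset.mem_univ j)] at h1
    refine h1.trans_eq ?_
    congr 2
    · simp [F]
    · refine Finset.prod_congr rfl fun k hk => ?_
      simp only [F, Function.update_of_ne (Finset.ne_of_mem_erase hk)]
  have hlim : Filter.Tendsto (fun n => (eLpNorm (G n) (2 ^ m) volume).toReal)
      Filter.atTop (nhds 0) := by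
    have h1 := tendsto_integral_gaussian_mul w hw (2 ^ m) (by positivity)
    have h2 (n : ℕ) : ∫ y : Rm m,
        (Real.exp (-(∑ i, y i ^ 2 / 2)) * Real.exp (-(n * (inner ℝ w y) ^ 2))) ^ (2 ^ m) =
        (eLpNorm (G n) (2 ^ m) volume).toReal ^ (2 ^ m) := by
      rw [toReal_eLpNorm_pow]
      refine integral_congr_ae (Filter.Eventually.of_forall fun y => ?_)
      simp only [hG, Complex.norm_real]
      rw [Real.norm_of_nonneg (by positivity)]
    simp only [h2] at h1
    have h3 := h1.rpow_const (p := ((2 ^ m : ℕ) : ℝ)⁻¹) (Or.inr (by positivity))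
    rw [Real.zero_rpow (by positivity)] at h3
    simpa only [Real.pow_rpow_inv_natCast ENNReal.toReal_nonneg
      (show (2 ^ m : ℕ) ≠ 0 by positivity)] using h3
  have hlim2 := ((hlim.mul_const (∏ k ∈ Finset.univ.erase j,
    (eLpNorm (G 0) (2 ^ m) volume).toReal)).const_mul C)
  rw [zero_mul, mul_zero] at hlim2
  have := ge_of_tendsto' hlim2 hbound
  have := mul_pos hJ hgpos
  linarith

end Necessity

end SingularBL

end

noncomputable section

namespace SingularBL

/-! ### Frames: parametrized kernels in general position -/

/-- An `m`-dimensional subspace of `ℝ^{2m}` in general position with respect to the cubical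
projections, parametrized by `emb`, together with a map `proj` that has this subspace as kernel. -/
structure Frame (m : ℕ) where
  emb : Rm m →ₗ[ℝ] R2m m
  proj : R2m m →ₗ[ℝ] Rm m
  surj : Function.Surjective proj
  proj_emb : ∀ p, proj (emb p) = 0
  bij : ∀ j : Cube m, Function.Bijective fun p => cubeProj j (emb p)

section Decay

variable {E : Type*} [NormedAddCommGroup E] [NormedSpace ℝ E]

theorem schwartz_decay (Φ : 𝓢(E, ℂ)) (k : ℕ) :
    ∃ C : ℝ, 0 ≤ C ∧ ∀ x, ‖Φ x‖ ≤ C * (1 + ‖x‖) ^ (-(k : ℝ)) := by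
  refine ⟨2 ^ k * (Finset.Iic (k, 0)).sup (fun q => SchwartzMap.seminorm ℝ q.1 q.2) Φ,
    by positivity, fun x => ?_⟩
  have h1 := SchwartzMap.one_add_le_sup_seminorm_apply (𝕜 := ℝ) (m := (k, 0)) le_rfl le_rfl Φ x
  rw [norm_iteratedFDeriv_zero] at h1
  rwa [Real.rpow_neg (by positivity), Real.rpow_natCast, ← div_eq_mul_inv,
    le_div_iff₀ (by positivity), mul_comm]

end Decay

/-- The correlation of two Schwartz functions along a subspace is integrable. -/
theorem integrable_schwartz_mul_sub {E H : Type*}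
    [NormedAddCommGroup E] [NormedSpace ℝ E] [FiniteDimensional ℝ E] [MeasureSpace E]
    [BorelSpace E] [(volume : Measure E).IsAddHaarMeasure]
    [NormedAddCommGroup H] [NormedSpace ℝ H] [FiniteDimensional ℝ H] [MeasureSpace H]
    [BorelSpace H] [(volume : Measure H).IsAddHaarMeasure]
    (Φ Ψ : 𝓢(E, ℂ)) (ℓ : H →ₗ[ℝ] E) (hℓ : Function.Injective ℓ) :
    Integrable (fun q : E × H => Φ q.1 * Ψ (q.1 - ℓ q.2)) (volume.prod volume) := by
  obtain ⟨K, -, hK⟩ := ℓ.exists_antilipschitzWith (LinearMap.ker_eq_bot.mpr hℓ)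
  have hK' (p : H) : 1 + ‖p‖ ≤ (1 + K) * (1 + ‖ℓ p‖) := by
    have := hK.le_mul_dist p 0
    rw [map_zero, dist_zero_right, dist_zero_right] at this
    nlinarith [norm_nonneg (ℓ p), K.2]
  let k : ℕ := Module.finrank ℝ H + 1
  let k' : ℕ := Module.finrank ℝ E + 1
  -- The decay of `Φ` is split: k' powers make the x-integral converge, and k powers convert the
  -- decay of `Ψ` at x - ℓ p into decay in p.
  obtain ⟨C₁, hC₁, h₁⟩ := schwartz_decay Φ (k + k')
  obtain ⟨C₂, hC₂, h₂⟩ := schwartz_decay Ψ k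
  have hbd : Integrable (fun q : E × H => (C₁ * (1 + ‖q.1‖) ^ (-(k' : ℝ))) *
      (C₂ * (1 + K) ^ (k : ℝ) * (1 + ‖q.2‖) ^ (-(k : ℝ)))) (volume.prod volume) := by
    have i1 : Integrable fun x : E => C₁ * (1 + ‖x‖) ^ (-(k' : ℝ)) :=
      (integrable_one_add_norm (by simp [k'])).const_mul _
    have i2 : Integrable fun p : H => C₂ * (1 + K) ^ (k : ℝ) * (1 + ‖p‖) ^ (-(k : ℝ)) :=
      (integrable_one_add_norm (by simp [k])).const_mul _
    exact i1.mul_prod i2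
  have hcont : Continuous fun q : E × H => Φ q.1 * Ψ (q.1 - ℓ q.2) := by
    have := ℓ.continuous_of_finiteDimensional
    have := Φ.continuous
    have := Ψ.continuous
    fun_prop
  refine hbd.mono' hcont.aestronglyMeasurable (Filter.Eventually.of_forall fun q => ?_)
  obtain ⟨x, p⟩ := q
  simp only [norm_mul]
  have h3 : 1 + ‖p‖ ≤ (1 + K) * ((1 + ‖x‖) * (1 + ‖x - ℓ p‖)) := by
    refine (hK' p).trans ?_
    gcongr
    have : ‖ℓ p‖ ≤ ‖x‖ + ‖x - ℓ p‖ := by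
      have := norm_sub_le x (x - ℓ p)
      rwa [sub_sub_cancel] at this
    nlinarith [norm_nonneg x, norm_nonneg (x - ℓ p)]
  calc ‖Φ x‖ * ‖Ψ (x - ℓ p)‖
      ≤ (C₁ * (1 + ‖x‖) ^ (-((k + k' : ℕ) : ℝ))) * (C₂ * (1 + ‖x - ℓ p‖) ^ (-(k : ℝ))) := by
        gcongr
        · exact h₁ x
        · exact h₂ _
    _ ≤ _ := by
        have h4 : (1 + ‖x - ℓ p‖) ^ (-(k : ℝ)) ≤
            (1 + ‖x‖) ^ (k : ℝ) * ((1 + K) ^ (k : ℝ) * (1 + ‖p‖) ^ (-(k : ℝ))) := by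
          simp only [Real.rpow_neg (show 0 ≤ 1 + ‖x - ℓ p‖ by positivity),
            Real.rpow_neg (show 0 ≤ 1 + ‖p‖ by positivity), Real.rpow_natCast]
          rw [← div_eq_mul_inv, ← mul_div_assoc, inv_eq_one_div,
            div_le_div_iff₀ (by positivity) (by positivity), one_mul, ← mul_pow, ← mul_pow]
          refine pow_le_pow_left₀ (by positivity) (h3.trans_eq (by ring)) k
        have h5 : (1 + ‖x‖) ^ (-((k + k' : ℕ) : ℝ)) * (1 + ‖x‖) ^ (k : ℝ) =
            (1 + ‖x‖) ^ (-(k' : ℝ)) := by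
          rw [← Real.rpow_add (by positivity)]
          congr 1
          push_cast
          ring
        calc _ ≤ (C₁ * (1 + ‖x‖) ^ (-((k + k' : ℕ) : ℝ))) * (C₂ * ((1 + ‖x‖) ^ (k : ℝ) *
              ((1 + K) ^ (k : ℝ) * (1 + ‖p‖) ^ (-(k : ℝ))))) := by gcongr
          _ = (C₁ * ((1 + ‖x‖) ^ (-((k + k' : ℕ) : ℝ)) * (1 + ‖x‖) ^ (k : ℝ))) *
              (C₂ * (1 + K) ^ (k : ℝ) * (1 + ‖p‖) ^ (-(k : ℝ))) := by ring
          _ = _ := by rw [h5]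

/-- The product of heat kernels at times `v * s_i ^ 2`, differentiated in the two variables with
index `i ∈ B`. -/
def heatProd {m : ℕ} (B : Finset (Fin m)) (v : ℝ) (s : Fin m → ℝ) (x : R2m m) : ℝ :=
  ∏ c : Fin 2 × Fin m,
    if c.2 ∈ B then heatDeriv (v * s c.2 ^ 2) (x c) else heat (v * s c.2 ^ 2) (x c)

theorem exists_schwartz_heatProd {m : ℕ} (B : Finset (Fin m)) {v : ℝ} (hv : 0 < v)
    {s : Fin m → ℝ} (hs : ∀ i, 0 < s i) (z : R2m m) :
    ∃ Ψ : 𝓢(R2m m, ℂ), (∀ x, Ψ x = heatProd B v s (x - z)) ∧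
      ∀ η, 𝓕 Ψ η = ∏ c : Fin 2 × Fin m,
        (Complex.exp (-(2 * Real.pi * Complex.I * (z c * η c : ℝ))) *
          ((if c.2 ∈ B then 2 * Real.pi * Complex.I * η c else 1) *
            Real.exp (-(4 * Real.pi ^ 2 * (v * s c.2 ^ 2) * η c ^ 2)))) := by
  have h (c : Fin 2 × Fin m) : ∃ φ : 𝓢(ℝ, ℂ), (∀ x, φ x = ((if c.2 ∈ B then
      heatDeriv (v * s c.2 ^ 2) (x - z c) else heat (v * s c.2 ^ 2) (x - z c) : ℝ) : ℂ)) ∧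
      ∀ ξ, 𝓕 φ ξ = Complex.exp (-(2 * Real.pi * Complex.I * (z c * ξ : ℝ))) *
        ((if c.2 ∈ B then 2 * Real.pi * Complex.I * ξ else 1) *
          Real.exp (-(4 * Real.pi ^ 2 * (v * s c.2 ^ 2) * ξ ^ 2))) := by
    have hvs : 0 < v * s c.2 ^ 2 := by have := hs c.2; positivity
    by_cases hc : c.2 ∈ B
    · obtain ⟨φ, h1, h2⟩ := exists_schwartz_heatDeriv hvs
      obtain ⟨ψ, h3, h4⟩ := exists_schwartz_shift φ (z c)
      refine ⟨ψ, fun x => ?_, fun ξ => ?_⟩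
      · rw [h3, h1, if_pos hc]
      · rw [h4, h2, if_pos hc]
    · obtain ⟨φ, h1, h2⟩ := exists_schwartz_heat hvs
      obtain ⟨ψ, h3, h4⟩ := exists_schwartz_shift φ (z c)
      refine ⟨ψ, fun x => ?_, fun ξ => ?_⟩
      · rw [h3, h1, if_neg hc]
      · rw [h4, h2, if_neg hc, one_mul]
  choose φ hφ hφF using h
  refine ⟨tensor φ, fun x => ?_, fun η => ?_⟩
  · rw [tensor_apply, heatProd, Complex.ofReal_prod]
    exact Finset.prod_congr rfl fun c _ => hφ c (x c)
  · rw [fourier_tensor]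
    exact Finset.prod_congr rfl fun c _ => hφF c (η c)

namespace Frame

variable {m : ℕ} (A : Frame m)

theorem emb_injective : Function.Injective A.emb := fun p q h =>
  (A.bij fun _ => 0).1 (by simp only [h])

theorem range_emb : LinearMap.range A.emb = LinearMap.ker A.proj := by
  refine Submodule.eq_of_le_of_finrank_eq ?_ ?_
  · rintro _ ⟨p, rfl⟩
    exact A.proj_emb p
  · rw [LinearMap.finrank_range_of_inj A.emb_injective, finrank_ker_eq _ A.surj]
    simp

theorem exists_jac : ∃ J : ℝ, 0 < J ∧ ∀ (Ψ : 𝓢(R2m m, ℂ)) (x : R2m m),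
    pushforward A.proj A.surj Ψ (A.proj x) = J * ∫ p, Ψ (x - A.emb p) :=
  exists_pushforward_eq A.proj A.surj A.emb A.emb_injective A.range_emb

/-- The Jacobian factor that relates the pull-back by `proj` to integration along `emb`. -/
def jac : ℝ := A.exists_jac.choose

theorem jac_pos : 0 < A.jac := A.exists_jac.choose_spec.1

/-- The coordinates of the transpose of `proj`. -/
def freq (ξ : Rm m) (c : Fin 2 × Fin m) : ℝ := transposeCLM A.proj ξ c

theorem continuous_freq (c : Fin 2 × Fin m) : Continuous fun ξ => A.freq ξ c := by
  unfold freq; fun_prop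

/-- The form with Fourier multiplier `M`, applied to the function `Φ`. -/
def symbolForm (Φ : 𝓢(R2m m, ℂ)) (M : Rm m → ℂ) : ℂ :=
  ∫ ξ, 𝓕 Φ (-transposeCLM A.proj ξ) * M ξ

/-- The form with kernel `∫ k (x - emb p) dp`, applied to the function `f`. -/
def spatialForm (f k : R2m m → ℝ) : ℝ := ∫ p, ∫ x, f x * k (x - A.emb p)

theorem integrable_spatial {Φ Ψ : 𝓢(R2m m, ℂ)} {f k : R2m m → ℝ} (hf : ∀ x, Φ x = f x)
    (hk : ∀ x, Ψ x = k x) :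
    Integrable (fun q : R2m m × Rm m => f q.1 * k (q.1 - A.emb q.2)) (volume.prod volume) := by
  have h := (integrable_schwartz_mul_sub Φ Ψ A.emb A.emb_injective).re
  refine h.congr (Filter.Eventually.of_forall fun q => ?_)
  simp only [hf, hk]
  rw [← Complex.ofReal_mul]
  rfl

/-- The bridge between the two sides: restricting a transform to the frequencies Π^T ξ corresponds
to integrating the kernel over the subspace. Estimates with positivity take place in space, algebra
of multipliers in frequency. -/
theorem symbolForm_fourier {Φ Ψ : 𝓢(R2m m, ℂ)} {f k : R2m m → ℝ} (hf : ∀ x, Φ x = f x)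
    (hk : ∀ x, Ψ x = k x) :
    A.symbolForm Φ (fun ξ => 𝓕 Ψ (transposeCLM A.proj ξ)) = (A.jac * A.spatialForm f k : ℝ) := by
  rw [symbolForm, integral_fourier_mul_fourier_comp_transpose A.proj A.surj]
  have h1 (x : R2m m) : pushforward A.proj A.surj Ψ (A.proj x) =
      (A.jac * ∫ p, k (x - A.emb p) : ℝ) := by
    rw [A.exists_jac.choose_spec.2]
    simp only [hk, integral_complex_ofReal]
    push_cast
    rfl
  have h2 (x : R2m m) : Φ x * pushforward A.proj A.surj Ψ (A.proj x) =
      ((A.jac * ∫ p, f x * k (x - A.emb p) : ℝ) : ℂ) := by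
    rw [h1, hf, integral_const_mul]
    push_cast
    ring
  simp only [h2]
  rw [integral_complex_ofReal, integral_const_mul, spatialForm,
    integral_integral_swap (f := fun x p => f x * k (x - A.emb p)) (A.integrable_spatial hf hk)]

/-- The energy `∑_c (s_c τ_c)²` of a frequency. -/
def energy (s : Fin m → ℝ) (ξ : Rm m) : ℝ := ∑ c : Fin 2 × Fin m, (s c.2 * A.freq ξ c) ^ 2

theorem energy_nonneg (s : Fin m → ℝ) (ξ : Rm m) : 0 ≤ A.energy s ξ :=
  Finset.sum_nonneg fun _ _ => sq_nonneg _

theorem continuous_energy (s : Fin m → ℝ) : Continuous (A.energy s) := by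
  unfold energy
  have := A.continuous_freq
  fun_prop

/-- The Gaussian `exp (-4π² v ∑_c (s_c τ_c)²)`. -/
def gauss (s : Fin m → ℝ) (v : ℝ) (ξ : Rm m) : ℝ :=
  Real.exp (-(4 * Real.pi ^ 2 * v * A.energy s ξ))

/-- The character `exp (-2π i ⟨z, τ⟩)`. -/
def chi (z : R2m m) (ξ : Rm m) : ℂ :=
  Complex.exp (-(2 * Real.pi * Complex.I * (∑ c, z c * A.freq ξ c : ℝ)))

theorem norm_chi (z : R2m m) (ξ : Rm m) : ‖A.chi z ξ‖ = 1 := by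
  rw [chi, show -(2 * Real.pi * Complex.I * ((∑ c, z c * A.freq ξ c : ℝ) : ℂ)) =
    ((-(2 * Real.pi * ∑ c, z c * A.freq ξ c) : ℝ) : ℂ) * Complex.I by push_cast; ring,
    Complex.norm_exp_ofReal_mul_I]

/-- The derivatives in x_i^0 and x_i^1 contribute (2πi)² = -4π², so all factors except the
modulation are real. -/
theorem prod_multiplier (B : Finset (Fin m)) (v : ℝ) (s : Fin m → ℝ) (z : R2m m) (ξ : Rm m) :
    ∏ c : Fin 2 × Fin m,
      (Complex.exp (-(2 * Real.pi * Complex.I * (z c * A.freq ξ c : ℝ))) *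
        ((if c.2 ∈ B then 2 * Real.pi * Complex.I * A.freq ξ c else 1) *
          Real.exp (-(4 * Real.pi ^ 2 * (v * s c.2 ^ 2) * A.freq ξ c ^ 2)))) =
      A.chi z ξ * ((∏ i ∈ B, (-(4 * Real.pi ^ 2) * A.freq ξ (0, i) * A.freq ξ (1, i))) *
        A.gauss s v ξ : ℝ) := by
  rw [Finset.prod_mul_distrib, Finset.prod_mul_distrib, ← Complex.exp_sum]
  have h1 : ∏ c : Fin 2 × Fin m, (if c.2 ∈ B then 2 * Real.pi * Complex.I * A.freq ξ c else 1) =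
      ((∏ i ∈ B, (-(4 * Real.pi ^ 2) * A.freq ξ (0, i) * A.freq ξ (1, i)) : ℝ) : ℂ) := by
    rw [Fintype.prod_prod_type, Fin.prod_univ_two, ← Finset.prod_mul_distrib, Complex.ofReal_prod,
      ← Finset.prod_subset (Finset.subset_univ B)]
    · refine Finset.prod_congr rfl fun i hi => ?_
      simp only [hi, if_true]
      push_cast
      linear_combination (4 * Real.pi ^ 2 * A.freq ξ (0, i) * A.freq ξ (1, i) : ℂ) * Complex.I_sq
    · intro i _ hi
      simp [hi]
  have h2 : ∏ c : Fin 2 × Fin m,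
      ((Real.exp (-(4 * Real.pi ^ 2 * (v * s c.2 ^ 2) * A.freq ξ c ^ 2)) : ℝ) : ℂ) =
      (A.gauss s v ξ : ℂ) := by
    rw [← Complex.ofReal_prod, ← Real.exp_sum, gauss, energy, Finset.mul_sum,
      ← Finset.sum_neg_distrib]
    refine congrArg (fun r : ℝ => ((Real.exp r : ℝ) : ℂ)) (Finset.sum_congr rfl fun c _ => ?_)
    ring
  rw [h1, h2, chi, Finset.sum_neg_distrib, Complex.ofReal_sum, Finset.mul_sum]
  push_cast
  rfl

theorem symbolForm_gauss {Φ : 𝓢(R2m m, ℂ)} {f : R2m m → ℝ} (hf : ∀ x, Φ x = f x)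
    (B : Finset (Fin m)) {v : ℝ} (hv : 0 < v) {s : Fin m → ℝ} (hs : ∀ i, 0 < s i) (z : R2m m) :
    A.symbolForm Φ (fun ξ => A.chi z ξ *
      ((∏ i ∈ B, (-(4 * Real.pi ^ 2) * A.freq ξ (0, i) * A.freq ξ (1, i))) *
        A.gauss s v ξ : ℝ)) =
      (A.jac * A.spatialForm f fun x => heatProd B v s (x - z) : ℝ) := by
  obtain ⟨Ψ, h1, h2⟩ := exists_schwartz_heatProd B hv hs z
  rw [← A.symbolForm_fourier hf h1]
  congr 1
  funext ξ
  rw [← A.prod_multiplier, h2]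
  rfl

end Frame

end SingularBL

end

noncomputable section

namespace SingularBL

/-! ### Splitting off the two variables with a given index -/

section Split

variable {m : ℕ}

/-- The point with coordinates `s₀`, `s₁` at the index `i` and `y` elsewhere. -/
def glue (i : Fin m) (y : {c : Fin 2 × Fin m // ¬ c.2 = i} → ℝ) (s₀ s₁ : ℝ) : R2m m :=
  WithLp.toLp 2 fun c => if h : c.2 = i then (if c.1 = 0 then s₀ else s₁) else y ⟨c, h⟩

theorem glue_zero (i : Fin m) (y : {c : Fin 2 × Fin m // ¬ c.2 = i} → ℝ) (s₀ s₁ : ℝ) :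
    glue i y s₀ s₁ (0, i) = s₀ := by simp [glue]

theorem glue_one (i : Fin m) (y : {c : Fin 2 × Fin m // ¬ c.2 = i} → ℝ) (s₀ s₁ : ℝ) :
    glue i y s₀ s₁ (1, i) = s₁ := by simp [glue]

theorem glue_of_ne (i : Fin m) (y : {c : Fin 2 × Fin m // ¬ c.2 = i} → ℝ) (s₀ s₁ : ℝ)
    {c : Fin 2 × Fin m} (hc : c.2 ≠ i) : glue i y s₀ s₁ c = y ⟨c, hc⟩ := by simp [glue, hc]

theorem exists_glue_equiv (i : Fin m) :
    ∃ e : (({c : Fin 2 × Fin m // ¬ c.2 = i} → ℝ) × (ℝ × ℝ)) ≃ᵐ R2m m,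
      MeasurePreserving e ∧ ∀ q, e q = glue i q.1 q.2.1 q.2.2 := by
  let p : Fin 2 × Fin m → Prop := fun c => c.2 = i
  let σ : Fin 2 ≃ Subtype p :=
    { toFun := fun a => ⟨(a, i), rfl⟩
      invFun := fun c => c.1.1
      left_inv := fun a => rfl
      right_inv := by rintro ⟨⟨a, l⟩, h⟩; exact Subtype.ext (Prod.ext rfl h.symm) }
  let e₁ : (Fin 2 → ℝ) ≃ᵐ (Subtype p → ℝ) := MeasurableEquiv.piCongrLeft (fun _ => ℝ) σ
  have h₁ : MeasurePreserving e₁ := volume_measurePreserving_piCongrLeft _ σ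
  let e₂ : (ℝ × ℝ) ≃ᵐ (Fin 2 → ℝ) := MeasurableEquiv.finTwoArrow.symm
  have h₂ : MeasurePreserving e₂ := (volume_preserving_finTwoArrow ℝ).symm
  let e₃ := (MeasurableEquiv.piEquivPiSubtypeProd (fun _ : Fin 2 × Fin m => ℝ) p).symm
  have h₃ : MeasurePreserving e₃ :=
    (volume_preserving_piEquivPiSubtypeProd (fun _ : Fin 2 × Fin m => ℝ) p).symm
  let e₄ : (Fin 2 × Fin m → ℝ) ≃ᵐ R2m m := MeasurableEquiv.toLp 2 _
  have h₄ : MeasurePreserving e₄ := PiLp.volume_preserving_toLp _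
  let e₅ : (({c : Fin 2 × Fin m // ¬ c.2 = i} → ℝ) × (ℝ × ℝ)) ≃ᵐ
      ((ℝ × ℝ) × ({c : Fin 2 × Fin m // ¬ c.2 = i} → ℝ)) := MeasurableEquiv.prodComm
  have h₅ : MeasurePreserving e₅ := Measure.measurePreserving_swap
  let e₆ := MeasurableEquiv.prodCongr (e₂.trans e₁)
    (MeasurableEquiv.refl ({c : Fin 2 × Fin m // ¬ c.2 = i} → ℝ))
  have h₆ : MeasurePreserving e₆ := (h₁.comp h₂).prod (MeasurePreserving.id volume)
  refine ⟨((e₅.trans e₆).trans e₃).trans e₄, h₄.comp (h₃.comp (h₆.comp h₅)), ?_⟩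
  rintro ⟨y, s₀, s₁⟩
  ext ⟨a, l⟩
  change (e₃ (e₁ (e₂ (s₀, s₁)), y)) (a, l) = _
  by_cases h : l = i
  · subst h
    have h7 : (e₃ (e₁ (e₂ (s₀, s₁)), y)) (a, l) = e₁ (e₂ (s₀, s₁)) (σ a) := by
      simp only [e₃, MeasurableEquiv.piEquivPiSubtypeProd, MeasurableEquiv.symm_mk,
        MeasurableEquiv.coe_mk, Equiv.piEquivPiSubtypeProd, Equiv.coe_fn_symm_mk, p]
      simp [σ]
    rw [h7]
    have h8 : e₁ (e₂ (s₀, s₁)) (σ a) = e₂ (s₀, s₁) a :=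
      Equiv.piCongrLeft_apply_apply (fun _ => ℝ) σ _ a
    rw [h8]
    fin_cases a
    · exact (glue_zero _ _ _ _).symm
    · exact (glue_one _ _ _ _).symm
  · have h7 : (e₃ (e₁ (e₂ (s₀, s₁)), y)) (a, l) = y ⟨(a, l), h⟩ := by
      simp only [e₃, MeasurableEquiv.piEquivPiSubtypeProd, MeasurableEquiv.symm_mk,
        MeasurableEquiv.coe_mk, Equiv.piEquivPiSubtypeProd, Equiv.coe_fn_symm_mk, p]
      simp [h]
    rw [h7]
    exact (glue_of_ne i y s₀ s₁ (c := (a, l)) h).symm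

theorem integral_eq_integral_glue (i : Fin m) {f : R2m m → ℝ} (hf : Integrable f) :
    ∫ x, f x = ∫ y, ∫ s : ℝ × ℝ, f (glue i y s.1 s.2) ∧
      Integrable fun y => ∫ s : ℝ × ℝ, f (glue i y s.1 s.2) := by
  obtain ⟨e, he, hg⟩ := exists_glue_equiv i
  have h1 : Integrable (fun q => f (glue i q.1 q.2.1 q.2.2))
      ((volume : Measure ({c : Fin 2 × Fin m // ¬ c.2 = i} → ℝ)).prod
        (volume : Measure (ℝ × ℝ))) := by
    have := (he.integrable_comp_emb e.measurableEmbedding (g := f)).mpr hf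
    refine this.congr (Filter.Eventually.of_forall fun q => ?_)
    simp [hg]
  refine ⟨?_, h1.integral_prod_left⟩
  rw [← he.integral_comp e.measurableEmbedding]
  simp only [hg]
  exact integral_prod _ h1

/-- A cubical projection sees exactly one of the two variables with index i; writing the result with
the vertex moved to the face j i = 0 makes both faces comparable. -/
theorem cubeProj_glue (i : Fin m) (y : {c : Fin 2 × Fin m // ¬ c.2 = i} → ℝ) (s₀ s₁ : ℝ)
    (j : Cube m) :
    cubeProj j (glue i y s₀ s₁) =
      cubeProj (Function.update j i 0) (glue i y (if j i = 0 then s₀ else s₁) 0) := by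
  ext l
  simp only [cubeProj_apply]
  by_cases h : l = i
  · subst h
    rw [Function.update_self, glue_zero]
    rcases fin_two_eq_or (j l) 0 with h1 | h1
    · rw [h1, glue_zero, if_pos rfl]
    · rw [h1, if_neg (by decide)]
      exact glue_one _ _ _ _
  · rw [Function.update_of_ne h, glue_of_ne _ _ _ _ (c := (j l, l)) h,
      glue_of_ne _ _ _ _ (c := (j l, l)) h]

theorem prod_cube_eq (i : Fin m) (G : Cube m → ℝ) :
    ∏ j, G j = (∏ j : Cube m with j i = 0, G j) *
      ∏ j : Cube m with j i = 0, G (Function.update j i 1) := by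
  rw [← Finset.prod_filter_mul_prod_filter_not Finset.univ (fun j : Cube m => j i = 0)]
  congr 1
  refine (Finset.prod_bij' (fun j _ => Function.update j i 1) (fun j _ => Function.update j i 0)
    ?_ ?_ ?_ ?_ ?_).symm
  · intro j _; simp
  · intro j _; simp
  · intro j hj
    simp only [Finset.mem_filter, Finset.mem_univ, true_and] at hj
    rw [Function.update_idem, ← hj, Function.update_eq_self]
  · intro j hj
    simp only [Finset.mem_filter, Finset.mem_univ, true_and] at hj
    have : j i = 1 := by omega
    rw [Function.update_idem, ← this, Function.update_eq_self]
  · intro j _; rfl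

/-- The product of the functions `F_j ∘ Π_j`. -/
def cubeFun (F : Cube m → Rm m → ℝ) (x : R2m m) : ℝ := ∏ j, F j (cubeProj j x)

/-- The tuple of functions frozen on the face `j i = a`. -/
def freezeFun (F : Cube m → Rm m → ℝ) (i : Fin m) (a : Fin 2) : Cube m → Rm m → ℝ :=
  fun j => F (Function.update j i a)

/-- The product of the functions on the face `j i = a`, as a function of the variable with
index `(a, i)` and the remaining ones. -/
def faceFun (F : Cube m → Rm m → ℝ) (i : Fin m) (a : Fin 2)
    (y : {c : Fin 2 × Fin m // ¬ c.2 = i} → ℝ) (s : ℝ) : ℝ :=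
  ∏ j : Cube m with j i = 0, F (Function.update j i a) (cubeProj j (glue i y s 0))

/-- This separation of the two variables with index i is where the cubical structure enters; it
makes Cauchy–Schwarz possible. -/
theorem cubeFun_glue (F : Cube m → Rm m → ℝ) (i : Fin m)
    (y : {c : Fin 2 × Fin m // ¬ c.2 = i} → ℝ) (s₀ s₁ : ℝ) :
    cubeFun F (glue i y s₀ s₁) = faceFun F i 0 y s₀ * faceFun F i 1 y s₁ := by
  rw [cubeFun, prod_cube_eq i]
  congr 1
  · refine Finset.prod_congr rfl fun j hj => ?_
    simp only [Finset.mem_filter, Finset.mem_univ, true_and] at hj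
    rw [cubeProj_glue, if_pos hj, ← hj, Function.update_eq_self]
  · refine Finset.prod_congr rfl fun j hj => ?_
    simp only [Finset.mem_filter, Finset.mem_univ, true_and] at hj
    rw [cubeProj_glue, Function.update_self, if_neg (by decide), Function.update_idem]
    conv_lhs => rw [← hj, Function.update_eq_self]

theorem faceFun_freezeFun (F : Cube m → Rm m → ℝ) (i : Fin m) (a b : Fin 2)
    (y : {c : Fin 2 × Fin m // ¬ c.2 = i} → ℝ) (s : ℝ) :
    faceFun (freezeFun F i a) i b y s = faceFun F i a y s := by
  simp only [faceFun, freezeFun, Function.update_idem]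

/-- The integrand of a form in which the variables with index `i` carry the kernels `k₀`, `k₁`. -/
def splitFun (F : Cube m → Rm m → ℝ) (i : Fin m) (k₀ k₁ : ℝ → ℝ) (W : R2m m → ℝ)
    (x : R2m m) : ℝ := cubeFun F x * (k₀ (x (0, i)) * k₁ (x (1, i)) * W x)

/-- A function does not depend on the variables with index `i`. -/
def IndepOf (i : Fin m) (W : R2m m → ℝ) : Prop :=
  ∀ y s₀ s₁, W (glue i y s₀ s₁) = W (glue i y 0 0)

theorem integral_splitFun {F : Cube m → Rm m → ℝ} {i : Fin m} {k₀ k₁ : ℝ → ℝ} {W : R2m m → ℝ}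
    (hW : IndepOf i W) (hint : Integrable (splitFun F i k₀ k₁ W)) :
    ∫ x, splitFun F i k₀ k₁ W x =
        ∫ y, W (glue i y 0 0) *
          ((∫ s, faceFun F i 0 y s * k₀ s) * ∫ s, faceFun F i 1 y s * k₁ s) ∧
      Integrable fun y => W (glue i y 0 0) *
          ((∫ s, faceFun F i 0 y s * k₀ s) * ∫ s, faceFun F i 1 y s * k₁ s) := by
  have h := integral_eq_integral_glue i hint
  have h1 (y : {c : Fin 2 × Fin m // ¬ c.2 = i} → ℝ) :
      ∫ s : ℝ × ℝ, splitFun F i k₀ k₁ W (glue i y s.1 s.2) = W (glue i y 0 0) *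
          ((∫ s, faceFun F i 0 y s * k₀ s) * ∫ s, faceFun F i 1 y s * k₁ s) := by
    rw [← integral_prod_mul, ← integral_const_mul]
    refine integral_congr_ae (Filter.Eventually.of_forall fun s => ?_)
    simp only [splitFun, cubeFun_glue, glue_zero, glue_one]
    rw [hW]
    ring
  simpa only [h1] using h

/-- The Cauchy–Schwarz inequality in the variables with index `i`. -/
theorem abs_integral_splitFun_le {F : Cube m → Rm m → ℝ} {i : Fin m} {k₀ k₁ : ℝ → ℝ}
    {W : R2m m → ℝ} (hW : IndepOf i W) (hW0 : ∀ x, 0 ≤ W x)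
    (hint : Integrable (splitFun F i k₀ k₁ W))
    (hint₀ : Integrable (splitFun (freezeFun F i 0) i k₀ k₀ W))
    (hint₁ : Integrable (splitFun (freezeFun F i 1) i k₁ k₁ W)) :
    |∫ x, splitFun F i k₀ k₁ W x| ≤
      (∫ x, splitFun (freezeFun F i 0) i k₀ k₀ W x) +
        ∫ x, splitFun (freezeFun F i 1) i k₁ k₁ W x := by
  obtain ⟨e, he⟩ := integral_splitFun hW hint
  obtain ⟨e₀, he₀⟩ := integral_splitFun hW hint₀
  obtain ⟨e₁, he₁⟩ := integral_splitFun hW hint₁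
  rw [e, e₀, e₁, ← integral_add he₀ he₁]
  refine (abs_integral_le_integral_abs).trans
    (integral_mono he.abs (he₀.add he₁) fun y => ?_)
  simp only [faceFun_freezeFun]
  rw [← mul_add, abs_mul, abs_of_nonneg (hW0 _), abs_mul]
  refine mul_le_mul_of_nonneg_left ?_ (hW0 _)
  set u := ∫ s, faceFun F i 0 y s * k₀ s
  set w := ∫ s, faceFun F i 1 y s * k₁ s
  nlinarith [sq_nonneg (|u| - |w|), sq_abs u, sq_abs w, abs_nonneg u, abs_nonneg w]

theorem faceFun_eq_of_symm {F : Cube m → Rm m → ℝ} {i : Fin m}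
    (hF : ∀ j a, F (Function.update j i a) = F j) (a b : Fin 2) :
    faceFun F i a = faceFun F i b := by
  funext y s
  simp only [faceFun, hF]

/-- With equal kernels and functions that do not distinguish the two faces, the inner integrals in
the two variables coincide and form a square. -/
theorem integral_splitFun_nonneg {F : Cube m → Rm m → ℝ} {i : Fin m} {k : ℝ → ℝ}
    {W : R2m m → ℝ} (hF : ∀ j a, F (Function.update j i a) = F j) (hW : IndepOf i W)
    (hW0 : ∀ x, 0 ≤ W x) (hint : Integrable (splitFun F i k k W)) :
    0 ≤ ∫ x, splitFun F i k k W x := by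
  rw [(integral_splitFun hW hint).1]
  refine integral_nonneg fun y => mul_nonneg (hW0 _) ?_
  rw [faceFun_eq_of_symm hF 0 1]
  exact mul_self_nonneg _

/-- The square of the inner integral is nonnegative whatever the signs of the functions and kernels,
so the weight in the remaining variables can be enlarged pointwise. -/
theorem integral_splitFun_mono {F : Cube m → Rm m → ℝ} {i : Fin m} {k : ℝ → ℝ}
    {W W' : R2m m → ℝ} (hF : ∀ j a, F (Function.update j i a) = F j) (hW : IndepOf i W)
    (hW' : IndepOf i W') (hle : ∀ x, W x ≤ W' x)
    (hint : Integrable (splitFun F i k k W)) (hint' : Integrable (splitFun F i k k W')) :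
    ∫ x, splitFun F i k k W x ≤ ∫ x, splitFun F i k k W' x := by
  obtain ⟨e, he⟩ := integral_splitFun hW hint
  obtain ⟨e', he'⟩ := integral_splitFun hW' hint'
  rw [e, e']
  refine integral_mono he he' fun y => mul_le_mul_of_nonneg_right (hle _) ?_
  rw [faceFun_eq_of_symm hF 0 1]
  exact mul_self_nonneg _

end Split

end SingularBL

end

noncomputable section

namespace SingularBL

/-! ### Freezing a direction of a frame -/

section Freeze

variable {m : ℕ}

/-- The map that replaces both coordinates with index `i` by the one with index `(a, i)`. -/
def freezeMap (i : Fin m) (a : Fin 2) : R2m m →ₗ[ℝ] R2m m where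
  toFun x := WithLp.toLp 2 fun c => x (if c.2 = i then a else c.1, c.2)
  map_add' _ _ := rfl
  map_smul' _ _ := rfl

@[simp] theorem freezeMap_apply (i : Fin m) (a : Fin 2) (x : R2m m) (c : Fin 2 × Fin m) :
    freezeMap i a x c = x (if c.2 = i then a else c.1, c.2) := rfl

theorem freezeMap_apply_self (i : Fin m) (a b : Fin 2) (x : R2m m) :
    freezeMap i a x (b, i) = x (a, i) := by simp

theorem freezeMap_apply_of_ne {i : Fin m} (a : Fin 2) (x : R2m m) {c : Fin 2 × Fin m}
    (hc : c.2 ≠ i) : freezeMap i a x c = x c := by simp [hc]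

theorem cubeProj_freezeMap (i : Fin m) (a : Fin 2) (j : Cube m) (x : R2m m) :
    cubeProj j (freezeMap i a x) = cubeProj (Function.update j i a) x := by
  ext l
  simp only [cubeProj_apply, freezeMap_apply]
  by_cases h : l = i
  · subst h; simp
  · simp [h]

/-- The frame with a given embedding. -/
def Frame.ofEmb (ℓ : Rm m →ₗ[ℝ] R2m m)
    (h : ∀ j : Cube m, Function.Bijective fun p => cubeProj j (ℓ p)) : Frame m where
  emb := ℓ
  -- The subspace is a graph over the vertex 0: its points satisfy Π_1 x = (Π_1 ℓ)(Π_0 ℓ)⁻¹ Π_0 x,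
  -- and `proj` is the defect in this equation.
  proj := cubeProj (fun _ => 1) - (cubeProj (fun _ => 1) ∘ₗ ℓ) ∘ₗ
    (LinearEquiv.ofBijective (cubeProj (fun _ => 0) ∘ₗ ℓ) (h _)).symm.toLinearMap ∘ₗ
      cubeProj fun _ => 0
  surj y := by
    refine ⟨LinearMap.adjoint (cubeProj fun _ => 1) y, ?_⟩
    have h0 : cubeProj (fun _ => 0) (LinearMap.adjoint (cubeProj fun _ => 1) y) = 0 := by
      have h := cubeProj_adjoint_opp (fun _ => 1) y
      rwa [show opp (fun _ : Fin m => 1) = fun _ => 0 from funext fun _ => by simp [opp]] at h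
    have h1 := cubeProj_adjoint (fun _ => 1) y
    simp only [LinearMap.sub_apply, LinearMap.comp_apply, h0, h1, map_zero, sub_zero]
  proj_emb p := by
    have h0 : (LinearEquiv.ofBijective (cubeProj (fun _ => 0) ∘ₗ ℓ) (h _)).symm
        (cubeProj (fun _ => 0) (ℓ p)) = p := by
      rw [LinearEquiv.symm_apply_eq]
      rfl
    simp only [LinearMap.sub_apply, LinearMap.comp_apply, LinearEquiv.coe_coe, h0, sub_self]
  bij := h

/-- The frame in which the coordinates `(0, i)` and `(1, i)` of the embedding are both replaced by
the coordinate `(a, i)`. -/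
def Frame.freeze (A : Frame m) (i : Fin m) (a : Fin 2) : Frame m :=
  Frame.ofEmb (freezeMap i a ∘ₗ A.emb) fun j => by
    simp only [LinearMap.comp_apply, cubeProj_freezeMap]
    exact A.bij _

@[simp] theorem Frame.freeze_emb (A : Frame m) (i : Fin m) (a : Fin 2) (p : Rm m) :
    (A.freeze i a).emb p = freezeMap i a (A.emb p) := rfl

/-- The Schwartz function with values `∏_j F_j (Π_j x)`, for real-valued `F_j`. -/
def cubeSchwartz (F : Cube m → 𝓢(Rm m, ℝ)) : 𝓢(R2m m, ℂ) :=
  cubeProd fun j => (F j).postcompCLM Complex.ofRealCLM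

theorem cubeSchwartz_apply (F : Cube m → 𝓢(Rm m, ℝ)) (x : R2m m) :
    cubeSchwartz F x = cubeFun (fun j => F j) x := by
  rw [cubeSchwartz, cubeProd_apply, cubeFun, Complex.ofReal_prod]
  rfl

/-- The tuple of Schwartz functions frozen on the face `j i = a`. -/
def freezeTuple (F : Cube m → 𝓢(Rm m, ℝ)) (i : Fin m) (a : Fin 2) : Cube m → 𝓢(Rm m, ℝ) :=
  fun j => F (Function.update j i a)

theorem freezeTuple_symm (F : Cube m → 𝓢(Rm m, ℝ)) (i : Fin m) (a : Fin 2) (j : Cube m)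
    (b : Fin 2) : freezeTuple F i a (Function.update j i b) = freezeTuple F i a j := by
  simp [freezeTuple]

/-- The factors of `heatProd` with index different from `i`. -/
def offProd (i : Fin m) (v : ℝ) (s : Fin m → ℝ) (x : R2m m) : ℝ :=
  ∏ c : Fin 2 × Fin m with c.2 ≠ i, heat (v * s c.2 ^ 2) (x c)

theorem offProd_nonneg (i : Fin m) (v : ℝ) (s : Fin m → ℝ) (x : R2m m) : 0 ≤ offProd i v s x :=
  Finset.prod_nonneg fun _ _ => heat_nonneg _ _

theorem heatProd_singleton (i : Fin m) (v : ℝ) (s : Fin m → ℝ) (x : R2m m) :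
    heatProd {i} v s x = heatDeriv (v * s i ^ 2) (x (0, i)) * heatDeriv (v * s i ^ 2) (x (1, i)) *
      offProd i v s x := by
  rw [heatProd, offProd,
    ← Finset.prod_filter_mul_prod_filter_not Finset.univ (fun c : Fin 2 × Fin m => c.2 = i)]
  congr 1
  · have : (Finset.univ.filter fun c : Fin 2 × Fin m => c.2 = i) = {(0, i), (1, i)} := by
      ext ⟨a, l⟩
      simp only [Finset.mem_filter, Finset.mem_univ, true_and, Finset.mem_insert,
        Finset.mem_singleton, Prod.mk.injEq, ← or_and_right]
      exact ⟨fun h => ⟨by omega, h⟩, fun h => h.2⟩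
    rw [this, Finset.prod_pair (by simp)]
    simp
  · refine Finset.prod_congr rfl fun c hc => ?_
    simp only [Finset.mem_filter, Finset.mem_univ, true_and] at hc
    rw [if_neg (by simpa using hc)]

theorem indepOf_offProd (i : Fin m) (v : ℝ) (s : Fin m → ℝ) (z : R2m m) :
    IndepOf i fun x => offProd i v s (x - z) := by
  intro y s₀ s₁
  refine Finset.prod_congr rfl fun c hc => ?_
  simp only [Finset.mem_filter, Finset.mem_univ, true_and] at hc
  simp only [PiLp.sub_apply, glue_of_ne i y _ _ hc]

theorem mul_heatProd_eq_splitFun (F : Cube m → Rm m → ℝ) (i : Fin m) (v : ℝ) (s : Fin m → ℝ)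
    (z x : R2m m) :
    cubeFun F x * heatProd {i} v s (x - z) =
      splitFun F i (fun t => heatDeriv (v * s i ^ 2) (t - z (0, i)))
        (fun t => heatDeriv (v * s i ^ 2) (t - z (1, i))) (fun x => offProd i v s (x - z)) x := by
  rw [heatProd_singleton, splitFun]
  simp only [PiLp.sub_apply]

theorem Frame.integrable_heatProd (A : Frame m) (F : Cube m → 𝓢(Rm m, ℝ)) (B : Finset (Fin m))
    {v : ℝ} (hv : 0 < v) {s : Fin m → ℝ} (hs : ∀ i, 0 < s i) (z : R2m m) :
    Integrable (fun q : R2m m × Rm m => cubeFun (fun j => F j) q.1 *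
      heatProd B v s (q.1 - A.emb q.2 - z)) (volume.prod volume) := by
  obtain ⟨Ψ, h1, -⟩ := exists_schwartz_heatProd B hv hs z
  exact A.integrable_spatial (k := fun x => heatProd B v s (x - z)) (cubeSchwartz_apply F) h1

/-- Translation invariance of the integral along the subspace: only shifts modulo the subspace
matter. -/
theorem Frame.spatialForm_shift (A : Frame m) (f k : R2m m → ℝ) (q : Rm m) :
    A.spatialForm f (fun x => k (x + A.emb q)) = A.spatialForm f k := by
  unfold Frame.spatialForm
  rw [← integral_sub_right_eq_self (fun p => ∫ x, f x * k (x - A.emb p)) q]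
  simp only [map_sub]
  congr! 6 with p x
  abel

theorem offProd_freezeMap (i : Fin m) (v : ℝ) (s : Fin m → ℝ) (a : Fin 2) (x z : R2m m) :
    offProd i v s (x - freezeMap i a z) = offProd i v s (x - z) := by
  refine Finset.prod_congr rfl fun c hc => ?_
  simp only [Finset.mem_filter, Finset.mem_univ, true_and] at hc
  rw [PiLp.sub_apply, PiLp.sub_apply, freezeMap_apply_of_ne _ _ hc]

/-- The Cauchy–Schwarz inequality for forms with cancellation in the direction `i`. -/
theorem Frame.abs_spatialForm_le (A : Frame m) (F : Cube m → 𝓢(Rm m, ℝ)) (i : Fin m)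
    {v : ℝ} (hv : 0 < v) {s : Fin m → ℝ} (hs : ∀ i, 0 < s i) (z : R2m m) :
    |A.spatialForm (cubeFun fun j => F j) fun x => heatProd {i} v s (x - z)| ≤
      ∑ a, (A.freeze i a).spatialForm (cubeFun fun j => freezeTuple F i a j)
        fun x => heatProd {i} v s (x - freezeMap i a z) := by
  have hA := A.integrable_heatProd F {i} hv hs z
  have hB (a : Fin 2) := (A.freeze i a).integrable_heatProd (freezeTuple F i a) {i} hv hs
    (freezeMap i a z)
  rw [Fin.sum_univ_two]
  unfold Frame.spatialForm
  rw [← integral_add (hB 0).integral_prod_right (hB 1).integral_prod_right]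
  refine abs_integral_le_integral_abs.trans (integral_mono_ae hA.integral_prod_right.abs
    ((hB 0).integral_prod_right.add (hB 1).integral_prod_right) ?_)
  filter_upwards [hA.prod_left_ae, (hB 0).prod_left_ae, (hB 1).prod_left_ae] with p h h0 h1
  -- For fixed p the kernels are centred at emb p + z. Freezing changes this centre only in the
  -- coordinates with index i, so all three integrals carry the same weight.
  simp only [Frame.freeze_emb, sub_sub, ← map_add, mul_heatProd_eq_splitFun,
    freezeMap_apply_self, offProd_freezeMap] at h h0 h1 ⊢
  exact abs_integral_splitFun_le (indepOf_offProd i v s _) (fun x => offProd_nonneg i v s _)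
    h h0 h1

/-- Forms with a square structure in the direction `i` are nonnegative. -/
theorem Frame.spatialForm_nonneg (A : Frame m) (F : Cube m → 𝓢(Rm m, ℝ)) (i : Fin m)
    (hA : ∀ p, A.emb p (0, i) = A.emb p (1, i)) (hF : ∀ j a, F (Function.update j i a) = F j)
    {v : ℝ} (hv : 0 < v) {s : Fin m → ℝ} (hs : ∀ i, 0 < s i) :
    0 ≤ A.spatialForm (cubeFun fun j => F j) (heatProd {i} v s) := by
  have h := A.integrable_heatProd F {i} hv hs 0
  unfold Frame.spatialForm
  refine integral_nonneg_of_ae ?_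
  filter_upwards [h.prod_left_ae] with p hp
  simp only [sub_zero, mul_heatProd_eq_splitFun, hA] at hp ⊢
  exact integral_splitFun_nonneg (fun j a => by rw [hF]) (indepOf_offProd i v s _)
    (fun x => offProd_nonneg i v s _) hp

/-- `heat_add_le` is applied in each coordinate. At most 2m factors occur, each costing 3√w, which
gives (9w)^m. -/
theorem offProd_add_le {i : Fin m} {v w : ℝ} (hv : 0 < v) (hw : 1 ≤ w) {s : Fin m → ℝ}
    (hs : ∀ i, 0 < s i) {z : R2m m} (hz : ∀ c : Fin 2 × Fin m, c.2 ≠ i →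
      z c ^ 2 ≤ w * (v * s c.2 ^ 2)) (x : R2m m) :
    offProd i v s (x + z) ≤ (9 * w) ^ m *
      offProd i v (fun l => if l = i then s l else Real.sqrt (2 * w) * s l) x := by
  have h1 (c : Fin 2 × Fin m) (hc : c.2 ≠ i) : heat (v * s c.2 ^ 2) ((x + z) c) ≤
      3 * Real.sqrt w * heat (v * (Real.sqrt (2 * w) * s c.2) ^ 2) (x c) := by
    have hsc := hs c.2
    have := heat_add_le (v := v * s c.2 ^ 2) (by positivity) hw (hz c hc) (x c)
    rwa [mul_pow, Real.sq_sqrt (by positivity),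
      show v * (2 * w * s c.2 ^ 2) = 2 * w * (v * s c.2 ^ 2) by ring]
  have h3 : 1 ≤ 3 * Real.sqrt w := by
    have := Real.one_le_sqrt.mpr hw
    linarith
  calc offProd i v s (x + z) ≤ ∏ c : Fin 2 × Fin m with c.2 ≠ i,
        (3 * Real.sqrt w * heat (v * (Real.sqrt (2 * w) * s c.2) ^ 2) (x c)) :=
        Finset.prod_le_prod (fun _ _ => heat_nonneg _ _) fun c hc => h1 c (by simpa using hc)
    _ = (3 * Real.sqrt w) ^ (Finset.univ.filter fun c : Fin 2 × Fin m => c.2 ≠ i).card *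
        offProd i v (fun l => if l = i then s l else Real.sqrt (2 * w) * s l) x := by
        rw [Finset.prod_mul_distrib, Finset.prod_const]
        congr 1
        refine Finset.prod_congr rfl fun c hc => ?_
        simp only [Finset.mem_filter, Finset.mem_univ, true_and] at hc
        simp only [if_neg hc]
    _ ≤ _ := by
        refine mul_le_mul_of_nonneg_right ?_ (offProd_nonneg _ _ _ _)
        have h4 : (9 * w) ^ m = (3 * Real.sqrt w) ^ (2 * m) := by
          rw [pow_mul, mul_pow 3 (Real.sqrt w), Real.sq_sqrt (by positivity)]
          norm_num
        rw [h4]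
        refine pow_le_pow_right₀ h3 ((Finset.card_le_univ _).trans_eq ?_)
        simp

/-- Removal of a shift, at the cost of larger heat kernels. -/
theorem Frame.spatialForm_shift_le (A : Frame m) (F : Cube m → 𝓢(Rm m, ℝ)) (i : Fin m)
    (hA : ∀ p, A.emb p (0, i) = A.emb p (1, i)) (hF : ∀ j a, F (Function.update j i a) = F j)
    {v w : ℝ} (hv : 0 < v) (hw : 1 ≤ w) {s : Fin m → ℝ} (hs : ∀ i, 0 < s i) (z : R2m m) (q : Rm m)
    (hq : ∀ a, A.emb q (a, i) = z (a, i)) (hz : ∀ c : Fin 2 × Fin m, c.2 ≠ i →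
      (A.emb q c - z c) ^ 2 ≤ w * (v * s c.2 ^ 2)) :
    A.spatialForm (cubeFun fun j => F j) (fun x => heatProd {i} v s (x - z)) ≤
      (9 * w) ^ m * A.spatialForm (cubeFun fun j => F j)
        (heatProd {i} v fun l => if l = i then s l else Real.sqrt (2 * w) * s l) := by
  set s' : Fin m → ℝ := fun l => if l = i then s l else Real.sqrt (2 * w) * s l with hs'
  have hs'0 (l : Fin m) : 0 < s' l := by
    simp only [hs']
    have := hs l
    split_ifs <;> positivity
  have hs'i : s' i = s i := by simp [hs']
  have h := A.integrable_heatProd F {i} hv hs (z - A.emb q)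
  have h' := A.integrable_heatProd F {i} hv hs'0 0
  rw [← A.spatialForm_shift _ _ q]
  unfold Frame.spatialForm
  have hL : (fun q' : R2m m × Rm m => cubeFun (fun j => F j) q'.1 *
      heatProd {i} v s (q'.1 - A.emb q'.2 - (z - A.emb q))) = fun q' : R2m m × Rm m =>
      cubeFun (fun j => F j) q'.1 * heatProd {i} v s (q'.1 - A.emb q'.2 + A.emb q - z) := by
    funext q'
    congr 2
    abel
  rw [hL] at h
  simp only [sub_zero] at h'
  rw [← integral_const_mul]
  refine integral_mono_ae h.integral_prod_right (h'.integral_prod_right.const_mul _) ?_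
  filter_upwards [h.prod_left_ae, h'.prod_left_ae] with p hp hp'
  have e1 (x : R2m m) : cubeFun (fun j => F j) x *
      heatProd {i} v s (x - A.emb p + A.emb q - z) =
      splitFun (fun j => F j) i (fun t => heatDeriv (v * s i ^ 2) (t - A.emb p (0, i)))
        (fun t => heatDeriv (v * s i ^ 2) (t - A.emb p (0, i)))
        (fun x => offProd i v s (x - (A.emb p - A.emb q + z))) x := by
    rw [show x - A.emb p + A.emb q - z = x - (A.emb p - A.emb q + z) by abel,
      mul_heatProd_eq_splitFun]
    simp only [PiLp.add_apply, PiLp.sub_apply, hq, sub_add_cancel, ← hA]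
  have e2 (x : R2m m) : (9 * w) ^ m * (cubeFun (fun j => F j) x *
      heatProd {i} v s' (x - A.emb p)) =
      splitFun (fun j => F j) i (fun t => heatDeriv (v * s i ^ 2) (t - A.emb p (0, i)))
        (fun t => heatDeriv (v * s i ^ 2) (t - A.emb p (0, i)))
        (fun x => (9 * w) ^ m * offProd i v s' (x - A.emb p)) x := by
    rw [mul_heatProd_eq_splitFun]
    simp only [splitFun, hs'i, ← hA]
    ring
  have hp'' := hp'.const_mul ((9 * w) ^ m)
  rw [← integral_const_mul]
  simp only [e1, e2] at hp hp'' ⊢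
  refine integral_splitFun_mono (fun j a => by rw [hF]) (indepOf_offProd i v s _)
    (fun y s₀ s₁ => ?_) (fun x => ?_) hp hp''
  · simp only [indepOf_offProd i v s' (A.emb p) y s₀ s₁]
  · have := offProd_add_le hv hw hs (z := A.emb q - z) (fun c hc => by
      simpa using hz c hc) (x - A.emb p)
    rwa [show x - A.emb p + (A.emb q - z) = x - (A.emb p - A.emb q + z) by abel] at this

end Freeze

end SingularBL

end

noncomputable section

namespace SingularBL

/-! ### Configurations and the reduction to data with one more symmetry -/

section Config

variable {m : ℕ}

/-- A tuple of functions is normalized if `‖F_j ∘ Π_j ∘ emb‖_{L^{2^m}} ≤ 1` for all `j`. -/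
def Frame.Normalized (A : Frame m) (F : Cube m → 𝓢(Rm m, ℝ)) : Prop :=
  ∀ j, ∫⁻ p, ‖F j (cubeProj j (A.emb p))‖ₑ ^ (2 ^ m) ≤ 1

/-- A frame, scales for the variables and a normalized tuple of functions, all symmetric in the
directions of `S`; the change of coordinates between any two vertices of the cube is bounded by
`D` in units of the scales. -/
structure IsConfig (S : Finset (Fin m)) (D : ℝ) (A : Frame m) (s : Fin m → ℝ)
    (F : Cube m → 𝓢(Rm m, ℝ)) : Prop where
  pos : ∀ i, 0 < s i
  bound : ∀ (j : Cube m) (i : Fin m) (q : Rm m),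
    cubeProj j (A.emb q) = EuclideanSpace.single i 1 → ∀ c, |A.emb q c| * s i ≤ D * s c.2
  symm_emb : ∀ i ∈ S, ∀ p, A.emb p (0, i) = A.emb p (1, i)
  symm_fun : ∀ i ∈ S, ∀ j a, F (Function.update j i a) = F j
  normalized : A.Normalized F

/-- The form with heat kernels, with cancellation in the direction `i`. -/
def Frame.heatForm (A : Frame m) (s : Fin m → ℝ) (F : Cube m → 𝓢(Rm m, ℝ)) (i : Fin m)
    (v : ℝ) : ℝ := A.spatialForm (cubeFun fun j => F j) (heatProd {i} v s)

/-- The square function estimate for configurations that are symmetric in the directions of `S`. -/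
def SquareBound (S : Finset (Fin m)) (D : ℝ) : Prop :=
  ∃ C : NNReal, ∀ A s F, IsConfig S D A s F → ∀ i ∈ S,
    ∫⁻ v in Set.Ioi (0 : ℝ), ENNReal.ofReal (s i ^ 2 * A.heatForm s F i v) ≤ C

/-! ### The estimate without cancellation -/

theorem heatProd_empty_nonneg (v : ℝ) (s : Fin m → ℝ) (x : R2m m) : 0 ≤ heatProd ∅ v s x :=
  Finset.prod_nonneg fun c _ => by simpa using heat_nonneg _ _

/-- The total mass is the value of the Fourier transform at the origin. -/
theorem lintegral_heatProd_empty {v : ℝ} (hv : 0 < v) {s : Fin m → ℝ} (hs : ∀ i, 0 < s i) :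
    ∫⁻ x, ENNReal.ofReal (heatProd ∅ v s x) = 1 := by
  obtain ⟨Ψ, h1, h2⟩ := exists_schwartz_heatProd ∅ hv hs 0
  have h3 := h2 0
  rw [SchwartzMap.fourier_coe, Real.fourier_eq'] at h3
  simp only [sub_zero] at h1
  simp [h1] at h3
  have h4 : ((∫ x, heatProd ∅ v s x : ℝ) : ℂ) = 1 := by rw [← integral_complex_ofReal, h3]
  have h5 : Integrable (heatProd ∅ v s) := by
    have := Ψ.integrable (μ := volume).re
    simpa [h1] using this
  rw [← ofReal_integral_eq_lintegral_ofReal h5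
    (Filter.Eventually.of_forall (heatProd_empty_nonneg v s))]
  rw [Complex.ofReal_eq_one] at h4
  rw [h4, ENNReal.ofReal_one]

/-- The arithmetic-geometric mean inequality with equal weights 2^(-m); for normalized functions it
does the work of Hölder's inequality. -/
theorem enorm_cubeFun_le (F : Cube m → Rm m → ℝ) (x : R2m m) :
    ‖cubeFun F x‖ₑ ≤ ∑ j, ((2 ^ m : ℕ) : ENNReal)⁻¹ * ‖F j (cubeProj j x)‖ₑ ^ (2 ^ m) := by
  have hn : (2 ^ m : ℕ) ≠ 0 := by positivity
  have h := Real.geom_mean_le_arith_mean_weighted Finset.univ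
    (fun _ : Cube m => ((2 ^ m : ℕ) : ℝ)⁻¹) (fun j => |F j (cubeProj j x)| ^ (2 ^ m))
    (fun _ _ => by positivity) (by simp) (fun _ _ => by positivity)
  simp only [Real.pow_rpow_inv_natCast (abs_nonneg _) hn] at h
  rw [← Finset.abs_prod] at h
  rw [cubeFun, Real.enorm_eq_ofReal_abs]
  refine (ENNReal.ofReal_le_ofReal h).trans_eq ?_
  rw [ENNReal.ofReal_sum_of_nonneg fun _ _ => by positivity]
  refine Finset.sum_congr rfl fun j _ => ?_
  rw [ENNReal.ofReal_mul (by positivity), ENNReal.ofReal_inv_of_pos (by positivity),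
    ENNReal.ofReal_natCast, ENNReal.ofReal_pow (abs_nonneg _), ← Real.enorm_eq_ofReal_abs]

theorem continuous_heatProd (B : Finset (Fin m)) (v : ℝ) (s : Fin m → ℝ) :
    Continuous (heatProd B v s) := by
  refine continuous_finsetProd _ fun c _ => ?_
  split_ifs
  · exact (continuous_heatDeriv _).comp (by fun_prop)
  · exact (continuous_heat _).comp (by fun_prop)

theorem Frame.continuous_emb (A : Frame m) : Continuous A.emb :=
  A.emb.continuous_of_finiteDimensional

theorem continuous_cubeProj (j : Cube m) : Continuous (cubeProj j) :=
  (cubeProj j).continuous_of_finiteDimensional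

/-- After x is translated by emb p, the p-integral for fixed x runs over a translate of the whole
parameter space, because Π_j ∘ emb is onto. So it is at most 1, and the mass of H remains. -/
theorem Frame.lintegral_face_le (A : Frame m) {G : Rm m → ENNReal} (hG : Measurable G)
    (j : Cube m) (hGA : ∫⁻ p, G (cubeProj j (A.emb p)) ≤ 1) {H : R2m m → ENNReal}
    (hH : Measurable H) (hH1 : ∫⁻ x, H x = 1) :
    ∫⁻ p, ∫⁻ x, G (cubeProj j x) * H (x - A.emb p) ≤ 1 := by
  have hemb := A.continuous_emb.measurable
  have hproj := (continuous_cubeProj j).measurable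
  calc ∫⁻ p, ∫⁻ x, G (cubeProj j x) * H (x - A.emb p)
      = ∫⁻ p, ∫⁻ x, G (cubeProj j (x + A.emb p)) * H x := by
        refine lintegral_congr fun p => ?_
        rw [← lintegral_add_right_eq_self _ (A.emb p)]
        simp only [add_sub_cancel_right]
    _ = ∫⁻ x, ∫⁻ p, G (cubeProj j (x + A.emb p)) * H x := by
        refine lintegral_lintegral_swap (Measurable.aemeasurable ?_)
        exact (hG.comp (hproj.comp (measurable_snd.add (hemb.comp measurable_fst)))).mul
          (hH.comp measurable_snd)
    _ ≤ ∫⁻ x, H x := by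
        refine lintegral_mono fun x => ?_
        obtain ⟨q, hq⟩ := (A.bij j).2 (cubeProj j x)
        have h1 : ∫⁻ p, G (cubeProj j (x + A.emb p)) * H x =
            (∫⁻ p, G (cubeProj j (A.emb p))) * H x := by
          have hm : Measurable fun p => G (cubeProj j (x + A.emb p)) :=
            hG.comp (hproj.comp (measurable_const.add hemb))
          rw [lintegral_mul_const _ hm]
          congr 1
          rw [← lintegral_add_right_eq_self (fun p => G (cubeProj j (A.emb p))) q]
          refine lintegral_congr fun p => ?_
          simp only [map_add]
          rw [← hq, add_comm]
        rw [h1]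
        exact mul_le_of_le_one_left' hGA
    _ = 1 := hH1

theorem Frame.lintegral_sum_face_le (A : Frame m) {G : Cube m → Rm m → ENNReal}
    (hG : ∀ j, Measurable (G j)) (hGA : ∀ j, ∫⁻ p, G j (cubeProj j (A.emb p)) ≤ 1)
    {H : R2m m → ENNReal} (hH : Measurable H) (hH1 : ∫⁻ x, H x = 1) (c : ENNReal) :
    ∫⁻ p, ∫⁻ x, ∑ j, c * (G j (cubeProj j x) * H (x - A.emb p)) ≤ ∑ _j : Cube m, c := by
  have hemb := A.continuous_emb.measurable
  have hproj (j : Cube m) := (continuous_cubeProj j).measurable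
  have hm2 (j : Cube m) : Measurable fun q : Rm m × R2m m =>
      G j (cubeProj j q.2) * H (q.2 - A.emb q.1) :=
    ((hG j).comp ((hproj j).comp measurable_snd)).mul
      (hH.comp (measurable_snd.sub (hemb.comp measurable_fst)))
  have hm1 (j : Cube m) (p : Rm m) : Measurable fun x : R2m m =>
      G j (cubeProj j x) * H (x - A.emb p) := (hm2 j).comp measurable_prodMk_left
  have hin (p : Rm m) : ∫⁻ x, ∑ j, c * (G j (cubeProj j x) * H (x - A.emb p)) =
      ∑ j, c * ∫⁻ x, G j (cubeProj j x) * H (x - A.emb p) := by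
    rw [lintegral_finsetSum _ fun j _ => (hm1 j p).const_mul _]
    exact Finset.sum_congr rfl fun j _ => lintegral_const_mul _ (hm1 j p)
  rw [lintegral_congr hin,
    lintegral_finsetSum _ fun j _ => (hm2 j).lintegral_prod_right'.const_mul _]
  refine Finset.sum_le_sum fun j _ => ?_
  rw [lintegral_const_mul _ (hm2 j).lintegral_prod_right']
  exact mul_le_of_le_one_right' (A.lintegral_face_le (hG j) j (hGA j) hH hH1)

/-- This estimate without cancellation, uniform in time and scales, controls the boundary terms of
the heat flow. -/
theorem Frame.abs_spatialForm_empty_le (A : Frame m) {F : Cube m → 𝓢(Rm m, ℝ)}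
    (hF : A.Normalized F) {v : ℝ} (hv : 0 < v) {s : Fin m → ℝ} (hs : ∀ i, 0 < s i) :
    |A.spatialForm (cubeFun fun j => F j) (heatProd ∅ v s)| ≤ 1 := by
  have hmeas (j : Cube m) : Measurable fun y => ‖F j y‖ₑ ^ (2 ^ m) :=
    (F j).continuous.measurable.enorm.pow_const _
  have hH : Measurable fun x => ENNReal.ofReal (heatProd ∅ v s x) :=
    (continuous_heatProd ∅ v s).measurable.ennreal_ofReal
  have key : ‖A.spatialForm (cubeFun fun j => F j) (heatProd ∅ v s)‖ₑ ≤ 1 := by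
    have h1 := A.lintegral_sum_face_le hmeas hF hH (lintegral_heatProd_empty hv hs)
      ((2 ^ m : ℕ) : ENNReal)⁻¹
    have h2 : ∑ _j : Cube m, ((2 ^ m : ℕ) : ENNReal)⁻¹ = 1 := by
      rw [Finset.sum_const, Finset.card_univ, nsmul_eq_mul, Fintype.card_pi]
      simp only [Fintype.card_fin, Finset.prod_const, Finset.card_univ]
      exact ENNReal.mul_inv_cancel (by simp) (ENNReal.natCast_ne_top _)
    rw [h2] at h1
    refine le_trans ?_ h1
    refine (enorm_integral_le_lintegral_enorm _).trans (lintegral_mono fun p => ?_)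
    refine (enorm_integral_le_lintegral_enorm _).trans (lintegral_mono fun x => ?_)
    have hb := enorm_cubeFun_le (fun j => F j) x
    rw [enorm_mul, Real.enorm_eq_ofReal (heatProd_empty_nonneg _ _ _)]
    generalize ENNReal.ofReal (heatProd ∅ v s (x - A.emb p)) = h
    refine (mul_le_mul' hb le_rfl).trans_eq ?_
    rw [Finset.sum_mul]
    exact Finset.sum_congr rfl fun j _ => mul_assoc _ _ _
  rw [Real.enorm_eq_ofReal_abs] at key
  exact ENNReal.ofReal_le_one.mp key

/-! ### Measurability in the time parameter -/

theorem measurable_heat : Measurable fun q : ℝ × ℝ => heat q.1 q.2 := by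
  unfold heat; fun_prop

theorem measurable_heatDeriv : Measurable fun q : ℝ × ℝ => heatDeriv q.1 q.2 := by
  unfold heatDeriv heat; fun_prop

theorem Frame.measurable_heatForm (A : Frame m) (s : Fin m → ℝ) (F : Cube m → 𝓢(Rm m, ℝ))
    (i : Fin m) : Measurable (A.heatForm s F i) := by
  have hemb := A.continuous_emb.measurable
  have h1 : Measurable fun q : (ℝ × Rm m) × R2m m =>
      cubeFun (fun j => F j) q.2 * heatProd {i} q.1.1 s (q.2 - A.emb q.1.2) := by
    refine Measurable.mul ?_ ?_
    · have : Continuous (cubeFun fun j => F j) := by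
        refine continuous_finsetProd _ fun j _ => ?_
        exact (F j).continuous.comp (continuous_cubeProj j)
      exact this.measurable.comp measurable_snd
    · refine Finset.measurable_prod _ fun c _ => ?_
      have hc : Measurable fun q : (ℝ × Rm m) × R2m m =>
          (q.1.1 * s c.2 ^ 2, (q.2 - A.emb q.1.2) c) := by
        refine Measurable.prodMk (by fun_prop) ?_
        have : Measurable fun x : R2m m => x c :=
          (EuclideanSpace.proj (𝕜 := ℝ) c).continuous.measurable
        exact this.comp (measurable_snd.sub (hemb.comp (measurable_snd.comp measurable_fst)))
      split_ifs
      · exact measurable_heatDeriv.comp hc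
      · exact measurable_heat.comp hc
  exact (h1.stronglyMeasurable.integral_prod_right.integral_prod_right).measurable

/-! ### Configurations and freezing -/

/-- Scales outside i may be enlarged without increasing `D`. After freezing, both coordinates with
index i of the vector dual to e_l are 0 or 1 according to whether l = i, so a larger scale in a
direction l ≠ i never has to be compared with the unchanged scale of i. -/
theorem IsConfig.freeze {S : Finset (Fin m)} {D : ℝ} (hD : 1 ≤ D) {A : Frame m} {s : Fin m → ℝ}
    {F : Cube m → 𝓢(Rm m, ℝ)} (h : IsConfig S D A s F) (i : Fin m) (a : Fin 2) {r : ℝ}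
    (hr : 1 ≤ r) :
    IsConfig (insert i S) D (A.freeze i a) (fun l => if l = i then s l else r * s l)
      (freezeTuple F i a) where
  pos l := by
    have := h.pos l
    split_ifs <;> positivity
  bound j l q hq c := by
    rw [Frame.freeze_emb, cubeProj_freezeMap] at hq
    rw [Frame.freeze_emb]
    by_cases hc : c.2 = i
    · have h1 : freezeMap i a (A.emb q) c = if i = l then 1 else 0 := by
        have h2 := congrArg (fun y : Rm m => y i) hq
        simp only [cubeProj_apply, Function.update_self, PiLp.single_apply] at h2
        rw [freezeMap_apply, hc, if_pos rfl, h2]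
      rw [h1, hc, if_pos rfl]
      split_ifs with h3 h4
      · subst h3
        rw [abs_one, one_mul]
        nlinarith [h.pos i]
      · exact absurd h3.symm h4
      · simp; nlinarith [h.pos i]
      · simp; nlinarith [h.pos i]
    · rw [freezeMap_apply_of_ne _ _ hc, if_neg hc]
      have h1 := h.bound _ l q hq c
      have h2 : (if l = i then s l else r * s l) ≤ r * s l := by
        have := h.pos l
        split_ifs <;> nlinarith
      calc _ ≤ |A.emb q c| * (r * s l) := by gcongr
        _ = r * (|A.emb q c| * s l) := by ring
        _ ≤ r * (D * s c.2) := by gcongr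
        _ = _ := by ring
  symm_emb l hl p := by
    rw [Frame.freeze_emb]
    by_cases hli : l = i
    · subst hli; simp
    · have := h.symm_emb l ((Finset.mem_insert.mp hl).resolve_left hli) p
      rwa [freezeMap_apply_of_ne _ _ hli, freezeMap_apply_of_ne _ _ hli]
  symm_fun l hl j b := by
    by_cases hli : l = i
    · subst hli; exact freezeTuple_symm F l a j b
    · simp only [freezeTuple]
      rw [Function.update_comm hli]
      exact h.symm_fun l ((Finset.mem_insert.mp hl).resolve_left hli) _ _
  normalized j := by
    simp only [Frame.freeze_emb, cubeProj_freezeMap, freezeTuple]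
    exact h.normalized _

/-- The multiplier `-4π² τ_i^0 τ_i^1 exp (-4π² v ∑ (s τ)²)`, modulated by `√v s ζ`. -/
def Frame.pairSymbol (A : Frame m) (i : Fin m) (s : Fin m → ℝ) (ζ : R2m m) (v : ℝ) (ξ : Rm m) :
    ℂ :=
  A.chi (WithLp.toLp 2 fun c => Real.sqrt v * s c.2 * ζ c) ξ *
    (-(4 * Real.pi ^ 2) * A.freq ξ (0, i) * A.freq ξ (1, i) * A.gauss s v ξ : ℝ)

/-- The pointwise form of the reduction to a larger set of symmetries. -/
theorem IsConfig.norm_pairSymbol_le {S : Finset (Fin m)} {D : ℝ} (hD : 1 ≤ D) {A : Frame m}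
    {s : Fin m → ℝ} {F : Cube m → 𝓢(Rm m, ℝ)} (h : IsConfig S D A s F) (i : Fin m) (ζ : R2m m)
    {v : ℝ} (hv : 0 < v) {w : ℝ} (hw : w = (D + 1) ^ 2 * (1 + ‖ζ‖) ^ 2) :
    ‖A.symbolForm (cubeSchwartz F) (A.pairSymbol i s ζ v)‖ ≤
      A.jac * (9 * w) ^ m * ∑ a, (A.freeze i a).heatForm
        (fun l => if l = i then s l else Real.sqrt (2 * w) * s l) (freezeTuple F i a) i v := by
  set z : R2m m := WithLp.toLp 2 fun c => Real.sqrt v * s c.2 * ζ c with hz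
  have hw1 : 1 ≤ w := by
    rw [hw]
    have := norm_nonneg ζ
    exact one_le_mul_of_one_le_of_one_le (one_le_pow₀ (by linarith)) (one_le_pow₀ (by linarith))
  have hzb (c : Fin 2 × Fin m) : |z c| ≤ Real.sqrt v * s c.2 * ‖ζ‖ := by
    have h1 : |ζ c| ≤ ‖ζ‖ := PiLp.norm_apply_le ζ c
    have := h.pos c.2
    rw [hz]
    simp only
    rw [abs_mul, abs_of_nonneg (by positivity)]
    gcongr
  have h1 := A.symbolForm_gauss (cubeSchwartz_apply F) {i} hv h.pos z
  simp only [Finset.prod_singleton] at h1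
  have h2 : A.symbolForm (cubeSchwartz F) (A.pairSymbol i s ζ v) = (A.jac *
      A.spatialForm (cubeFun fun j => F j) fun x => heatProd {i} v s (x - z) : ℝ) := h1
  rw [h2, Complex.norm_real, Real.norm_eq_abs, abs_mul, abs_of_pos A.jac_pos, mul_assoc]
  refine mul_le_mul_of_nonneg_left ((A.abs_spatialForm_le F i hv h.pos z).trans ?_) A.jac_pos.le
  rw [Finset.mul_sum]
  refine Finset.sum_le_sum fun a _ => ?_
  -- The multiple z (a, i) • q of this vector cancels the shift in the direction i. By `bound` its
  -- other coordinates are at most D in the given scales, which is what the choice of w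
  -- accommodates.
  obtain ⟨q, hq⟩ := (A.bij fun _ => a).2 (EuclideanSpace.single i 1)
  have hqi : A.emb q (a, i) = 1 := by
    have := congrArg (fun y : Rm m => y i) hq
    simpa using this
  refine (A.freeze i a).spatialForm_shift_le (freezeTuple F i a) i (fun p => by simp)
    (freezeTuple_symm F i a) hv hw1 h.pos (freezeMap i a z) (z (a, i) • q) (fun b => ?_) ?_
  · simp [hqi]
  · intro c hc
    rw [Frame.freeze_emb, freezeMap_apply_of_ne _ _ hc, freezeMap_apply_of_ne _ _ hc, map_smul,
      PiLp.smul_apply, smul_eq_mul]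
    have h3 := h.bound _ i q hq c
    have hsi := h.pos i
    have hsc := h.pos c.2
    have h4 : |z (a, i) * A.emb q c - z c| ≤ (D + 1) * (1 + ‖ζ‖) * (Real.sqrt v * s c.2) := by
      calc _ ≤ |z (a, i) * A.emb q c| + |z c| := abs_sub _ _
        _ ≤ (Real.sqrt v * s i * ‖ζ‖) * |A.emb q c| + Real.sqrt v * s c.2 * ‖ζ‖ := by
            rw [abs_mul]
            gcongr
            · exact hzb (a, i)
            · exact hzb c
        _ = Real.sqrt v * ‖ζ‖ * (|A.emb q c| * s i) + Real.sqrt v * s c.2 * ‖ζ‖ := by ring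
        _ ≤ Real.sqrt v * ‖ζ‖ * (D * s c.2) + Real.sqrt v * s c.2 * ‖ζ‖ := by gcongr
        _ = (D + 1) * ‖ζ‖ * (Real.sqrt v * s c.2) := by ring
        _ ≤ _ := by
            gcongr
            linarith
    calc _ = |z (a, i) * A.emb q c - z c| ^ 2 := (sq_abs _).symm
      _ ≤ ((D + 1) * (1 + ‖ζ‖) * (Real.sqrt v * s c.2)) ^ 2 := by gcongr
      _ = _ := by
          rw [hw, mul_pow, mul_pow, mul_pow (Real.sqrt v), Real.sq_sqrt hv.le]

/-- Cauchy–Schwarz bounds the modulated form by two frozen forms, which the estimate for `insert i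
S` controls. The growth (1 + ‖ζ‖)^(2m) comes from (9w)^m with w quadratic in 1 + ‖ζ‖. -/
theorem SquareBound.pairSymbol {S : Finset (Fin m)} {D : ℝ} (hD : 1 ≤ D) {i : Fin m}
    (hS : SquareBound (insert i S) D) :
    ∃ C : NNReal, ∀ A s F, IsConfig S D A s F → ∀ ζ : R2m m,
      ∫⁻ v in Set.Ioi (0 : ℝ), ‖(s i ^ 2 : ℝ) •
        A.symbolForm (cubeSchwartz F) (A.pairSymbol i s ζ v)‖ₑ ≤
      ENNReal.ofReal (A.jac * (1 + ‖ζ‖) ^ (2 * m)) * C := by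
  obtain ⟨C, hC⟩ := hS
  refine ⟨(9 * (D + 1) ^ 2).toNNReal ^ m * (2 * C), fun A s F h ζ => ?_⟩
  set w : ℝ := (D + 1) ^ 2 * (1 + ‖ζ‖) ^ 2 with hw
  set s' : Fin m → ℝ := fun l => if l = i then s l else Real.sqrt (2 * w) * s l with hs'
  have hs'i : s' i = s i := by simp [hs']
  have hw1 : 1 ≤ Real.sqrt (2 * w) := by
    rw [Real.one_le_sqrt, hw]
    have := norm_nonneg ζ
    have : 1 ≤ (D + 1) ^ 2 * (1 + ‖ζ‖) ^ 2 :=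
      one_le_mul_of_one_le_of_one_le (one_le_pow₀ (by linarith)) (one_le_pow₀ (by linarith))
    linarith
  have hconf (a : Fin 2) := h.freeze hD i a hw1
  have hpt (v : ℝ) (hv : v ∈ Set.Ioi (0 : ℝ)) : ‖(s i ^ 2 : ℝ) •
        A.symbolForm (cubeSchwartz F) (A.pairSymbol i s ζ v)‖ₑ ≤
      ENNReal.ofReal (A.jac * (9 * w) ^ m) * ∑ a, ENNReal.ofReal
        (s' i ^ 2 * (A.freeze i a).heatForm s' (freezeTuple F i a) i v) := by
    have hv' : 0 < v := hv
    have hnn (a : Fin 2) : 0 ≤ (A.freeze i a).heatForm s' (freezeTuple F i a) i v :=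
      (A.freeze i a).spatialForm_nonneg _ i
        ((hconf a).symm_emb i (Finset.mem_insert_self i S)) (freezeTuple_symm F i a) hv'
        (hconf a).pos
    rw [← ENNReal.ofReal_sum_of_nonneg fun a _ => mul_nonneg (sq_nonneg _) (hnn a),
      ← ENNReal.ofReal_mul (mul_nonneg A.jac_pos.le (by positivity)), ← ofReal_norm]
    refine ENNReal.ofReal_le_ofReal ?_
    rw [norm_smul, Real.norm_of_nonneg (sq_nonneg _), ← Finset.mul_sum, hs'i]
    have := h.norm_pairSymbol_le hD i ζ hv' hw
    calc _ ≤ s i ^ 2 * (A.jac * (9 * w) ^ m * ∑ a, (A.freeze i a).heatForm s'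
          (freezeTuple F i a) i v) := by gcongr
      _ = _ := by ring
  have hmeas (a : Fin 2) : Measurable fun v => ENNReal.ofReal
      (s' i ^ 2 * (A.freeze i a).heatForm s' (freezeTuple F i a) i v) :=
    (((A.freeze i a).measurable_heatForm s' _ i).const_mul _).ennreal_ofReal
  calc _ ≤ ∫⁻ v in Set.Ioi (0 : ℝ), ENNReal.ofReal (A.jac * (9 * w) ^ m) *
        ∑ a, ENNReal.ofReal (s' i ^ 2 * (A.freeze i a).heatForm s' (freezeTuple F i a) i v) :=
        setLIntegral_mono' measurableSet_Ioi hpt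
    _ = ENNReal.ofReal (A.jac * (9 * w) ^ m) * ∑ a, ∫⁻ v in Set.Ioi (0 : ℝ), ENNReal.ofReal
        (s' i ^ 2 * (A.freeze i a).heatForm s' (freezeTuple F i a) i v) := by
        rw [lintegral_const_mul _ (Finset.measurable_sum _ fun a _ => hmeas a),
          lintegral_finsetSum _ fun a _ => hmeas a]
    _ ≤ ENNReal.ofReal (A.jac * (9 * w) ^ m) * ∑ _a : Fin 2, (C : ENNReal) := by
        gcongr with a
        exact hC _ _ _ (hconf a) i (Finset.mem_insert_self i S)
    _ = _ := by
        have e1 : (9 * w) ^ m = (1 + ‖ζ‖) ^ (2 * m) * (9 * (D + 1) ^ 2) ^ m := by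
          rw [hw, show 9 * ((D + 1) ^ 2 * (1 + ‖ζ‖) ^ 2) =
            (1 + ‖ζ‖) ^ 2 * (9 * (D + 1) ^ 2) by ring, mul_pow, ← pow_mul]
        have e2 : ENNReal.ofReal ((9 * (D + 1) ^ 2) ^ m) =
            (((9 * (D + 1) ^ 2).toNNReal ^ m : NNReal) : ENNReal) := by
          rw [ENNReal.ofReal, Real.toNNReal_pow (by positivity)]
        rw [e1, ← mul_assoc, ENNReal.ofReal_mul (mul_nonneg A.jac_pos.le (by positivity)), e2]
        simp only [Finset.sum_const, Finset.card_univ, Fintype.card_fin, nsmul_eq_mul]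
        push_cast
        ring

end Config

end SingularBL

end

noncomputable section

namespace SingularBL

/-! ### Superpositions of multipliers; monomials times Gaussians -/

section Superposition

variable {m : ℕ} (A : Frame m)

namespace Frame

theorem continuous_fourier_transpose (Φ : 𝓢(R2m m, ℂ)) :
    Continuous fun ξ => 𝓕 Φ (-transposeCLM A.proj ξ) := by
  have := (𝓕 Φ).continuous
  fun_prop

theorem integrable_fourier_transpose (Φ : 𝓢(R2m m, ℂ)) :
    Integrable fun ξ => 𝓕 Φ (-transposeCLM A.proj ξ) := by
  have h := ((𝓕 (pushforward A.proj A.surj Φ)).integrable (μ := volume)).comp_neg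
  refine h.congr (Filter.Eventually.of_forall fun ξ => ?_)
  simp only [fourier_pushforward, map_neg]

/-- A bounded continuous multiplier has an integrable product with the transform. -/
theorem integrable_mul_multiplier (Φ : 𝓢(R2m m, ℂ)) {M : Rm m → ℂ} (hM : Measurable M) {C : ℝ}
    (hC : ∀ ξ, ‖M ξ‖ ≤ C) : Integrable fun ξ => 𝓕 Φ (-transposeCLM A.proj ξ) * M ξ :=
  (A.integrable_fourier_transpose Φ).mul_bdd (c := C) hM.aestronglyMeasurable
    (Filter.Eventually.of_forall hC)

variable {X : Type*} [MeasurableSpace X]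

theorem measurable_symbolForm (Φ : 𝓢(R2m m, ℂ)) {M : X → Rm m → ℂ}
    (hM : Measurable (Function.uncurry M)) : Measurable fun x => A.symbolForm Φ (M x) := by
  have h : Measurable fun q : X × Rm m => 𝓕 Φ (-transposeCLM A.proj q.2) * M q.1 q.2 :=
    ((A.continuous_fourier_transpose Φ).measurable.comp measurable_snd).mul hM
  exact (h.stronglyMeasurable.integral_prod_right').measurable

theorem symbolForm_integral (Φ : 𝓢(R2m m, ℂ)) {μ : Measure X} [SFinite μ] {M : X → Rm m → ℂ}
    (hM : Measurable (Function.uncurry M)) {g : X → ℝ} (hg : Integrable g μ)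
    (hb : ∀ᵐ x ∂μ, ∀ ξ, ‖M x ξ‖ ≤ g x) :
    A.symbolForm Φ (fun ξ => ∫ x, M x ξ ∂μ) = ∫ x, A.symbolForm Φ (M x) ∂μ := by
  simp only [symbolForm, ← integral_const_mul]
  refine integral_integral_swap ?_
  refine ((A.integrable_fourier_transpose Φ).norm.mul_prod hg).mono' ?_ ?_
  · exact (((A.continuous_fourier_transpose Φ).measurable.comp measurable_fst).mul
      (hM.comp measurable_swap)).aestronglyMeasurable
  · filter_upwards [Measure.quasiMeasurePreserving_snd.ae hb] with q hq
    simp only [Function.uncurry, norm_mul]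
    gcongr
    exact hq _

theorem enorm_symbolForm_integral_le (Φ : 𝓢(R2m m, ℂ)) {μ : Measure X} [SFinite μ]
    {M : X → Rm m → ℂ} (hM : Measurable (Function.uncurry M)) {g : X → ℝ} (hg : Integrable g μ)
    (hb : ∀ᵐ x ∂μ, ∀ ξ, ‖M x ξ‖ ≤ g x) :
    ‖A.symbolForm Φ (fun ξ => ∫ x, M x ξ ∂μ)‖ₑ ≤ ∫⁻ x, ‖A.symbolForm Φ (M x)‖ₑ ∂μ := by
  rw [A.symbolForm_integral Φ hM hg hb]
  exact enorm_integral_le_lintegral_enorm _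

theorem symbolForm_const_mul (Φ : 𝓢(R2m m, ℂ)) (c : ℂ) (M : Rm m → ℂ) :
    A.symbolForm Φ (fun ξ => c * M ξ) = c * A.symbolForm Φ M := by
  simp only [symbolForm, ← integral_const_mul]
  congr 1
  funext ξ
  ring

theorem symbolForm_sum {ι : Type*} (t : Finset ι) (Φ : 𝓢(R2m m, ℂ)) {M : ι → Rm m → ℂ}
    (hM : ∀ i ∈ t, Measurable (M i)) (hC : ∀ i ∈ t, ∃ C : ℝ, ∀ ξ, ‖M i ξ‖ ≤ C) :
    A.symbolForm Φ (fun ξ => ∑ i ∈ t, M i ξ) = ∑ i ∈ t, A.symbolForm Φ (M i) := by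
  simp only [symbolForm, Finset.mul_sum]
  refine integral_finsetSum _ fun i hi => ?_
  obtain ⟨C, hC⟩ := hC i hi
  exact A.integrable_mul_multiplier Φ (hM i hi) hC

/-! ### Monomials in the scaled frequencies -/

/-- The frequencies in units of the scales. -/
def wave (s : Fin m → ℝ) (ξ : Rm m) (c : Fin 2 × Fin m) : ℝ := s c.2 * A.freq ξ c

theorem continuous_wave (s : Fin m → ℝ) (c : Fin 2 × Fin m) :
    Continuous fun ξ => A.wave s ξ c := continuous_const.mul (A.continuous_freq c)

theorem wave_sq_le_energy (s : Fin m → ℝ) (ξ : Rm m) (c : Fin 2 × Fin m) :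
    A.wave s ξ c ^ 2 ≤ A.energy s ξ :=
  Finset.single_le_sum (f := fun c => A.wave s ξ c ^ 2) (fun _ _ => sq_nonneg _)
    (Finset.mem_univ c)

theorem abs_wave_le (s : Fin m → ℝ) (ξ : Rm m) (c : Fin 2 × Fin m) :
    |A.wave s ξ c| ≤ Real.sqrt (A.energy s ξ) :=
  Real.abs_le_sqrt (A.wave_sq_le_energy s ξ c)

/-- The product of the scaled frequencies with indices in `L`. -/
def mono (s : Fin m → ℝ) (L : Multiset (Fin 2 × Fin m)) (ξ : Rm m) : ℝ :=
  (L.map (A.wave s ξ)).prod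

@[simp] theorem mono_cons (s : Fin m → ℝ) (c : Fin 2 × Fin m) (L : Multiset (Fin 2 × Fin m))
    (ξ : Rm m) : A.mono s (c ::ₘ L) ξ = A.wave s ξ c * A.mono s L ξ := by
  simp [mono]

@[simp] theorem mono_zero (s : Fin m → ℝ) (ξ : Rm m) : A.mono s 0 ξ = 1 := by simp [mono]

theorem continuous_mono (s : Fin m → ℝ) (L : Multiset (Fin 2 × Fin m)) :
    Continuous (A.mono s L) := by
  induction L using Multiset.induction_on with
  | empty =>
    have : A.mono s 0 = fun _ => 1 := funext fun ξ => A.mono_zero s ξ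
    rw [this]
    exact continuous_const
  | cons c L ih =>
    have : A.mono s (c ::ₘ L) = fun ξ => A.wave s ξ c * A.mono s L ξ :=
      funext fun ξ => A.mono_cons s c L ξ
    rw [this]
    exact (A.continuous_wave s c).mul ih

theorem abs_mono_le (s : Fin m → ℝ) (L : Multiset (Fin 2 × Fin m)) (ξ : Rm m) :
    |A.mono s L ξ| ≤ Real.sqrt (A.energy s ξ) ^ L.card := by
  induction L using Multiset.induction_on with
  | empty => simp
  | cons c L ih =>
    rw [mono_cons, abs_mul, Multiset.card_cons, pow_succ, mul_comm]
    gcongr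
    exact A.abs_wave_le s ξ c

theorem mono_smul (t : ℝ) (s : Fin m → ℝ) (L : Multiset (Fin 2 × Fin m)) (ξ : Rm m) :
    A.mono (fun i => t * s i) L ξ = t ^ L.card * A.mono s L ξ := by
  induction L using Multiset.induction_on with
  | empty => simp
  | cons c L ih =>
    rw [mono_cons, mono_cons, ih, Multiset.card_cons, wave, wave]
    ring

theorem gauss_pos (s : Fin m → ℝ) (v : ℝ) (ξ : Rm m) : 0 < A.gauss s v ξ := Real.exp_pos _

theorem continuous_gauss (s : Fin m → ℝ) (v : ℝ) : Continuous (A.gauss s v) := by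
  have := A.continuous_energy s
  unfold gauss
  fun_prop

theorem measurable_gauss (s : Fin m → ℝ) :
    Measurable fun q : ℝ × Rm m => A.gauss s q.1 q.2 := by
  have := A.continuous_energy s
  unfold gauss
  fun_prop

theorem gauss_le_one (s : Fin m → ℝ) {v : ℝ} (hv : 0 ≤ v) (ξ : Rm m) : A.gauss s v ξ ≤ 1 := by
  rw [gauss, Real.exp_le_one_iff]
  have := A.energy_nonneg s ξ
  have : 0 ≤ 4 * Real.pi ^ 2 * v * A.energy s ξ := by positivity
  linarith

/-- The bound depends on the frame and the scales only through the energy. It follows from r^k ≤ k!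
e^r and completing the square. -/
theorem sqrt_energy_pow_mul_gauss_le (k : ℕ) {a : ℝ} (ha : 0 < a) :
    ∃ C : ℝ, 0 ≤ C ∧ ∀ (A : Frame m) (s : Fin m → ℝ) (v : ℝ), a ≤ v → ∀ ξ,
      Real.sqrt (A.energy s ξ) ^ k * A.gauss s v ξ ≤ C := by
  have h1 : Filter.Tendsto (fun r : ℝ => r ^ k * Real.exp (-r)) Filter.atTop (nhds 0) :=
    Real.tendsto_pow_mul_exp_neg_atTop_nhds_zero k
  have h2 (r : ℝ) (hr : 0 ≤ r) : r ^ k * Real.exp (-(4 * Real.pi ^ 2 * a * r ^ 2)) ≤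
      k.factorial * Real.exp (1 / (4 * (4 * Real.pi ^ 2 * a))) := by
    have hb : 0 < 4 * Real.pi ^ 2 * a := by positivity
    set b := 4 * Real.pi ^ 2 * a
    have h3 : r ^ k ≤ k.factorial * Real.exp r := by
      have := Real.pow_div_factorial_le_exp r hr k
      rwa [div_le_iff₀ (by positivity), mul_comm] at this
    calc r ^ k * Real.exp (-(b * r ^ 2)) ≤ k.factorial * Real.exp r * Real.exp (-(b * r ^ 2)) := by
          gcongr
      _ = k.factorial * Real.exp (r - b * r ^ 2) := by
          rw [mul_assoc, ← Real.exp_add, sub_eq_add_neg]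
      _ ≤ _ := by
          gcongr
          rw [le_div_iff₀ (by positivity)]
          nlinarith [sq_nonneg (2 * b * r - 1)]
  refine ⟨_, by positivity, fun A s v hv ξ => le_trans ?_ (h2 _ (Real.sqrt_nonneg (A.energy s ξ)))⟩
  rw [Real.sq_sqrt (A.energy_nonneg s ξ), gauss]
  have := A.energy_nonneg s ξ
  gcongr

/-- The multiplier given by a monomial times a Gaussian. -/
def monoSymbol (s : Fin m → ℝ) (L : Multiset (Fin 2 × Fin m)) (v : ℝ) (ξ : Rm m) : ℂ :=
  (A.mono s L ξ * A.gauss s v ξ : ℝ)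

theorem norm_monoSymbol_le (L : Multiset (Fin 2 × Fin m)) {a : ℝ} (ha : 0 < a) :
    ∃ C : ℝ, 0 ≤ C ∧ ∀ (A : Frame m) (s : Fin m → ℝ) (v : ℝ), a ≤ v → ∀ ξ,
      ‖A.monoSymbol s L v ξ‖ ≤ C := by
  obtain ⟨C, hC0, hC⟩ := sqrt_energy_pow_mul_gauss_le (m := m) L.card ha
  refine ⟨C, hC0, fun A s v hv ξ => le_trans ?_ (hC A s v hv ξ)⟩
  rw [monoSymbol, Complex.norm_real, Real.norm_eq_abs, abs_mul, abs_of_pos (A.gauss_pos s v ξ)]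
  have := (A.gauss_pos s v ξ).le
  gcongr
  exact A.abs_mono_le s L ξ

theorem measurable_monoSymbol (s : Fin m → ℝ) (L : Multiset (Fin 2 × Fin m)) :
    Measurable fun q : ℝ × Rm m => A.monoSymbol s L q.1 q.2 := by
  have h1 : Measurable fun q : ℝ × Rm m => A.mono s L q.2 :=
    (A.continuous_mono s L).measurable.comp measurable_snd
  exact (h1.mul (A.measurable_gauss s)).complex_ofReal

theorem measurable_monoSymbol_right (s : Fin m → ℝ) (L : Multiset (Fin 2 × Fin m)) (v : ℝ) :
    Measurable (A.monoSymbol s L v) :=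
  ((A.continuous_mono s L).mul (A.continuous_gauss s v)).measurable.complex_ofReal

theorem measurable_symbolForm_mono (Φ : 𝓢(R2m m, ℂ)) (s : Fin m → ℝ)
    (L : Multiset (Fin 2 × Fin m)) : Measurable fun v => A.symbolForm Φ (A.monoSymbol s L v) :=
  A.measurable_symbolForm Φ (A.measurable_monoSymbol s L)

end Frame

end Superposition

/-! ### Linear relations between the frequencies -/

section Relation

variable {m : ℕ}

/-- The range of the transpose is orthogonal to the kernel; every relation between the frequencies
comes from this. -/
theorem Frame.sum_freq_mul_emb (A : Frame m) (ξ q : Rm m) :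
    ∑ c, A.freq ξ c * A.emb q c = 0 := by
  have h := inner_transposeCLM A.proj (A.emb q) ξ
  rw [A.proj_emb, inner_zero_left, PiLp.inner_apply] at h
  exact h

/-- The linear relation that expresses the frequencies at one vertex of the cube by those at the
opposite vertex. -/
theorem IsConfig.exists_relation {S : Finset (Fin m)} {D : ℝ} (hD : 0 ≤ D) {A : Frame m}
    {s : Fin m → ℝ} {F : Cube m → 𝓢(Rm m, ℝ)} (h : IsConfig S D A s F) (j : Cube m) (i : Fin m) :
    ∃ κ : Fin m → ℝ, (∀ l, |κ l| ≤ D) ∧ (∀ l ∈ S, κ l = 0) ∧ ∀ ξ,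
      A.wave s ξ (j i, i) + (if i ∈ S then A.wave s ξ (opp j i, i) else 0) =
        ∑ l, κ l * A.wave s ξ (opp j l, l) := by
  -- Testing the orthogonality against the kernel vector whose coordinates at the vertex j are those
  -- of e_i isolates the frequency at (j i, i).
  obtain ⟨q, hq⟩ := (A.bij j).2 (EuclideanSpace.single i 1)
  have hq' (l : Fin m) : A.emb q (j l, l) = if l = i then 1 else 0 := by
    have := congrArg (fun y : Rm m => y l) hq
    simpa [PiLp.single_apply] using this
  -- In a symmetric direction the coordinate at the opposite vertex is again 0 or 1. So directions
  -- of S drop out of the right-hand side, and i itself, if in S, adds its opposite frequency on the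
  -- left.
  have hS (l : Fin m) (hl : l ∈ S) : A.emb q (opp j l, l) = A.emb q (j l, l) := by
    have h1 := h.symm_emb l hl q
    rcases fin_two_eq_or (j l) 0 with h2 | h2 <;> simp [h2, h1]
  refine ⟨fun l => if l ∈ S then 0 else -(A.emb q (opp j l, l) * s i / s l), fun l => ?_,
    fun l hl => if_pos hl, fun ξ => ?_⟩
  · beta_reduce
    split_ifs
    · simpa using hD
    · have h1 := h.bound j i q hq (opp j l, l)
      rw [abs_neg, abs_div, abs_mul, abs_of_pos (h.pos i), abs_of_pos (h.pos l),
        div_le_iff₀ (h.pos l)]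
      exact h1
  · have h1 := A.sum_freq_mul_emb ξ q
    have h2 : ∑ c, A.freq ξ c * A.emb q c = ∑ l, (A.freq ξ (j l, l) * A.emb q (j l, l) +
        A.freq ξ (opp j l, l) * A.emb q (opp j l, l)) := by
      rw [Fintype.sum_prod_type_right]
      refine Finset.sum_congr rfl fun l _ => ?_
      rw [Fin.sum_univ_two]
      rcases fin_two_eq_or (j l) 0 with h3 | h3 <;> simp [h3, add_comm]
    have h3 (l : Fin m) : s i * (A.freq ξ (opp j l, l) * A.emb q (opp j l, l)) =
        (if l = i then if i ∈ S then A.wave s ξ (opp j i, i) else 0 else 0) -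
          (if l ∈ S then 0 else -(A.emb q (opp j l, l) * s i / s l)) *
            A.wave s ξ (opp j l, l) := by
      have hl := (h.pos l).ne'
      by_cases hlS : l ∈ S
      · rw [hS l hlS, hq', if_pos hlS]
        by_cases hli : l = i
        · subst hli; simp [hlS, Frame.wave]
        · simp [hli]
      · have : (if l = i then if i ∈ S then A.wave s ξ (opp j i, i) else 0 else 0) = 0 := by
          by_cases hli : l = i
          · subst hli; simp [hlS]
          · simp [hli]
        rw [this, if_neg hlS, Frame.wave]
        field_simp
        ring
    rw [h2, Finset.sum_add_distrib] at h1
    simp only [hq', mul_ite, mul_one, mul_zero, Finset.sum_ite_eq', Finset.mem_univ, if_true] at h1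
    have h4 := congrArg (s i * ·) h1
    simp only [mul_add, Finset.mul_sum, h3, mul_zero, Finset.sum_sub_distrib, Finset.sum_ite_eq',
      Finset.mem_univ, if_true] at h4
    have h5 : A.wave s ξ (j i, i) = s i * A.freq ξ (j i, i) := rfl
    rw [h5]
    linarith

end Relation

end SingularBL

end

noncomputable section

namespace SingularBL

/-! ### Monomials times Gaussians as Fourier transforms -/

/-- Each derivative multiplies the transform by 2πiξ, starting from the heat kernel at time 1. -/
theorem exists_schwartz_pow_gauss (k : ℕ) : ∃ φ : 𝓢(ℝ, ℂ), ∀ ξ,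
    𝓕 φ ξ = ((ξ ^ k * Real.exp (-(4 * Real.pi ^ 2 * ξ ^ 2)) : ℝ) : ℂ) := by
  induction k with
  | zero =>
    obtain ⟨φ, -, h⟩ := exists_schwartz_heat one_pos
    exact ⟨φ, fun ξ => by rw [h]; simp⟩
  | succ k ih =>
    obtain ⟨φ, h⟩ := ih
    refine ⟨(2 * Real.pi * Complex.I : ℂ)⁻¹ • SchwartzMap.derivCLM ℂ ℂ φ, fun ξ => ?_⟩
    have h3 : ((SchwartzMap.derivCLM ℂ ℂ φ : 𝓢(ℝ, ℂ)) : ℝ → ℂ) = deriv φ :=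
      funext fun x => SchwartzMap.derivCLM_apply ..
    have h4 : 𝓕 (SchwartzMap.derivCLM ℂ ℂ φ) ξ = 2 * Real.pi * Complex.I * ξ * 𝓕 φ ξ := by
      rw [SchwartzMap.fourier_coe, h3, Real.fourier_deriv φ.integrable φ.differentiable
        (by rw [← h3]; exact (SchwartzMap.derivCLM ℂ ℂ φ).integrable), ← SchwartzMap.fourier_coe]
      simp only [smul_eq_mul]
    rw [FourierTransform.fourier_smul, smul_apply, h4, h, smul_eq_mul]
    have : (2 * Real.pi * Complex.I : ℂ) ≠ 0 := Complex.two_pi_I_ne_zero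
    push_cast
    field_simp
    ring

theorem exists_schwartz_monomial_gauss {m : ℕ} (L : Multiset (Fin 2 × Fin m)) :
    ∃ ρ : 𝓢(R2m m, ℂ), ∀ η, 𝓕 ρ η = (((L.map fun c => η c).prod *
      Real.exp (-(4 * Real.pi ^ 2 * ∑ c, η c ^ 2)) : ℝ) : ℂ) := by
  choose φ hφ using exists_schwartz_pow_gauss
  refine ⟨tensor fun c => φ (L.count c), fun η => ?_⟩
  rw [fourier_tensor]
  simp only [hφ]
  rw [← Complex.ofReal_prod, Finset.prod_mul_distrib, ← Real.exp_sum, Finset.mul_sum,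
    ← Finset.sum_neg_distrib, Finset.prod_multiset_map_count]
  congr 2
  symm
  refine Finset.prod_subset (Finset.subset_univ _) fun c _ hc => ?_
  rw [Multiset.count_eq_zero.mpr (by simpa using hc), pow_zero]

theorem lintegral_schwartz_mul_pow_lt_top {E : Type*} [NormedAddCommGroup E] [NormedSpace ℝ E]
    [FiniteDimensional ℝ E] [MeasureSpace E] [BorelSpace E]
    [(volume : Measure E).IsAddHaarMeasure] (ρ : 𝓢(E, ℂ)) (k : ℕ) :
    ∫⁻ ζ, ‖ρ ζ‖ₑ * ENNReal.ofReal ((1 + ‖ζ‖) ^ k) < ⊤ := by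
  obtain ⟨C, hC, h⟩ := schwartz_decay ρ (k + (Module.finrank ℝ E + 1))
  have hi : Integrable fun x : E => C * (1 + ‖x‖) ^ (-((Module.finrank ℝ E + 1 : ℕ) : ℝ)) :=
    (integrable_one_add_norm (by simp)).const_mul _
  refine lt_of_le_of_lt (lintegral_mono fun ζ => ?_) hi.lintegral_lt_top
  rw [← ofReal_norm, ← ENNReal.ofReal_mul (norm_nonneg _)]
  refine ENNReal.ofReal_le_ofReal ?_
  calc ‖ρ ζ‖ * (1 + ‖ζ‖) ^ k ≤ C * (1 + ‖ζ‖) ^ (-((k + (Module.finrank ℝ E + 1) : ℕ) : ℝ)) *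
        (1 + ‖ζ‖) ^ k := by gcongr; exact h ζ
    _ = _ := by
      rw [mul_assoc, ← Real.rpow_natCast (1 + ‖ζ‖) k, ← Real.rpow_add (by positivity)]
      congr 2
      push_cast
      ring

theorem lintegral_lintegral_mul_le {X Y : Type*} [MeasurableSpace X] [MeasurableSpace Y]
    {μ : Measure X} {ν : Measure Y} [SFinite μ] [SFinite ν] {g w : Y → ENNReal}
    {G : X → Y → ENNReal} (hg : Measurable g) (hG : Measurable (Function.uncurry G))
    (h : ∀ y, ∫⁻ x, G x y ∂μ ≤ w y) :
    ∫⁻ x, ∫⁻ y, g y * G x y ∂ν ∂μ ≤ ∫⁻ y, g y * w y ∂ν := by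
  rw [lintegral_lintegral_swap ((hg.comp measurable_snd).mul hG).aemeasurable]
  refine lintegral_mono fun y => ?_
  have h1 : Measurable fun x => G x y := hG.comp (measurable_id.prodMk measurable_const)
  rw [lintegral_const_mul _ h1]
  exact mul_le_mul' le_rfl (h y)

/-! ### Monomials that contain both frequencies of one index -/

section MonoBound

variable {m : ℕ}

theorem Frame.measurable_pairSymbol (A : Frame m) (i : Fin m) (s : Fin m → ℝ) :
    Measurable fun q : (ℝ × R2m m) × Rm m => A.pairSymbol i s q.1.2 q.1.1 q.2 := by
  have h1 (c : Fin 2 × Fin m) : Measurable fun q : (ℝ × R2m m) × Rm m => A.freq q.2 c :=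
    (A.continuous_freq c).measurable.comp measurable_snd
  have h2 : Measurable fun q : (ℝ × R2m m) × Rm m => A.gauss s q.1.1 q.2 :=
    (A.measurable_gauss s).comp ((measurable_fst.comp measurable_fst).prodMk measurable_snd)
  have h3 (c : Fin 2 × Fin m) : Measurable fun q : (ℝ × R2m m) × Rm m => q.1.2 c :=
    (EuclideanSpace.proj (𝕜 := ℝ) c).continuous.measurable.comp
      (measurable_snd.comp measurable_fst)
  have h4 : Measurable fun q : (ℝ × R2m m) × Rm m =>
      ∑ c : Fin 2 × Fin m, Real.sqrt q.1.1 * s c.2 * q.1.2 c * A.freq q.2 c := by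
    refine Finset.measurable_sum _ fun c _ => ?_
    have := h1 c
    have := h3 c
    fun_prop
  have h5 : Measurable fun q : (ℝ × R2m m) × Rm m =>
      -(4 * Real.pi ^ 2) * A.freq q.2 (0, i) * A.freq q.2 (1, i) * A.gauss s q.1.1 q.2 :=
    (((h1 _).const_mul _).mul (h1 _)).mul h2
  exact ((h4.complex_ofReal.const_mul _).neg.cexp).mul h5.complex_ofReal

theorem Frame.measurable_symbolForm_pair (A : Frame m) (Φ : 𝓢(R2m m, ℂ)) (i : Fin m)
    (s : Fin m → ℝ) :
    Measurable fun q : ℝ × R2m m => A.symbolForm Φ (A.pairSymbol i s q.2 q.1) :=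
  A.measurable_symbolForm Φ (M := fun (q : ℝ × R2m m) ξ => A.pairSymbol i s q.2 q.1 ξ)
    (A.measurable_pairSymbol i s)

theorem Frame.norm_pairSymbol (A : Frame m) (i : Fin m) (s : Fin m → ℝ) (ζ : R2m m) (v : ℝ)
    (ξ : Rm m) : s i ^ 2 * ‖A.pairSymbol i s ζ v ξ‖ =
      4 * Real.pi ^ 2 * ‖A.monoSymbol s {(0, i), (1, i)} v ξ‖ := by
  rw [Frame.pairSymbol, norm_mul, Frame.norm_chi, one_mul, Complex.norm_real, Frame.monoSymbol,
    Complex.norm_real, ← Real.norm_of_nonneg (sq_nonneg (s i)), ← norm_mul]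
  have h : (4 * Real.pi ^ 2 : ℝ) = ‖(-(4 * Real.pi ^ 2) : ℝ)‖ := by
    rw [norm_neg, Real.norm_of_nonneg (by positivity)]
  conv_rhs => rw [h]
  rw [← norm_mul]
  congr 1
  rw [Multiset.insert_eq_cons, Frame.mono_cons, ← Multiset.cons_zero, Frame.mono_cons,
    Frame.mono_zero, Frame.wave, Frame.wave]
  ring

/-- The square function estimate for the Gaussian multiplied by a monomial of degree `2 n + 2`. -/
def MonoBound (S : Finset (Fin m)) (D : ℝ) (L : Multiset (Fin 2 × Fin m)) (n : ℕ) : Prop :=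
  ∃ C : NNReal, ∀ A s F, IsConfig S D A s F →
    ∫⁻ v in Set.Ioi (0 : ℝ), ‖((v ^ n : ℝ) : ℂ) *
      A.symbolForm (cubeSchwartz F) (A.monoSymbol s L v)‖ₑ ≤ ENNReal.ofReal A.jac * C

theorem IsConfig.smul {S : Finset (Fin m)} {D : ℝ} {A : Frame m} {s : Fin m → ℝ}
    {F : Cube m → 𝓢(Rm m, ℝ)} (h : IsConfig S D A s F) {t : ℝ} (ht : 0 < t) :
    IsConfig S D A (fun i => t * s i) F where
  pos i := mul_pos ht (h.pos i)
  bound j i q hq c := by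
    have := h.bound j i q hq c
    calc _ = t * (|A.emb q c| * s i) := by ring
      _ ≤ t * (D * s c.2) := by gcongr
      _ = _ := by ring
  symm_emb := h.symm_emb
  symm_fun := h.symm_fun
  normalized := h.normalized

/-- A vector dual to e_i with i ∉ S vanishes in the coordinates with index in S, by symmetry of the
embedding. Stretched scales therefore only have to be compared with stretched ones, and `D` survives
with no dependence on r. -/
theorem IsConfig.stretch {S : Finset (Fin m)} {D : ℝ} (hD : 0 ≤ D) {A : Frame m} {s : Fin m → ℝ}
    {F : Cube m → 𝓢(Rm m, ℝ)} (h : IsConfig S D A s F) {r : ℝ} (hr : 1 ≤ r) :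
    IsConfig S D A (fun i => if i ∈ S then s i else r * s i) F where
  pos i := by
    have := h.pos i
    split_ifs <;> positivity
  bound j i q hq c := by
    have h1 := h.bound j i q hq c
    have hc := h.pos c.2
    have hi := h.pos i
    by_cases hiS : i ∈ S
    · rw [if_pos hiS]
      refine h1.trans ?_
      gcongr
      split_ifs
      · exact le_rfl
      · nlinarith
    · rw [if_neg hiS]
      by_cases hcS : c.2 ∈ S
      · have h2 : A.emb q c = 0 := by
          have h3 : A.emb q (j c.2, c.2) = 0 := by
            have h4 := congrArg (fun y : Rm m => y c.2) hq
            have h5 : c.2 ≠ i := fun h6 => hiS (h6 ▸ hcS)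
            simpa [PiLp.single_apply, h5] using h4
          have h6 := h.symm_emb c.2 hcS q
          obtain ⟨a, l⟩ := c
          rcases fin_two_eq_or (j l) 0 with h7 | h7 <;> rcases fin_two_eq_or a 0 with h8 | h8 <;>
            simp_all
        rw [h2, if_pos hcS]
        simpa using mul_nonneg hD hc.le
      · rw [if_neg hcS]
        calc _ = r * (|A.emb q c| * s i) := by ring
          _ ≤ r * (D * s c.2) := by gcongr
          _ = _ := by ring
  symm_emb := h.symm_emb
  symm_fun := h.symm_fun
  normalized := h.normalized

theorem Frame.energy_smul (A : Frame m) (t : ℝ) (s : Fin m → ℝ) (ξ : Rm m) :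
    A.energy (fun i => t * s i) ξ = t ^ 2 * A.energy s ξ := by
  rw [Frame.energy, Frame.energy, Finset.mul_sum]
  exact Finset.sum_congr rfl fun c _ => by ring

/-- A Gaussian at scales √2 s is the product of two Gaussians at scales s. One stays with the pair
of index i. The other, with the monomial L and v^n, is the transform of ρ at the point √v times the
scaled frequency, hence a superposition of characters. The powers of √2 add up to 2^(n+1). -/
theorem Frame.pow_mul_monoSymbol_eq (A : Frame m) (i : Fin m) (s : Fin m → ℝ) {n : ℕ}
    {L : Multiset (Fin 2 × Fin m)} (hL : L.card = 2 * n) {ρ : 𝓢(R2m m, ℂ)}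
    (hρ : ∀ η, 𝓕 ρ η = (((L.map fun c => η c).prod *
      Real.exp (-(4 * Real.pi ^ 2 * ∑ c, η c ^ 2)) : ℝ) : ℂ)) {v : ℝ} (hv : 0 < v) (ξ : Rm m) :
    ((v ^ n : ℝ) : ℂ) * A.monoSymbol (fun l => Real.sqrt 2 * s l) ((0, i) ::ₘ (1, i) ::ₘ L) v ξ =
      ∫ ζ, -((2 ^ (n + 1) / (4 * Real.pi ^ 2) : ℝ) : ℂ) * ρ ζ *
        (((s i ^ 2 : ℝ) : ℂ) * A.pairSymbol i s ζ v ξ) := by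
  have h1 : 𝓕 ρ (WithLp.toLp 2 fun c => Real.sqrt v * A.wave s ξ c) =
      ((v ^ n * A.mono s L ξ * A.gauss s v ξ : ℝ) : ℂ) := by
    rw [hρ]
    have e1 : (L.map fun c => Real.sqrt v * A.wave s ξ c).prod = v ^ n * A.mono s L ξ := by
      have := A.mono_smul (Real.sqrt v) s L ξ
      rw [hL, pow_mul, Real.sq_sqrt hv.le] at this
      rw [← this, mono]
      congr 2
      funext c
      simp only [wave]
      ring
    have e2 : Real.exp (-(4 * Real.pi ^ 2 * ∑ c, (Real.sqrt v * A.wave s ξ c) ^ 2)) =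
        A.gauss s v ξ := by
      rw [gauss, energy]
      congr 2
      rw [mul_assoc (4 * Real.pi ^ 2), Finset.mul_sum (a := v)]
      congr 1
      refine Finset.sum_congr rfl fun c _ => ?_
      rw [mul_pow, Real.sq_sqrt hv.le, wave]
    simp only [e1, e2]
  have h2 (ζ : R2m m) : -((2 ^ (n + 1) / (4 * Real.pi ^ 2) : ℝ) : ℂ) * ρ ζ *
        (((s i ^ 2 : ℝ) : ℂ) * A.pairSymbol i s ζ v ξ) =
      ((2 ^ (n + 1) * (A.wave s ξ (0, i) * A.wave s ξ (1, i)) * A.gauss s v ξ : ℝ) : ℂ) *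
        (Complex.exp ((-2 * Real.pi * inner ℝ ζ
          (WithLp.toLp 2 fun c => Real.sqrt v * A.wave s ξ c : R2m m) : ℝ) * Complex.I) • ρ ζ) := by
    have e1 : A.chi (WithLp.toLp 2 fun c => Real.sqrt v * s c.2 * ζ c) ξ =
        Complex.exp ((-2 * Real.pi * inner ℝ ζ
          (WithLp.toLp 2 fun c => Real.sqrt v * A.wave s ξ c : R2m m) : ℝ) * Complex.I) := by
      rw [chi]
      congr 1
      have e2 : inner ℝ ζ (WithLp.toLp 2 fun c => Real.sqrt v * A.wave s ξ c : R2m m) =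
          ∑ c, Real.sqrt v * s c.2 * ζ c * A.freq ξ c := by
        rw [PiLp.inner_apply]
        refine Finset.sum_congr rfl fun c _ => ?_
        simp only [wave, RCLike.inner_apply, conj_trivial]
        ring
      rw [e2]
      push_cast
      ring
    have hpi : (Real.pi : ℂ) ≠ 0 := by exact_mod_cast Real.pi_ne_zero
    rw [pairSymbol, e1, smul_eq_mul, wave, wave]
    push_cast
    field_simp
  simp only [h2]
  rw [integral_const_mul, ← Real.fourier_eq', ← SchwartzMap.fourier_coe, h1, monoSymbol,
    mono_cons, mono_cons, mono_smul, hL, pow_mul, Real.sq_sqrt (by norm_num), gauss, energy_smul,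
    Real.sq_sqrt (by norm_num), gauss]
  rw [show -(4 * Real.pi ^ 2 * v * (2 * A.energy s ξ)) = -(4 * Real.pi ^ 2 * v * A.energy s ξ) +
    -(4 * Real.pi ^ 2 * v * A.energy s ξ) by ring, Real.exp_add]
  simp only [wave]
  have h3 : Real.sqrt 2 * Real.sqrt 2 = 2 := Real.mul_self_sqrt (by norm_num)
  rw [← Complex.ofReal_mul, ← Complex.ofReal_mul]
  congr 1
  linear_combination (v ^ n * s i ^ 2 * A.freq ξ (0, i) * A.freq ξ (1, i) * 2 ^ n * A.mono s L ξ *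
    Real.exp (-(4 * Real.pi ^ 2 * v * A.energy s ξ)) ^ 2) * h3

theorem Frame.enorm_pow_mul_monoSymbol_le (A : Frame m) (Φ : 𝓢(R2m m, ℂ)) (i : Fin m)
    (s : Fin m → ℝ) {n : ℕ} {L : Multiset (Fin 2 × Fin m)} (hL : L.card = 2 * n)
    {ρ : 𝓢(R2m m, ℂ)} (hρ : ∀ η, 𝓕 ρ η = (((L.map fun c => η c).prod *
      Real.exp (-(4 * Real.pi ^ 2 * ∑ c, η c ^ 2)) : ℝ) : ℂ)) {κ : ℂ}
    (hκ : κ = -((2 ^ (n + 1) / (4 * Real.pi ^ 2) : ℝ) : ℂ)) {v : ℝ} (hv : 0 < v) :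
    ‖((v ^ n : ℝ) : ℂ) * A.symbolForm Φ
      (A.monoSymbol (fun l => Real.sqrt 2 * s l) ((0, i) ::ₘ (1, i) ::ₘ L) v)‖ₑ ≤
      ∫⁻ ζ, ‖κ * ρ ζ‖ₑ * ‖(s i ^ 2 : ℝ) • A.symbolForm Φ (A.pairSymbol i s ζ v)‖ₑ := by
  obtain ⟨B, hB0, hB⟩ := Frame.norm_monoSymbol_le (m := m) {(0, i), (1, i)} hv
  rw [← A.symbolForm_const_mul]
  have e1 : (fun ξ => ((v ^ n : ℝ) : ℂ) *
      A.monoSymbol (fun l => Real.sqrt 2 * s l) ((0, i) ::ₘ (1, i) ::ₘ L) v ξ) =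
      fun ξ => ∫ ζ, κ * ρ ζ * (((s i ^ 2 : ℝ) : ℂ) * A.pairSymbol i s ζ v ξ) := by
    funext ξ
    rw [hκ]
    exact A.pow_mul_monoSymbol_eq i s hL hρ hv ξ
  rw [e1]
  have hm : Measurable (Function.uncurry fun (ζ : R2m m) (ξ : Rm m) =>
      κ * ρ ζ * (((s i ^ 2 : ℝ) : ℂ) * A.pairSymbol i s ζ v ξ)) := by
    have h0 : Measurable fun q : R2m m × Rm m => ((v, q.1), q.2) :=
      (measurable_const.prodMk measurable_fst).prodMk measurable_snd
    have h1 := (A.measurable_pairSymbol i s).comp h0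
    have h2 : Measurable fun q : R2m m × Rm m => κ * ρ q.1 :=
      (ρ.continuous.measurable.comp measurable_fst).const_mul κ
    exact h2.mul (h1.const_mul _)
  have hg : Integrable (fun ζ => ‖κ‖ * (4 * Real.pi ^ 2 * B) * ‖ρ ζ‖) :=
    (ρ.integrable (μ := volume)).norm.const_mul _
  refine (A.enorm_symbolForm_integral_le Φ hm hg
    (Filter.Eventually.of_forall fun ζ ξ => ?_)).trans (lintegral_mono fun ζ => ?_)
  · rw [norm_mul, norm_mul, norm_mul, Complex.norm_real, Real.norm_of_nonneg (sq_nonneg _),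
      A.norm_pairSymbol]
    calc _ ≤ ‖κ‖ * ‖ρ ζ‖ * (4 * Real.pi ^ 2 * B) := by gcongr; exact hB A s v le_rfl ξ
      _ = _ := by ring
  · rw [A.symbolForm_const_mul, A.symbolForm_const_mul, enorm_mul, Complex.real_smul]

/-- The extra monomial is written as a superposition of modulations with Schwartz density ρ; the
decay of ρ pays for the polynomial growth in ζ of the estimate for a single modulation. -/
theorem SquareBound.monoBound_pair {S : Finset (Fin m)} {D : ℝ} (hD : 1 ≤ D) {i : Fin m}
    (hS : SquareBound (insert i S) D) {n : ℕ} {L : Multiset (Fin 2 × Fin m)}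
    (hL : L.card = 2 * n) : MonoBound S D ((0, i) ::ₘ (1, i) ::ₘ L) n := by
  obtain ⟨C, hC⟩ := hS.pairSymbol hD
  obtain ⟨ρ, hρ⟩ := exists_schwartz_monomial_gauss L
  set κ : ℂ := -((2 ^ (n + 1) / (4 * Real.pi ^ 2) : ℝ) : ℂ) with hκ
  have hK := (lintegral_schwartz_mul_pow_lt_top ρ (2 * m)).ne
  set K := ∫⁻ ζ, ‖ρ ζ‖ₑ * ENNReal.ofReal ((1 + ‖ζ‖) ^ (2 * m)) with hKdef
  refine ⟨C * (‖κ‖₊ * K.toNNReal), fun A s F h => ?_⟩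
  -- The scales are divided by √2 in advance, because the splitting of the Gaussian doubles the
  -- time.
  obtain ⟨s', hs'⟩ : ∃ s' : Fin m → ℝ, s' = fun l => (Real.sqrt 2)⁻¹ * s l := ⟨_, rfl⟩
  have hconf : IsConfig S D A s' F := by
    rw [hs']
    exact h.smul (by positivity)
  have hss : s = fun l => Real.sqrt 2 * s' l := by
    funext l
    rw [hs', mul_inv_cancel_left₀ (by positivity)]
  have hmP := A.measurable_symbolForm_pair (cubeSchwartz F) i s'
  have hpt (v : ℝ) (hv : v ∈ Set.Ioi (0 : ℝ)) :
      ‖((v ^ n : ℝ) : ℂ) * A.symbolForm (cubeSchwartz F)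
        (A.monoSymbol s ((0, i) ::ₘ (1, i) ::ₘ L) v)‖ₑ ≤
      ∫⁻ ζ, ‖κ * ρ ζ‖ₑ *
        ‖(s' i ^ 2 : ℝ) • A.symbolForm (cubeSchwartz F) (A.pairSymbol i s' ζ v)‖ₑ := by
    rw [hss]
    exact A.enorm_pow_mul_monoSymbol_le _ i s' hL hρ hκ hv
  have hmG : Measurable fun q : ℝ × R2m m =>
      ‖(s' i ^ 2 : ℝ) • A.symbolForm (cubeSchwartz F) (A.pairSymbol i s' q.2 q.1)‖ₑ :=
    (hmP.const_smul (s' i ^ 2 : ℝ)).enorm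
  have hmg : Measurable fun ζ => ‖κ * ρ ζ‖ₑ := (ρ.continuous.measurable.const_mul κ).enorm
  have key := lintegral_lintegral_mul_le (μ := volume.restrict (Set.Ioi (0 : ℝ))) (ν := volume)
    (G := fun v ζ => ‖(s' i ^ 2 : ℝ) • A.symbolForm (cubeSchwartz F) (A.pairSymbol i s' ζ v)‖ₑ)
    hmg hmG (hC A s' F hconf)
  refine (setLIntegral_mono' measurableSet_Ioi hpt).trans (key.trans_eq ?_)
  have e1 (ζ : R2m m) : ‖κ * ρ ζ‖ₑ * (ENNReal.ofReal (A.jac * (1 + ‖ζ‖) ^ (2 * m)) * C) =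
      (ENNReal.ofReal A.jac * C * ‖κ‖ₑ) *
        (‖ρ ζ‖ₑ * ENNReal.ofReal ((1 + ‖ζ‖) ^ (2 * m))) := by
    rw [ENNReal.ofReal_mul A.jac_pos.le, enorm_mul]
    ring
  have e2 : Measurable fun ζ => ‖ρ ζ‖ₑ * ENNReal.ofReal ((1 + ‖ζ‖) ^ (2 * m)) :=
    ρ.continuous.measurable.enorm.mul (by fun_prop)
  rw [lintegral_congr e1, lintegral_const_mul _ e2, ← hKdef]
  push_cast
  rw [ENNReal.coe_toNNReal hK, enorm_eq_nnnorm]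
  ring

end MonoBound

end SingularBL

end

noncomputable section

namespace SingularBL

/-! ### Rewriting monomials until a pair appears -/

section Reduction

variable {m : ℕ}

theorem Frame.norm_symbolForm_le (A : Frame m) (Φ : 𝓢(R2m m, ℂ)) {M : Rm m → ℂ} {C : ℝ}
    (hC : ∀ ξ, ‖M ξ‖ ≤ C) :
    ‖A.symbolForm Φ M‖ ≤ (∫ ξ, ‖𝓕 Φ (-transposeCLM A.proj ξ)‖) * C := by
  rw [← integral_mul_const]
  refine norm_integral_le_of_norm_le ((A.integrable_fourier_transpose Φ).norm.mul_const C)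
    (Filter.Eventually.of_forall fun ξ => ?_)
  rw [norm_mul]
  gcongr
  exact hC ξ

/-- A linear combination of monomials, with a Gaussian. -/
theorem Frame.lintegral_combination_le (A : Frame m) (Φ : 𝓢(R2m m, ℂ)) (s : Fin m → ℝ) (n : ℕ)
    {ι : Type*} (t : Finset ι) {κ : ι → ℝ} {D : ℝ} (hκ : ∀ k ∈ t, |κ k| ≤ D)
    {L : ι → Multiset (Fin 2 × Fin m)} {p : Rm m → ℝ}
    (hp : ∀ ξ, p ξ = ∑ k ∈ t, κ k * A.mono s (L k) ξ) :
    ∫⁻ v in Set.Ioi (0 : ℝ), ‖((v ^ n : ℝ) : ℂ) *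
        A.symbolForm Φ (fun ξ => (p ξ * A.gauss s v ξ : ℝ))‖ₑ ≤
      ∑ k ∈ t, ENNReal.ofReal D * ∫⁻ v in Set.Ioi (0 : ℝ), ‖((v ^ n : ℝ) : ℂ) *
        A.symbolForm Φ (A.monoSymbol s (L k) v)‖ₑ := by
  have hm (k : ι) : Measurable fun v : ℝ => ‖((v ^ n : ℝ) : ℂ) *
      A.symbolForm Φ (A.monoSymbol s (L k) v)‖ₑ := by
    have h1 : Measurable fun v : ℝ => ((v ^ n : ℝ) : ℂ) := by fun_prop
    exact (h1.mul (A.measurable_symbolForm_mono Φ s (L k))).enorm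
  have e (v : ℝ) (hv : v ∈ Set.Ioi (0 : ℝ)) : ‖((v ^ n : ℝ) : ℂ) *
        A.symbolForm Φ (fun ξ => (p ξ * A.gauss s v ξ : ℝ))‖ₑ ≤
      ∑ k ∈ t, ENNReal.ofReal D * ‖((v ^ n : ℝ) : ℂ) *
        A.symbolForm Φ (A.monoSymbol s (L k) v)‖ₑ := by
    have e1 : (fun ξ => ((p ξ * A.gauss s v ξ : ℝ) : ℂ)) =
        fun ξ => ∑ k ∈ t, (κ k : ℂ) * A.monoSymbol s (L k) v ξ := by
      funext ξ
      rw [hp, Finset.sum_mul, Complex.ofReal_sum]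
      refine Finset.sum_congr rfl fun k _ => ?_
      rw [Frame.monoSymbol]
      push_cast
      ring
    have hB (k : ι) : ∃ C : ℝ, ∀ ξ, ‖(κ k : ℂ) * A.monoSymbol s (L k) v ξ‖ ≤ C := by
      obtain ⟨B, hB0, hB⟩ := Frame.norm_monoSymbol_le (m := m) (L k) (a := v) hv
      refine ⟨‖(κ k : ℂ)‖ * B, fun ξ => ?_⟩
      rw [norm_mul]
      gcongr
      exact hB A s v le_rfl ξ
    rw [e1, A.symbolForm_sum t Φ (fun k _ => (A.measurable_monoSymbol_right s (L k) v).const_mul _)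
      fun k _ => hB k, Finset.mul_sum]
    refine (enorm_sum_le _ _).trans (Finset.sum_le_sum fun k hk => ?_)
    rw [A.symbolForm_const_mul, mul_left_comm, enorm_mul]
    refine mul_le_mul' ?_ le_rfl
    rw [← ofReal_norm, Complex.norm_real]
    exact ENNReal.ofReal_le_ofReal (hκ k hk)
  refine (setLIntegral_mono' measurableSet_Ioi e).trans_eq ?_
  rw [lintegral_finsetSum _ fun k _ => (hm k).const_mul _]
  exact Finset.sum_congr rfl fun k _ => lintegral_const_mul _ (hm k)

/-- The constant is uniform over the coefficients below D'; this matters because the coefficients of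
the relations vary with the configuration. -/
theorem MonoBound.combination {S : Finset (Fin m)} {D : ℝ} {n : ℕ} {ι : Type*} (t : Finset ι)
    {L : ι → Multiset (Fin 2 × Fin m)} (h : ∀ k ∈ t, MonoBound S D (L k) n) (D' : ℝ) :
    ∃ C : NNReal, ∀ A s F, IsConfig S D A s F → ∀ (κ : ι → ℝ) (p : Rm m → ℝ),
      (∀ k ∈ t, |κ k| ≤ D') → (∀ ξ, p ξ = ∑ k ∈ t, κ k * A.mono s (L k) ξ) →
      ∫⁻ v in Set.Ioi (0 : ℝ), ‖((v ^ n : ℝ) : ℂ) *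
        A.symbolForm (cubeSchwartz F) (fun ξ => (p ξ * A.gauss s v ξ : ℝ))‖ₑ ≤
      ENNReal.ofReal A.jac * C := by
  choose! C hC using h
  refine ⟨∑ k ∈ t, D'.toNNReal * C k, fun A s F hF κ p hκ hp => ?_⟩
  refine (A.lintegral_combination_le _ s n t hκ hp).trans ?_
  rw [ENNReal.ofNNReal_finsetSum, Finset.mul_sum]
  refine Finset.sum_le_sum fun k hk => ?_
  refine (mul_le_mul' le_rfl (hC k hk A s F hF)).trans_eq ?_
  rw [ENNReal.coe_mul, ENNReal.ofReal, ENNReal.ofReal]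
  ring

/-- One factor is replaced through the relation at the vertex j by factors from the opposite vertex,
all outside S. Only j i is prescribed; the rest of j is free and steers which factors appear. -/
theorem MonoBound.expand {S : Finset (Fin m)} {D : ℝ} (hD : 0 ≤ D) {n : ℕ} {j : Cube m}
    {i : Fin m} (hi : i ∉ S) {L : Multiset (Fin 2 × Fin m)}
    (h : ∀ l ∉ S, MonoBound S D ((opp j l, l) ::ₘ L) n) : MonoBound S D ((j i, i) ::ₘ L) n := by
  obtain ⟨C, hC⟩ := MonoBound.combination (n := n) (D := D) (S := S) Sᶜ
    (L := fun l => (opp j l, l) ::ₘ L) (fun l hl => h l (by simpa using hl)) D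
  refine ⟨C, fun A s F hF => ?_⟩
  obtain ⟨κ, h1, h2, h3⟩ := hF.exists_relation hD j i
  refine hC A s F hF κ (A.mono s ((j i, i) ::ₘ L)) (fun l _ => h1 l) fun ξ => ?_
  have h4 := h3 ξ
  rw [if_neg hi, add_zero, ← Finset.sum_subset (Finset.subset_univ Sᶜ)
    fun l _ hl => by rw [h2 l (by simpa using hl), zero_mul]] at h4
  rw [Frame.mono_cons, h4, Finset.sum_mul]
  exact Finset.sum_congr rfl fun l _ => by rw [Frame.mono_cons, mul_assoc]

theorem monoBound_of_mem {S : Finset (Fin m)} {D : ℝ} (hD : 1 ≤ D) {i : Fin m}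
    (hS : SquareBound (insert i S) D) {n : ℕ} {L : Multiset (Fin 2 × Fin m)}
    (hL : L.card = 2 * n + 2) {b : Fin 2} (h0 : (b, i) ∈ L) (h1 : (1 - b, i) ∈ L) :
    MonoBound S D L n := by
  have key (h0 : (0, i) ∈ L) (h1 : (1, i) ∈ L) : MonoBound S D L n := by
    obtain ⟨L1, rfl⟩ := Multiset.exists_cons_of_mem h0
    rw [Multiset.mem_cons] at h1
    obtain ⟨L2, rfl⟩ := Multiset.exists_cons_of_mem (h1.resolve_left (by simp))
    exact hS.monoBound_pair hD (by simpa using hL)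
  rcases fin_two_eq_or b 0 with rfl | rfl
  · exact key h0 h1
  · exact key h1 h0

/-- P holds factors with distinct indices, L the factors still to be expanded. Expanding a factor of
L either completes a pair with P or adds a new index to P. As the degree exceeds m, pairs must occur
before L is exhausted. -/
theorem monoBound_of_card_lt {S : Finset (Fin m)} {D : ℝ} (hD : 1 ≤ D)
    (hS : ∀ i ∉ S, SquareBound (insert i S) D) {n : ℕ} (hn : m < 2 * n + 2)
    (L : Multiset (Fin 2 × Fin m)) : ∀ P : Multiset (Fin 2 × Fin m),
      (P.map Prod.snd).Nodup → (P + L).card = 2 * n + 2 → (∀ c ∈ P + L, c.2 ∉ S) →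
      MonoBound S D (P + L) n := by
  induction L using Multiset.induction_on with
  | empty =>
    intro P hP hc _
    -- With L empty, P would have more than m factors with distinct indices among m.
    have h1 := Multiset.card_le_card (Multiset.le_iff_subset hP |>.mpr
      (fun x _ => Finset.mem_univ x) : P.map Prod.snd ≤ (Finset.univ : Finset (Fin m)).val)
    simp at h1 hc
    omega
  | cons c L ih =>
    intro P hP hcard hcS
    rw [Multiset.add_cons] at hcard hcS ⊢
    rw [Multiset.card_cons] at hcard
    have hcS' : c.2 ∉ S := hcS c (Multiset.mem_cons_self _ _)
    by_cases hc : (1 - c.1, c.2) ∈ P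
    · exact monoBound_of_mem hD (hS _ hcS') (by rw [Multiset.card_cons, hcard]) (b := c.1)
        (Multiset.mem_cons_self _ _)
        (Multiset.mem_cons_of_mem (Multiset.mem_add.mpr (Or.inl hc)))
    -- The vertex agrees with the components present in P and with c at its own index; the two
    -- demands are compatible since the partner of c is not in P. The expansion therefore yields the
    -- partner of a factor of P, or a factor whose index is not in P.
    let j : Cube m := fun l => if l = c.2 then c.1 else if (1, l) ∈ P then 1 else 0
    have hj : c = (j c.2, c.2) := by simp [j]
    rw [hj]
    refine MonoBound.expand (zero_le_one.trans hD) hcS' fun l hl => ?_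
    by_cases hlP : l ∈ P.map Prod.snd
    · obtain ⟨⟨b, l'⟩, hb, rfl⟩ := Multiset.mem_map.mp hlP
      have hjP : (j l', l') ∈ P := by
        by_cases hlc : l' = c.2
        · rcases fin_two_eq_or b c.1 with h | h
          · simpa [j, hlc, ← h] using hlc ▸ hb
          · exact absurd (by rw [← h, ← hlc]; exact hb) hc
        · by_cases h1 : (1, l') ∈ P
          · simp [j, hlc, h1]
          · rcases fin_two_eq_or b 0 with h | h
            · simpa [j, hlc, h1, ← h] using hb
            · exact absurd (by simpa [h] using hb) h1
      exact monoBound_of_mem hD (hS _ hl) (by rw [Multiset.card_cons, hcard]) (b := j l')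
        (Multiset.mem_cons_of_mem (Multiset.mem_add.mpr (Or.inl hjP)))
        (Multiset.mem_cons_self _ _)
    · rw [← Multiset.cons_add]
      refine ih _ ?_ ?_ ?_
      · rw [Multiset.map_cons, Multiset.nodup_cons]
        exact ⟨hlP, hP⟩
      · rw [Multiset.cons_add, Multiset.card_cons, hcard]
      · intro d hd
        rw [Multiset.cons_add, Multiset.mem_cons] at hd
        rcases hd with rfl | hd
        · exact hl
        · exact hcS d (Multiset.mem_cons_of_mem hd)

/-! ### Lowering the degree -/

/-- The part of the energy in the directions outside `S`. -/
def Frame.lowEnergy (A : Frame m) (S : Finset (Fin m)) (s : Fin m → ℝ) (ξ : Rm m) : ℝ :=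
  ∑ c ∈ Finset.univ ×ˢ Sᶜ, A.wave s ξ c ^ 2

theorem Frame.energy_eq_lowEnergy_add (A : Frame m) (S : Finset (Fin m)) (s : Fin m → ℝ)
    (ξ : Rm m) : A.energy s ξ =
      A.lowEnergy S s ξ + ∑ c ∈ Finset.univ ×ˢ S, A.wave s ξ c ^ 2 := by
  rw [Frame.lowEnergy, add_comm, ← Finset.sum_union, ← Finset.product_union, Finset.union_compl]
  · rfl
  · exact Finset.disjoint_product.mpr (Or.inr disjoint_compl_right)

/-- The scales with the directions outside `S` stretched by `r`. -/
def stretchScale (S : Finset (Fin m)) (r : ℝ) (s : Fin m → ℝ) (i : Fin m) : ℝ :=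
  if i ∈ S then s i else r * s i

theorem Frame.energy_stretchScale (A : Frame m) (S : Finset (Fin m)) {α : ℝ} (hα : 0 ≤ α)
    (s : Fin m → ℝ) (ξ : Rm m) : A.energy (stretchScale S (Real.sqrt α) s) ξ =
      A.energy s ξ + (α - 1) * A.lowEnergy S s ξ := by
  have h1 (s : Fin m → ℝ) := A.energy_eq_lowEnergy_add S s ξ
  have h2 : A.lowEnergy S (stretchScale S (Real.sqrt α) s) ξ = α * A.lowEnergy S s ξ := by
    rw [Frame.lowEnergy, Frame.lowEnergy, Finset.mul_sum]
    refine Finset.sum_congr rfl fun c hc => ?_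
    have : c.2 ∉ S := by simpa using hc
    rw [Frame.wave, Frame.wave, stretchScale, if_neg this, mul_assoc, mul_pow, Real.sq_sqrt hα]
  have h3 : ∑ c ∈ Finset.univ ×ˢ S, A.wave (stretchScale S (Real.sqrt α) s) ξ c ^ 2 =
      ∑ c ∈ Finset.univ ×ˢ S, A.wave s ξ c ^ 2 := by
    refine Finset.sum_congr rfl fun c hc => ?_
    have : c.2 ∈ S := by simpa using hc
    rw [Frame.wave, Frame.wave, stretchScale, if_pos this]
  rw [h1, h1 s, h2, h3]
  ring

theorem Frame.mono_stretchScale (A : Frame m) (S : Finset (Fin m)) (r : ℝ) (s : Fin m → ℝ)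
    {L : Multiset (Fin 2 × Fin m)} (hL : ∀ c ∈ L, c.2 ∉ S) (ξ : Rm m) :
    A.mono (stretchScale S r s) L ξ = r ^ L.card * A.mono s L ξ := by
  rw [← A.mono_smul, Frame.mono, Frame.mono]
  congr 1
  refine Multiset.map_congr rfl fun c hc => ?_
  rw [Frame.wave, stretchScale, if_neg (hL c hc), Frame.wave]

/-- The integrand in the representation of a Gaussian as a superposition of Gaussians with
stretched scales. -/
def Frame.stretchSymbol (A : Frame m) (S : Finset (Fin m)) (s : Fin m → ℝ)
    (L : Multiset (Fin 2 × Fin m)) (v α : ℝ) (ξ : Rm m) : ℂ :=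
  (A.mono s L ξ * A.gauss s v ξ * (4 * Real.pi ^ 2 * v * A.lowEnergy S s ξ *
    Real.exp (-(4 * Real.pi ^ 2 * v * A.lowEnergy S s ξ * (α - 1)))) : ℝ)

theorem Frame.lowEnergy_nonneg (A : Frame m) (S : Finset (Fin m)) (s : Fin m → ℝ) (ξ : Rm m) :
    0 ≤ A.lowEnergy S s ξ := Finset.sum_nonneg fun _ _ => sq_nonneg _

theorem Frame.continuous_lowEnergy (A : Frame m) (S : Finset (Fin m)) (s : Fin m → ℝ) :
    Continuous (A.lowEnergy S s) :=
  continuous_finsetSum _ fun c _ => (A.continuous_wave s c).pow 2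

theorem Frame.measurable_stretchSymbol (A : Frame m) (S : Finset (Fin m)) (s : Fin m → ℝ)
    (L : Multiset (Fin 2 × Fin m)) :
    Measurable fun q : (ℝ × ℝ) × Rm m => A.stretchSymbol S s L q.1.1 q.1.2 q.2 := by
  have h1 : Measurable fun q : (ℝ × ℝ) × Rm m => A.mono s L q.2 :=
    (A.continuous_mono s L).measurable.comp measurable_snd
  have h2 : Measurable fun q : (ℝ × ℝ) × Rm m => A.gauss s q.1.1 q.2 :=
    (A.measurable_gauss s).comp ((measurable_fst.comp measurable_fst).prodMk measurable_snd)
  have h3 : Measurable fun q : (ℝ × ℝ) × Rm m => A.lowEnergy S s q.2 :=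
    (A.continuous_lowEnergy S s).measurable.comp measurable_snd
  unfold Frame.stretchSymbol
  fun_prop

theorem integral_mul_exp_Ioi_one {b : ℝ} (hb : 0 < b) :
    ∫ α in Set.Ioi (1 : ℝ), b * Real.exp (-(b * (α - 1))) = 1 := by
  have h := integral_exp_mul_Ioi (a := -b) (by linarith) 1
  have e (α : ℝ) : b * Real.exp (-(b * (α - 1))) = b * Real.exp b * Real.exp (-b * α) := by
    rw [mul_assoc, ← Real.exp_add]
    ring_nf
  simp only [e]
  rw [integral_const_mul, h, mul_one, Real.exp_neg]
  field_simp

/-- The density b e^(-b(α-1)) on (1, ∞) has mass 1 for b > 0, where b is a multiple of the energy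
outside S. Where that energy vanishes so does the monomial, which has at least one factor and only
factors outside S. -/
theorem Frame.integral_stretchSymbol (A : Frame m) (S : Finset (Fin m)) (s : Fin m → ℝ)
    {L : Multiset (Fin 2 × Fin m)} (hL0 : L ≠ 0) (hL : ∀ c ∈ L, c.2 ∉ S) {v : ℝ} (hv : 0 < v)
    (ξ : Rm m) :
    ∫ α in Set.Ioi (1 : ℝ), A.stretchSymbol S s L v α ξ = A.monoSymbol s L v ξ := by
  simp only [Frame.stretchSymbol]
  rw [integral_complex_ofReal, integral_const_mul, Frame.monoSymbol]
  rcases (A.lowEnergy_nonneg S s ξ).eq_or_lt with h0 | h0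
  · obtain ⟨c, hc⟩ := Multiset.exists_mem_of_ne_zero hL0
    have h1 : A.wave s ξ c = 0 := by
      have h2 := (Finset.sum_eq_zero_iff_of_nonneg fun c _ => sq_nonneg (A.wave s ξ c)).mp
        h0.symm c (by simpa using hL c hc)
      simpa using h2
    obtain ⟨L', rfl⟩ := Multiset.exists_cons_of_mem hc
    rw [Frame.mono_cons, h1]
    simp
  · have := integral_mul_exp_Ioi_one (b := 4 * Real.pi ^ 2 * v * A.lowEnergy S s ξ) (by positivity)
    rw [this, mul_one]

/-- The exponential turns the Gaussian into one with the scales outside S stretched by √α, and the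
energy factor raises the degree by two. Expressing the monomial of degree 2n + 4 in stretched scales
costs α^(-(n+2)). -/
theorem Frame.stretchSymbol_eq (A : Frame m) (S : Finset (Fin m)) (s : Fin m → ℝ) {n : ℕ}
    {L : Multiset (Fin 2 × Fin m)} (hLc : L.card = 2 * n + 2) (hL : ∀ c ∈ L, c.2 ∉ S) (v : ℝ)
    {α : ℝ} (hα : 0 < α) (ξ : Rm m) :
    A.stretchSymbol S s L v α ξ = ((4 * Real.pi ^ 2 * (α ^ (n + 2))⁻¹ * v : ℝ) : ℂ) *
      ∑ c ∈ Finset.univ ×ˢ Sᶜ,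
        A.monoSymbol (stretchScale S (Real.sqrt α) s) (c ::ₘ c ::ₘ L) v ξ := by
  have h1 (c : Fin 2 × Fin m) (hc : c ∈ Finset.univ ×ˢ Sᶜ) :
      A.monoSymbol (stretchScale S (Real.sqrt α) s) (c ::ₘ c ::ₘ L) v ξ =
        ((α ^ (n + 2) * (A.wave s ξ c ^ 2 * A.mono s L ξ) *
          A.gauss (stretchScale S (Real.sqrt α) s) v ξ : ℝ) : ℂ) := by
    have hc' : c.2 ∉ S := by simpa using hc
    rw [Frame.monoSymbol, A.mono_stretchScale S _ s (by simpa [hc'] using hL), Frame.mono_cons,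
      Frame.mono_cons, Multiset.card_cons, Multiset.card_cons, hLc,
      show 2 * n + 2 + 1 + 1 = 2 * (n + 2) by ring, pow_mul, Real.sq_sqrt hα.le]
    ring_nf
  rw [Finset.sum_congr rfl h1, ← Complex.ofReal_sum, ← Complex.ofReal_mul, Frame.stretchSymbol,
    ← Finset.sum_mul, ← Finset.mul_sum, ← Finset.sum_mul]
  congr 1
  have h2 : A.gauss (stretchScale S (Real.sqrt α) s) v ξ = A.gauss s v ξ *
      Real.exp (-(4 * Real.pi ^ 2 * v * A.lowEnergy S s ξ * (α - 1))) := by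
    rw [Frame.gauss, A.energy_stretchScale S hα.le, Frame.gauss, ← Real.exp_add]
    ring_nf
  rw [h2]
  change _ = 4 * Real.pi ^ 2 * (α ^ (n + 2))⁻¹ * v * (α ^ (n + 2) *
    (A.lowEnergy S s ξ * A.mono s L ξ) * _)
  field_simp

end Reduction

end SingularBL

end

noncomputable section

namespace SingularBL

/-! ### The estimate for all monomials in directions outside S -/

section SquareFunction

variable {m : ℕ}

theorem integrableOn_inv_pow_Ioi_one (n : ℕ) (a : ℝ) :
    IntegrableOn (fun α : ℝ => a * (α ^ (n + 2))⁻¹) (Set.Ioi 1) := by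
  have h := integrableOn_Ioi_rpow_of_lt (a := -((n + 2 : ℕ) : ℝ)) (c := 1)
    (by push_cast; linarith [(Nat.cast_nonneg n : (0 : ℝ) ≤ n)]) one_pos
  refine IntegrableOn.congr_fun (h.const_mul a) (fun α hα => ?_) measurableSet_Ioi
  have hα' : (0 : ℝ) < α := one_pos.trans hα
  simp only [Real.rpow_neg hα'.le, Real.rpow_natCast]

theorem Frame.enorm_monoSymbol_le_lintegral (A : Frame m) (Φ : 𝓢(R2m m, ℂ)) (S : Finset (Fin m))
    (s : Fin m → ℝ) {n : ℕ} {L : Multiset (Fin 2 × Fin m)} (hLc : L.card = 2 * n + 2)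
    (hL : ∀ c ∈ L, c.2 ∉ S) {v : ℝ} (hv : 0 < v) :
    ‖A.symbolForm Φ (A.monoSymbol s L v)‖ₑ ≤
      ∫⁻ α in Set.Ioi (1 : ℝ), ‖A.symbolForm Φ (A.stretchSymbol S s L v α)‖ₑ := by
  have hL0 : L ≠ 0 := by
    rintro rfl
    simp at hLc
  have e : A.monoSymbol s L v =
      fun ξ => ∫ α in Set.Ioi (1 : ℝ), A.stretchSymbol S s L v α ξ :=
    funext fun ξ => (A.integral_stretchSymbol S s hL0 hL hv ξ).symm
  choose B hB0 hB using fun c : Fin 2 × Fin m =>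
    Frame.norm_monoSymbol_le (m := m) (c ::ₘ c ::ₘ L) hv
  have h0 : Measurable fun q : ℝ × Rm m => ((v, q.1), q.2) :=
    (measurable_const.prodMk measurable_fst).prodMk measurable_snd
  have hm := (A.measurable_stretchSymbol S s L).comp h0
  have hg : Integrable (fun α : ℝ => 4 * Real.pi ^ 2 * v *
      (∑ c ∈ Finset.univ ×ˢ Sᶜ, B c) * (α ^ (n + 2))⁻¹) (volume.restrict (Set.Ioi 1)) :=
    integrableOn_inv_pow_Ioi_one n _
  rw [e]
  refine A.enorm_symbolForm_integral_le Φ (M := fun α ξ => A.stretchSymbol S s L v α ξ) hm hg ?_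
  filter_upwards [ae_restrict_mem measurableSet_Ioi] with α hα ξ
  have hα' : (0 : ℝ) < α := one_pos.trans hα
  rw [A.stretchSymbol_eq S s hLc hL v hα' ξ, norm_mul, Complex.norm_real,
    Real.norm_of_nonneg (by positivity)]
  calc _ ≤ 4 * Real.pi ^ 2 * (α ^ (n + 2))⁻¹ * v * ∑ c ∈ Finset.univ ×ˢ Sᶜ, B c := by
        gcongr
        exact norm_sum_le_of_le _ fun c _ => hB c A _ v le_rfl ξ
    _ = _ := by ring

/-- The superposition trades degree 2n + 2 and weight v^n for degree 2n + 4 and weight v^(n+1).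
Stretched configurations satisfy the same hypotheses with the same `D`, and α^(-(n+2)) is integrable
on (1, ∞). -/
theorem MonoBound.lower {S : Finset (Fin m)} {D : ℝ} (hD : 0 ≤ D) {n : ℕ}
    {L : Multiset (Fin 2 × Fin m)} (hLc : L.card = 2 * n + 2) (hL : ∀ c ∈ L, c.2 ∉ S)
    (h : ∀ c : Fin 2 × Fin m, c.2 ∉ S → MonoBound S D (c ::ₘ c ::ₘ L) (n + 1)) :
    MonoBound S D L n := by
  obtain ⟨C, hC⟩ := MonoBound.combination (S := S) (D := D) (n := n + 1) (Finset.univ ×ˢ Sᶜ)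
    (L := fun c => c ::ₘ c ::ₘ L) (fun c hc => h c (by simpa using hc)) 1
  have hK : ∫⁻ α in Set.Ioi (1 : ℝ), ENNReal.ofReal (4 * Real.pi ^ 2 * (α ^ (n + 2))⁻¹) ≠ ⊤ :=
    (integrableOn_inv_pow_Ioi_one n _).lintegral_lt_top.ne
  set K := ∫⁻ α in Set.Ioi (1 : ℝ), ENNReal.ofReal (4 * Real.pi ^ 2 * (α ^ (n + 2))⁻¹) with hKdef
  refine ⟨K.toNNReal * C, fun A s F hF => ?_⟩
  have hpt (v : ℝ) (hv : v ∈ Set.Ioi (0 : ℝ)) :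
      ‖((v ^ n : ℝ) : ℂ) * A.symbolForm (cubeSchwartz F) (A.monoSymbol s L v)‖ₑ ≤
      ∫⁻ α in Set.Ioi (1 : ℝ), ‖((v ^ n : ℝ) : ℂ) *
        A.symbolForm (cubeSchwartz F) (A.stretchSymbol S s L v α)‖ₑ := by
    simp only [enorm_mul]
    rw [lintegral_const_mul' _ _ enorm_ne_top]
    exact mul_le_mul' le_rfl (A.enorm_monoSymbol_le_lintegral _ S s hLc hL hv)
  have hmT : Measurable fun q : ℝ × ℝ => A.symbolForm (cubeSchwartz F)
      (A.stretchSymbol S s L q.1 q.2) :=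
    A.measurable_symbolForm _ (M := fun (q : ℝ × ℝ) ξ => A.stretchSymbol S s L q.1 q.2 ξ)
      (A.measurable_stretchSymbol S s L)
  have hmG : Measurable fun q : ℝ × ℝ => ‖((q.1 ^ n : ℝ) : ℂ) *
      A.symbolForm (cubeSchwartz F) (A.stretchSymbol S s L q.1 q.2)‖ₑ := by
    have h1 : Measurable fun q : ℝ × ℝ => ((q.1 ^ n : ℝ) : ℂ) := by fun_prop
    exact (h1.mul hmT).enorm
  have hin (α : ℝ) (hα : α ∈ Set.Ioi (1 : ℝ)) : ∫⁻ v in Set.Ioi (0 : ℝ), ‖((v ^ n : ℝ) : ℂ) *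
      A.symbolForm (cubeSchwartz F) (A.stretchSymbol S s L v α)‖ₑ ≤
      ENNReal.ofReal (4 * Real.pi ^ 2 * (α ^ (n + 2))⁻¹) * (ENNReal.ofReal A.jac * C) := by
    have hα' : (0 : ℝ) < α := one_pos.trans hα
    have hα1 : 1 ≤ Real.sqrt α := Real.one_le_sqrt.mpr (Set.mem_Ioi.mp hα).le
    set s' := stretchScale S (Real.sqrt α) s
    have hF' : IsConfig S D A s' F := hF.stretch hD hα1
    have h1 := hC A s' F hF' (fun _ => 1)
      (fun ξ => ∑ c ∈ Finset.univ ×ˢ Sᶜ, A.mono s' (c ::ₘ c ::ₘ L) ξ) (fun _ _ => by simp)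
      (fun ξ => by simp)
    have e (v : ℝ) : ‖((v ^ n : ℝ) : ℂ) *
        A.symbolForm (cubeSchwartz F) (A.stretchSymbol S s L v α)‖ₑ =
        ENNReal.ofReal (4 * Real.pi ^ 2 * (α ^ (n + 2))⁻¹) * ‖((v ^ (n + 1) : ℝ) : ℂ) *
          A.symbolForm (cubeSchwartz F) (fun ξ =>
            ((∑ c ∈ Finset.univ ×ˢ Sᶜ, A.mono s' (c ::ₘ c ::ₘ L) ξ) * A.gauss s' v ξ : ℝ))‖ₑ := by
      have e1 : A.stretchSymbol S s L v α = fun ξ => ((4 * Real.pi ^ 2 * (α ^ (n + 2))⁻¹ * v : ℝ)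
          : ℂ) * ((∑ c ∈ Finset.univ ×ˢ Sᶜ, A.mono s' (c ::ₘ c ::ₘ L) ξ) * A.gauss s' v ξ : ℝ) := by
        funext ξ
        rw [A.stretchSymbol_eq S s hLc hL v hα' ξ, Finset.sum_mul, Complex.ofReal_sum]
        rfl
      rw [e1, A.symbolForm_const_mul]
      have e2 : ENNReal.ofReal (4 * Real.pi ^ 2 * (α ^ (n + 2))⁻¹) =
          ‖((4 * Real.pi ^ 2 * (α ^ (n + 2))⁻¹ : ℝ) : ℂ)‖ₑ := by
        rw [← ofReal_norm, Complex.norm_real, Real.norm_of_nonneg (by positivity)]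
      rw [e2, ← enorm_mul]
      congr 1
      push_cast
      ring
    simp only [e]
    rw [lintegral_const_mul' _ _ ENNReal.ofReal_ne_top]
    exact mul_le_mul' le_rfl h1
  calc _ ≤ ∫⁻ v in Set.Ioi (0 : ℝ), ∫⁻ α in Set.Ioi (1 : ℝ), ‖((v ^ n : ℝ) : ℂ) *
        A.symbolForm (cubeSchwartz F) (A.stretchSymbol S s L v α)‖ₑ :=
        setLIntegral_mono' measurableSet_Ioi hpt
    _ = ∫⁻ α in Set.Ioi (1 : ℝ), ∫⁻ v in Set.Ioi (0 : ℝ), ‖((v ^ n : ℝ) : ℂ) *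
        A.symbolForm (cubeSchwartz F) (A.stretchSymbol S s L v α)‖ₑ :=
        lintegral_lintegral_swap hmG.aemeasurable
    _ ≤ ∫⁻ α in Set.Ioi (1 : ℝ), ENNReal.ofReal (4 * Real.pi ^ 2 * (α ^ (n + 2))⁻¹) *
        (ENNReal.ofReal A.jac * C) := setLIntegral_mono' measurableSet_Ioi hin
    _ = _ := by
        rw [lintegral_mul_const' _ _ (by finiteness), ← hKdef, ENNReal.coe_mul,
          ENNReal.coe_toNNReal hK]
        ring

/-- The degree is raised until it exceeds m, where the pigeonhole argument applies; k counts the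
remaining steps. -/
theorem monoBound_of_card {S : Finset (Fin m)} {D : ℝ} (hD : 1 ≤ D)
    (hS : ∀ i ∉ S, SquareBound (insert i S) D) {n : ℕ} {L : Multiset (Fin 2 × Fin m)}
    (hLc : L.card = 2 * n + 2) (hL : ∀ c ∈ L, c.2 ∉ S) : MonoBound S D L n := by
  have key (k : ℕ) : ∀ n, m ≤ n + k → ∀ L : Multiset (Fin 2 × Fin m), L.card = 2 * n + 2 →
      (∀ c ∈ L, c.2 ∉ S) → MonoBound S D L n := by
    induction k with
    | zero =>
      intro n hn L hLc hL
      simpa using monoBound_of_card_lt hD hS (n := n) (by omega) L 0 (by simp)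
        (by simpa using hLc) (by simpa using hL)
    | succ k ih =>
      intro n hn L hLc hL
      refine MonoBound.lower (zero_le_one.trans hD) hLc hL fun c hc => ?_
      refine ih (n + 1) (by omega) _ ?_ ?_
      · rw [Multiset.card_cons, Multiset.card_cons, hLc]
        ring
      · simpa [hc] using hL
  exact key m n (by omega) L hLc hL

/-! ### The square function estimate from the one with more symmetries -/

/-- The part of the energy that does not come with a sign. -/
def Frame.errorEnergy (A : Frame m) (S : Finset (Fin m)) (s : Fin m → ℝ) (ξ : Rm m) : ℝ :=
  (∑ i ∈ S, (A.wave s ξ (0, i) + A.wave s ξ (1, i)) ^ 2) + A.lowEnergy S s ξ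

theorem Frame.errorEnergy_eq (A : Frame m) (S : Finset (Fin m)) (s : Fin m → ℝ) (ξ : Rm m) :
    A.errorEnergy S s ξ =
      A.energy s ξ + 2 * ∑ i ∈ S, A.wave s ξ (0, i) * A.wave s ξ (1, i) := by
  have h1 := A.energy_eq_lowEnergy_add S s ξ
  rw [h1, Frame.errorEnergy, Finset.sum_product, Fin.sum_univ_two, Finset.mul_sum,
    ← Finset.sum_add_distrib, add_assoc, ← Finset.sum_add_distrib, add_comm]
  congr 1
  exact Finset.sum_congr rfl fun i _ => by ring

theorem Frame.abs_errorEnergy_le (A : Frame m) (S : Finset (Fin m)) (s : Fin m → ℝ) (ξ : Rm m) :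
    |A.errorEnergy S s ξ| ≤ 2 * A.energy s ξ := by
  have h1 := A.energy_eq_lowEnergy_add S s ξ
  have h0 := A.lowEnergy_nonneg S s ξ
  rw [Frame.errorEnergy,
    abs_of_nonneg (add_nonneg (Finset.sum_nonneg fun _ _ => sq_nonneg _) h0), h1,
    Finset.sum_product, Fin.sum_univ_two, ← Finset.sum_add_distrib, mul_add, Finset.mul_sum]
  have h2 : ∑ i ∈ S, (A.wave s ξ (0, i) + A.wave s ξ (1, i)) ^ 2 ≤
      ∑ i ∈ S, 2 * (A.wave s ξ (0, i) ^ 2 + A.wave s ξ (1, i) ^ 2) :=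
    Finset.sum_le_sum fun i _ => by nlinarith [sq_nonneg (A.wave s ξ (0, i) - A.wave s ξ (1, i))]
  linarith

/-- The error term of the energy identity is under control. -/
theorem exists_errorEnergy_bound {S : Finset (Fin m)} {D : ℝ} (hD : 1 ≤ D)
    (hS : ∀ i ∉ S, SquareBound (insert i S) D) :
    ∃ C : NNReal, ∀ A s F, IsConfig S D A s F →
      ∫⁻ v in Set.Ioi (0 : ℝ), ‖A.symbolForm (cubeSchwartz F)
        (fun ξ => (A.errorEnergy S s ξ * A.gauss s v ξ : ℝ))‖ₑ ≤ ENNReal.ofReal A.jac * C := by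
  -- The left summand indexes the products from expanding (τ_i^0 + τ_i^1)² with i ∈ S, the right one
  -- the squares in directions outside S.
  let L : (Fin m × Fin m) ⊕ (Fin 2 × Fin m) → Multiset (Fin 2 × Fin m) :=
    Sum.elim (fun q => {(1, q.1), (1, q.2)}) fun c => {c, c}
  obtain ⟨C, hC⟩ := MonoBound.combination (S := S) (D := D) (n := 0) (L := L)
    ((Sᶜ ×ˢ Sᶜ).disjSum (Finset.univ ×ˢ Sᶜ)) (fun k hk => by
      refine monoBound_of_card hD hS ?_ ?_
      · rcases k with k | k <;> simp [L]
      · rcases k with k | k <;> simp_all [L]) (max 1 (m * D ^ 2))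
  refine ⟨C, fun A s F hF => ?_⟩
  -- At the vertex 0 the relation writes the sum of the two frequencies of index i ∈ S through the
  -- frequencies (1, l) with l ∉ S. Its coefficients are at most D, so the summed products are at
  -- most m D².
  choose κ h1 h2 h3 using hF.exists_relation (zero_le_one.trans hD) (fun _ => 0)
  have := hC A s F hF (Sum.elim (fun q => ∑ i ∈ S, κ i q.1 * κ i q.2) fun _ => 1)
    (A.errorEnergy S s) ?_ ?_
  · simpa using this
  · rintro (⟨l, l'⟩ | c) -
    · refine le_trans ?_ (le_max_right _ _)
      refine (Finset.abs_sum_le_sum_abs _ _).trans ?_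
      calc _ ≤ ∑ _i ∈ S, D ^ 2 := Finset.sum_le_sum fun i _ => by
            rw [abs_mul, sq]
            have := h1 i l
            have := h1 i l'
            gcongr
        _ ≤ _ := by
            rw [Finset.sum_const, nsmul_eq_mul]
            gcongr
            simpa using Finset.card_le_univ S
    · simp
  · intro ξ
    have e0 (q : Fin m × Fin m) : A.mono s (L (Sum.inl q)) ξ =
        A.wave s ξ (1, q.1) * A.wave s ξ (1, q.2) := by simp [L, Frame.mono]
    have e1 (c : Fin 2 × Fin m) : A.mono s (L (Sum.inr c)) ξ = A.wave s ξ c ^ 2 := by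
      simp [L, Frame.mono, sq]
    rw [Finset.sum_disjSum]
    simp only [Sum.elim_inl, Sum.elim_inr, e0, e1, one_mul]
    rw [Frame.errorEnergy, Frame.lowEnergy]
    congr 1
    simp only [Finset.sum_mul]
    rw [Finset.sum_comm]
    refine Finset.sum_congr rfl fun i hi => ?_
    have h4 := h3 i ξ
    rw [if_pos hi, ← Finset.sum_subset (Finset.subset_univ Sᶜ)
      fun l _ hl => by rw [h2 i l (by simpa using hl), zero_mul]] at h4
    simp only [opp_apply, sub_zero] at h4
    rw [h4, sq, Finset.sum_mul_sum, Finset.sum_product]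
    exact Finset.sum_congr rfl fun l _ => Finset.sum_congr rfl fun l' _ => by ring

end SquareFunction

end SingularBL

end

noncomputable section

namespace SingularBL

/-! ### The energy identity and the induction on the symmetries -/

section SquareStep

variable {m : ℕ}

theorem Frame.symbolForm_sub (A : Frame m) (Φ : 𝓢(R2m m, ℂ)) {M N : Rm m → ℂ} {C C' : ℝ}
    (hM : Measurable M) (hN : Measurable N) (hMC : ∀ ξ, ‖M ξ‖ ≤ C) (hNC : ∀ ξ, ‖N ξ‖ ≤ C') :
    A.symbolForm Φ (fun ξ => M ξ - N ξ) = A.symbolForm Φ M - A.symbolForm Φ N := by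
  simp only [Frame.symbolForm, mul_sub]
  exact integral_sub (A.integrable_mul_multiplier Φ hM hMC) (A.integrable_mul_multiplier Φ hN hNC)

theorem Frame.symbolForm_heat (A : Frame m) (F : Cube m → 𝓢(Rm m, ℝ)) {s : Fin m → ℝ}
    (hs : ∀ i, 0 < s i) {v : ℝ} (hv : 0 < v) :
    A.symbolForm (cubeSchwartz F) (fun ξ => (A.gauss s v ξ : ℂ)) =
      (A.jac * A.spatialForm (cubeFun fun j => F j) (heatProd ∅ v s) : ℝ) := by
  have h := A.symbolForm_gauss (cubeSchwartz_apply F) ∅ hv hs 0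
  simpa [Frame.chi] using h

theorem Frame.symbolForm_heatForm (A : Frame m) (F : Cube m → 𝓢(Rm m, ℝ)) {s : Fin m → ℝ}
    (hs : ∀ i, 0 < s i) {v : ℝ} (hv : 0 < v) (i : Fin m) :
    A.symbolForm (cubeSchwartz F) (A.monoSymbol s {(0, i), (1, i)} v) =
      (-(4 * Real.pi ^ 2)⁻¹ * A.jac * (s i ^ 2 * A.heatForm s F i v) : ℝ) := by
  have h := A.symbolForm_gauss (cubeSchwartz_apply F) {i} hv hs 0
  have h1 : A.symbolForm (cubeSchwartz F) (fun ξ =>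
      ((-(4 * Real.pi ^ 2) * A.freq ξ (0, i) * A.freq ξ (1, i) * A.gauss s v ξ : ℝ) : ℂ)) =
      (A.jac * A.heatForm s F i v : ℝ) := by
    simpa [Frame.chi, Frame.heatForm] using h
  have h2 : A.monoSymbol s {(0, i), (1, i)} v = fun ξ =>
      ((-(4 * Real.pi ^ 2)⁻¹ * s i ^ 2 : ℝ) : ℂ) *
      ((-(4 * Real.pi ^ 2) * A.freq ξ (0, i) * A.freq ξ (1, i) * A.gauss s v ξ : ℝ) : ℂ) := by
    funext ξ
    rw [Frame.monoSymbol, ← Complex.ofReal_mul]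
    congr 1
    have : Real.pi ≠ 0 := Real.pi_ne_zero
    simp only [Frame.mono, Multiset.insert_eq_cons, Multiset.map_cons, Multiset.map_singleton,
      Multiset.prod_cons, Multiset.prod_singleton, Frame.wave]
    field_simp
  rw [h2, A.symbolForm_const_mul, h1, ← Complex.ofReal_mul]
  congr 1
  ring

theorem integral_mul_exp_Ioc {a b : ℝ} (hab : a ≤ b) (e : ℝ) :
    ∫ v in Set.Ioc a b, 4 * Real.pi ^ 2 * e * Real.exp (-(4 * Real.pi ^ 2 * v * e)) =
      Real.exp (-(4 * Real.pi ^ 2 * a * e)) - Real.exp (-(4 * Real.pi ^ 2 * b * e)) := by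
  have h (v : ℝ) : HasDerivAt (fun v => -Real.exp (-(4 * Real.pi ^ 2 * v * e)))
      (4 * Real.pi ^ 2 * e * Real.exp (-(4 * Real.pi ^ 2 * v * e))) v := by
    have h1 : HasDerivAt (fun v : ℝ => -(4 * Real.pi ^ 2 * v * e)) (-(4 * Real.pi ^ 2 * 1 * e)) v :=
      (((hasDerivAt_id v).const_mul _).mul_const e).neg
    have h2 := h1.exp.neg
    rwa [mul_one, mul_neg, neg_neg, mul_comm (Real.exp _)] at h2
  rw [← intervalIntegral.integral_of_le hab,
    intervalIntegral.integral_eq_sub_of_hasDerivAt (fun v _ => h v)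
      (Continuous.intervalIntegrable (by fun_prop) _ _)]
  ring

theorem Frame.norm_energy_mul_gauss_le (m : ℕ) {a : ℝ} (ha : 0 < a) :
    ∃ C : ℝ, 0 ≤ C ∧ ∀ (A : Frame m) (s : Fin m → ℝ) (v : ℝ), a ≤ v → ∀ ξ,
      A.energy s ξ * A.gauss s v ξ ≤ C := by
  obtain ⟨C, hC0, hC⟩ := Frame.sqrt_energy_pow_mul_gauss_le (m := m) 2 ha
  refine ⟨C, hC0, fun A s v hv ξ => ?_⟩
  have := hC A s v hv ξ
  rwa [Real.sq_sqrt (A.energy_nonneg s ξ)] at this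

theorem Frame.measurable_mul_gauss (A : Frame m) (s : Fin m → ℝ) {p : Rm m → ℝ}
    (hp : Continuous p) :
    Measurable fun q : ℝ × Rm m => ((p q.2 * A.gauss s q.1 q.2 : ℝ) : ℂ) := by
  have h1 : Measurable fun q : ℝ × Rm m => p q.2 := hp.measurable.comp measurable_snd
  exact (h1.mul (A.measurable_gauss s)).complex_ofReal

theorem Frame.continuous_errorEnergy (A : Frame m) (S : Finset (Fin m)) (s : Fin m → ℝ) :
    Continuous (A.errorEnergy S s) :=
  (continuous_finsetSum _ fun i _ =>
    ((A.continuous_wave s (0, i)).add (A.continuous_wave s (1, i))).pow 2).add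
    (A.continuous_lowEnergy S s)

/-- The derivative in time of the heat flow is the energy. -/
theorem Frame.integral_symbolForm_energy (A : Frame m) (Φ : 𝓢(R2m m, ℂ)) (s : Fin m → ℝ) {a b : ℝ}
    (ha : 0 < a) (hab : a ≤ b) :
    ∫ v in Set.Ioc a b, A.symbolForm Φ (fun ξ => (A.energy s ξ * A.gauss s v ξ : ℝ)) =
      ((4 * Real.pi ^ 2)⁻¹ : ℝ) * (A.symbolForm Φ (fun ξ => (A.gauss s a ξ : ℂ)) -
        A.symbolForm Φ fun ξ => (A.gauss s b ξ : ℂ)) := by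
  obtain ⟨C, hC0, hC⟩ := Frame.norm_energy_mul_gauss_le m ha
  have hm := A.measurable_mul_gauss s (A.continuous_energy s)
  have hg : Integrable (fun _ : ℝ => C) (volume.restrict (Set.Ioc a b)) :=
    integrable_const C
  have hb : ∀ᵐ v ∂volume.restrict (Set.Ioc a b), ∀ ξ,
      ‖((A.energy s ξ * A.gauss s v ξ : ℝ) : ℂ)‖ ≤ C := by
    filter_upwards [ae_restrict_mem measurableSet_Ioc] with v hv ξ
    rw [Complex.norm_real, Real.norm_of_nonneg
      (mul_nonneg (A.energy_nonneg s ξ) (A.gauss_pos s v ξ).le)]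
    exact hC A s v hv.1.le ξ
  rw [← A.symbolForm_integral Φ (M := fun v ξ => ((A.energy s ξ * A.gauss s v ξ : ℝ) : ℂ)) hm hg hb]
  have hG (v : ℝ) (hv : 0 < v) (ξ : Rm m) : ‖(A.gauss s v ξ : ℂ)‖ ≤ 1 := by
    rw [Complex.norm_real, Real.norm_of_nonneg (A.gauss_pos s v ξ).le]
    exact A.gauss_le_one s hv.le ξ
  have hGm (v : ℝ) : Measurable fun ξ => (A.gauss s v ξ : ℂ) :=
    (A.continuous_gauss s v).measurable.complex_ofReal
  rw [← A.symbolForm_sub Φ (hGm a) (hGm b) (hG a ha) (hG b (ha.trans_le hab)),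
    ← A.symbolForm_const_mul]
  congr 1
  funext ξ
  rw [integral_complex_ofReal, ← Complex.ofReal_sub, ← Complex.ofReal_mul]
  congr 1
  have h1 := integral_mul_exp_Ioc hab (A.energy s ξ)
  simp only [mul_assoc] at h1
  rw [integral_const_mul, integral_const_mul, ← mul_assoc] at h1
  simp only [Frame.gauss]
  rw [eq_inv_mul_iff_mul_eq₀ (by positivity)]
  simpa only [mul_assoc] using h1

/-- Energy minus error energy is -2 times the sum of the pair products over S. Each pair product is
the multiplier of a heat form up to -1/(4π²), hence the factor 2π². -/
theorem IsConfig.sum_heatForm_eq {S : Finset (Fin m)} {D : ℝ} {A : Frame m} {s : Fin m → ℝ}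
    {F : Cube m → 𝓢(Rm m, ℝ)} (h : IsConfig S D A s F) {v : ℝ} (hv : 0 < v) :
    ((A.jac * ∑ i ∈ S, s i ^ 2 * A.heatForm s F i v : ℝ) : ℂ) = (2 * Real.pi ^ 2 : ℝ) *
      (A.symbolForm (cubeSchwartz F) (fun ξ => (A.energy s ξ * A.gauss s v ξ : ℝ)) -
        A.symbolForm (cubeSchwartz F) (fun ξ => (A.errorEnergy S s ξ * A.gauss s v ξ : ℝ))) := by
  obtain ⟨C, hC0, hC⟩ := Frame.norm_energy_mul_gauss_le m hv
  have hm1 : Measurable fun ξ => ((A.energy s ξ * A.gauss s v ξ : ℝ) : ℂ) :=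
    ((A.continuous_energy s).mul (A.continuous_gauss s v)).measurable.complex_ofReal
  have hm2 : Measurable fun ξ => ((A.errorEnergy S s ξ * A.gauss s v ξ : ℝ) : ℂ) :=
    ((A.continuous_errorEnergy S s).mul (A.continuous_gauss s v)).measurable.complex_ofReal
  have hb1 (ξ : Rm m) : ‖((A.energy s ξ * A.gauss s v ξ : ℝ) : ℂ)‖ ≤ C := by
    rw [Complex.norm_real, Real.norm_of_nonneg
      (mul_nonneg (A.energy_nonneg s ξ) (A.gauss_pos s v ξ).le)]
    exact hC A s v le_rfl ξ
  have hb2 (ξ : Rm m) : ‖((A.errorEnergy S s ξ * A.gauss s v ξ : ℝ) : ℂ)‖ ≤ 2 * C := by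
    rw [Complex.norm_real, norm_mul, Real.norm_of_nonneg (A.gauss_pos s v ξ).le]
    have := A.abs_errorEnergy_le S s ξ
    have := (A.gauss_pos s v ξ).le
    calc _ ≤ 2 * A.energy s ξ * A.gauss s v ξ := by gcongr; assumption
      _ ≤ _ := by rw [mul_assoc]; gcongr; exact hC A s v le_rfl ξ
  rw [← A.symbolForm_sub _ hm1 hm2 hb1 hb2]
  have e : (fun ξ => ((A.energy s ξ * A.gauss s v ξ : ℝ) : ℂ) -
      ((A.errorEnergy S s ξ * A.gauss s v ξ : ℝ) : ℂ)) = fun ξ => ((-2 : ℝ) : ℂ) * ∑ i ∈ S,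
        A.monoSymbol s {(0, i), (1, i)} v ξ := by
    funext ξ
    simp only [Frame.monoSymbol]
    rw [← Complex.ofReal_sub, ← Complex.ofReal_sum, ← Complex.ofReal_mul, A.errorEnergy_eq]
    congr 1
    simp only [Frame.mono, Multiset.insert_eq_cons, Multiset.map_cons, Multiset.map_singleton,
      Multiset.prod_cons, Multiset.prod_singleton]
    rw [← Finset.sum_mul]
    ring
  rw [e, A.symbolForm_const_mul, A.symbolForm_sum]
  · simp only [A.symbolForm_heatForm F h.pos hv]
    rw [← Complex.ofReal_sum, ← Complex.ofReal_mul, ← Complex.ofReal_mul, ← Finset.mul_sum]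
    congr 1
    have : Real.pi ≠ 0 := Real.pi_ne_zero
    field_simp
    ring
  · exact fun i _ => A.measurable_monoSymbol_right s _ v
  · intro i _
    obtain ⟨B, hB0, hB⟩ := Frame.norm_monoSymbol_le (m := m) {(0, i), (1, i)} hv
    exact ⟨B, hB A s v le_rfl⟩

theorem IsConfig.heatForm_nonneg {S : Finset (Fin m)} {D : ℝ} {A : Frame m} {s : Fin m → ℝ}
    {F : Cube m → 𝓢(Rm m, ℝ)} (h : IsConfig S D A s F) {v : ℝ} (hv : 0 < v) {i : Fin m}
    (hi : i ∈ S) : 0 ≤ A.heatForm s F i v :=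
  A.spatialForm_nonneg F i (h.symm_emb i hi) (h.symm_fun i hi) hv h.pos

theorem Frame.integrableOn_symbolForm (A : Frame m) (Φ : 𝓢(R2m m, ℂ)) (s : Fin m → ℝ)
    {p : Rm m → ℝ} (hp : Continuous p) {K : ℝ} (hpK : ∀ ξ, |p ξ| ≤ K * A.energy s ξ) (hK : 0 ≤ K)
    {a b : ℝ} (ha : 0 < a) :
    IntegrableOn (fun v => A.symbolForm Φ (fun ξ => (p ξ * A.gauss s v ξ : ℝ))) (Set.Ioc a b) := by
  obtain ⟨C, hC0, hC⟩ := Frame.norm_energy_mul_gauss_le m ha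
  have hm : Measurable fun v => A.symbolForm Φ (fun ξ => (p ξ * A.gauss s v ξ : ℝ)) :=
    A.measurable_symbolForm Φ (M := fun v ξ => ((p ξ * A.gauss s v ξ : ℝ) : ℂ))
      (A.measurable_mul_gauss s hp)
  refine Measure.integrableOn_of_bounded (M := (∫ ξ, ‖𝓕 Φ (-transposeCLM A.proj ξ)‖) * (K * C))
    (by simp) hm.aestronglyMeasurable ?_
  filter_upwards [ae_restrict_mem measurableSet_Ioc] with v hv
  refine A.norm_symbolForm_le Φ fun ξ => ?_
  rw [Complex.norm_real, norm_mul, Real.norm_of_nonneg (A.gauss_pos s v ξ).le]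
  have := (A.gauss_pos s v ξ).le
  calc _ ≤ K * A.energy s ξ * A.gauss s v ξ := by gcongr; exact hpK ξ
    _ ≤ _ := by rw [mul_assoc]; gcongr; exact hC A s v hv.1.le ξ

/-- The energy integrates to the heat flow at the two end times, each at most `jac` in size; they
contribute 2π² · 2/(4π²) = 1 after division by `jac`. The bound does not depend on a and b. -/
theorem IsConfig.integral_heatForm_le {S : Finset (Fin m)} {D : ℝ} {A : Frame m} {s : Fin m → ℝ}
    {F : Cube m → 𝓢(Rm m, ℝ)} (h : IsConfig S D A s F) {C : NNReal}
    (hC : ∫⁻ v in Set.Ioi (0 : ℝ), ‖A.symbolForm (cubeSchwartz F)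
        (fun ξ => (A.errorEnergy S s ξ * A.gauss s v ξ : ℝ))‖ₑ ≤ ENNReal.ofReal A.jac * C)
    {a b : ℝ} (ha : 0 < a) (hab : a ≤ b) :
    IntegrableOn (fun v => ∑ i ∈ S, s i ^ 2 * A.heatForm s F i v) (Set.Ioc a b) ∧
    ∫ v in Set.Ioc a b, ∑ i ∈ S, s i ^ 2 * A.heatForm s F i v ≤ 1 + 2 * Real.pi ^ 2 * C := by
  set Φ := cubeSchwartz F with hΦ
  have i1 := A.integrableOn_symbolForm Φ s (A.continuous_energy s) (K := 1)
    (fun ξ => by rw [abs_of_nonneg (A.energy_nonneg s ξ), one_mul]) zero_le_one ha (b := b)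
  have i2 := A.integrableOn_symbolForm Φ s (A.continuous_errorEnergy S s)
    (A.abs_errorEnergy_le S s) zero_le_two ha (b := b)
  have hJ := A.jac_pos
  have e : Set.EqOn (fun v => ((A.jac * ∑ i ∈ S, s i ^ 2 * A.heatForm s F i v : ℝ) : ℂ))
      (fun v => ((2 * Real.pi ^ 2 : ℝ) : ℂ) *
      (A.symbolForm Φ (fun ξ => (A.energy s ξ * A.gauss s v ξ : ℝ)) -
        A.symbolForm Φ (fun ξ => (A.errorEnergy S s ξ * A.gauss s v ξ : ℝ)))) (Set.Ioc a b) :=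
    fun v hv => h.sum_heatForm_eq (ha.trans hv.1)
  have i3 : IntegrableOn (fun v => ((A.jac * ∑ i ∈ S, s i ^ 2 * A.heatForm s F i v : ℝ) : ℂ))
      (Set.Ioc a b) :=
    IntegrableOn.congr_fun (Integrable.const_mul (i1.sub i2) _) e.symm measurableSet_Ioc
  have i4 : IntegrableOn (fun v => A.jac * ∑ i ∈ S, s i ^ 2 * A.heatForm s F i v)
      (Set.Ioc a b) := i3.re
  refine ⟨IntegrableOn.congr_fun (Integrable.const_mul i4 A.jac⁻¹)
    (fun v _ => inv_mul_cancel_left₀ hJ.ne' _) measurableSet_Ioc, ?_⟩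
  have h1 := setIntegral_congr_fun (μ := volume) measurableSet_Ioc e
  rw [integral_complex_ofReal, integral_const_mul, integral_const_mul, integral_sub i1 i2,
    A.integral_symbolForm_energy Φ s ha hab] at h1
  have hheat (v : ℝ) (hv : 0 < v) : ‖A.symbolForm Φ fun ξ => (A.gauss s v ξ : ℂ)‖ ≤ A.jac := by
    rw [hΦ, A.symbolForm_heat F h.pos hv, Complex.norm_real, norm_mul, Real.norm_of_nonneg hJ.le]
    exact mul_le_of_le_one_right hJ.le (A.abs_spatialForm_empty_le h.normalized hv h.pos)
  have h2 : ‖∫ v in Set.Ioc a b,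
      A.symbolForm Φ (fun ξ => (A.errorEnergy S s ξ * A.gauss s v ξ : ℝ))‖ ≤ A.jac * C := by
    have h3 : ‖∫ v in Set.Ioc a b,
        A.symbolForm Φ (fun ξ => (A.errorEnergy S s ξ * A.gauss s v ξ : ℝ))‖ₑ ≤
        ENNReal.ofReal (A.jac * C) := by
      refine (enorm_integral_le_lintegral_enorm _).trans ((lintegral_mono_set
        fun v hv => ha.trans hv.1).trans (hC.trans_eq ?_))
      rw [ENNReal.ofReal_mul hJ.le, ENNReal.ofReal_coe_nnreal]
    rw [← ofReal_norm, ENNReal.ofReal_le_ofReal_iff (mul_nonneg hJ.le (NNReal.coe_nonneg C))] at h3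
    exact h3
  have h4 := congrArg norm h1
  rw [Complex.norm_real, norm_mul, Real.norm_of_nonneg hJ.le, norm_mul, Complex.norm_real,
    Real.norm_of_nonneg (show 0 ≤ 2 * Real.pi ^ 2 by positivity)] at h4
  set I := ∫ v in Set.Ioc a b, ∑ i ∈ S, s i ^ 2 * A.heatForm s F i v
  have h5 := norm_sub_le ((((4 * Real.pi ^ 2)⁻¹ : ℝ) : ℂ) *
    (A.symbolForm Φ (fun ξ => (A.gauss s a ξ : ℂ)) - A.symbolForm Φ fun ξ => (A.gauss s b ξ : ℂ)))
    (∫ v in Set.Ioc a b, A.symbolForm Φ (fun ξ => (A.errorEnergy S s ξ * A.gauss s v ξ : ℝ)))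
  rw [norm_mul, Complex.norm_real, Real.norm_of_nonneg (by positivity)] at h5
  have h6 := (norm_sub_le (A.symbolForm Φ (fun ξ => (A.gauss s a ξ : ℂ)))
    (A.symbolForm Φ fun ξ => (A.gauss s b ξ : ℂ))).trans
    (add_le_add (hheat a ha) (hheat b (ha.trans_le hab)))
  have h7 : A.jac * ‖I‖ ≤ A.jac * (1 + 2 * Real.pi ^ 2 * C) := by
    rw [h4]
    calc _ ≤ 2 * Real.pi ^ 2 * ((4 * Real.pi ^ 2)⁻¹ * (A.jac + A.jac) + A.jac * C) := by
          gcongr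
          exact h5.trans (by gcongr)
      _ = _ := by
          have : Real.pi ≠ 0 := Real.pi_ne_zero
          field_simp
          ring
  exact (le_abs_self I).trans (le_of_mul_le_mul_left h7 hJ)

/-- The bound on compact time intervals extends to (0, ∞) by monotone convergence. A single
direction is bounded by the sum over S because all its terms are nonnegative. -/
theorem squareBound_of_insert {S : Finset (Fin m)} {D : ℝ} (hD : 1 ≤ D)
    (hS : ∀ i ∉ S, SquareBound (insert i S) D) : SquareBound S D := by
  obtain ⟨C, hC⟩ := exists_errorEnergy_bound hD hS
  refine ⟨⟨1 + 2 * Real.pi ^ 2 * C, by positivity⟩, fun A s F h i hi => ?_⟩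
  let T (n : ℕ) : Set ℝ := Set.Ioc ((n + 1 : ℝ)⁻¹) (n + 1)
  have hT : Set.Ioi (0 : ℝ) ⊆ ⋃ n, T n := by
    intro v hv
    obtain ⟨n, hn⟩ := exists_nat_gt (max v v⁻¹)
    have hv' : 0 < v := hv
    have h1 : v < n := (le_max_left _ _).trans_lt hn
    have h2 : v⁻¹ < n := (le_max_right _ _).trans_lt hn
    refine Set.mem_iUnion.mpr ⟨n, ?_, by linarith⟩
    exact inv_lt_of_inv_lt₀ hv' (by linarith)
  have hmono : Monotone T := by
    intro n k hnk
    have : (n : ℝ) ≤ k := by exact_mod_cast hnk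
    exact Set.Ioc_subset_Ioc (by gcongr) (by gcongr)
  refine (lintegral_mono_set hT).trans ?_
  rw [setLIntegral_iUnion_of_directed _ hmono.directed_le]
  refine iSup_le fun n => ?_
  have hn : (0 : ℝ) < (n + 1 : ℝ)⁻¹ := by positivity
  have hn1 : ((n + 1 : ℝ)⁻¹) ≤ n + 1 := by
    have : (1 : ℝ) ≤ n + 1 := by linarith [(Nat.cast_nonneg n : (0 : ℝ) ≤ n)]
    exact (inv_le_one_of_one_le₀ this).trans this
  obtain ⟨hint, hle⟩ := h.integral_heatForm_le (hC A s F h) hn hn1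
  have hnn (v : ℝ) (hv : v ∈ T n) (l : Fin m) (hl : l ∈ S) : 0 ≤ s l ^ 2 * A.heatForm s F l v :=
    mul_nonneg (sq_nonneg _) (h.heatForm_nonneg (hn.trans hv.1) hl)
  calc _ ≤ ∫⁻ v in T n, ENNReal.ofReal (∑ i ∈ S, s i ^ 2 * A.heatForm s F i v) :=
        setLIntegral_mono' measurableSet_Ioc fun v hv =>
          ENNReal.ofReal_le_ofReal (Finset.single_le_sum (f := fun l => s l ^ 2 *
            A.heatForm s F l v) (hnn v hv) hi)
    _ = ENNReal.ofReal (∫ v in T n, ∑ i ∈ S, s i ^ 2 * A.heatForm s F i v) := by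
        refine (ofReal_integral_eq_lintegral_ofReal hint ?_).symm
        filter_upwards [ae_restrict_mem measurableSet_Ioc] with v hv
        exact Finset.sum_nonneg (hnn v hv)
    _ ≤ ENNReal.ofReal (1 + 2 * Real.pi ^ 2 * C) := ENNReal.ofReal_le_ofReal hle
    _ = _ := ENNReal.ofReal_eq_coe_nnreal _

/-- The square function estimate. -/
theorem squareBound {D : ℝ} (hD : 1 ≤ D) (S : Finset (Fin m)) : SquareBound S D := by
  -- Induction on the number of directions without symmetry. If there are none, the hypothesis of
  -- the inductive step is vacuous.
  have key (k : ℕ) : ∀ S : Finset (Fin m), Sᶜ.card = k → SquareBound S D := by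
    induction k with
    | zero =>
      intro S hS
      refine squareBound_of_insert hD fun i hi => ?_
      rw [Finset.card_eq_zero] at hS
      exact absurd (Finset.mem_compl.mpr hi) (by simp [hS])
    | succ k ih =>
      intro S hS
      refine squareBound_of_insert hD fun i hi => ih _ ?_
      rw [Finset.compl_insert, Finset.card_erase_of_mem (Finset.mem_compl.mpr hi), hS]
      rfl
  exact key _ S rfl

end SquareStep

end SingularBL

end

noncomputable section

namespace SingularBL

/-! ### Symbols localized to an annulus -/

section Symbol

variable {m : ℕ}

/-- The symbol estimates of Calderón–Zygmund kernels, in terms of the total derivatives. -/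
structure IsSymbol (N : ℕ) (k : Rm m → ℂ) : Prop where
  contDiffOn : ContDiffOn ℝ N k {0}ᶜ
  bound : ∀ n ≤ N, ∀ ξ : Rm m, ξ ≠ 0 → ‖iteratedFDeriv ℝ n k ξ‖ ≤ (m : ℝ) ^ n * (‖ξ‖ ^ n)⁻¹

/-- Expanding each argument in the standard basis gives m^n terms; this passes from partial to total
derivatives. -/
theorem norm_multilinear_le {n : ℕ}
    (T : ContinuousMultilinearMap ℝ (fun _ : Fin n => Rm m) ℂ) {c : ℝ} (hc : 0 ≤ c)
    (h : ∀ β : Fin n → Fin m, ‖T fun t => EuclideanSpace.single (β t) 1‖ ≤ c) :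
    ‖T‖ ≤ (m : ℝ) ^ n * c := by
  refine T.opNorm_le_bound (by positivity) fun v => ?_
  have hv : v = fun t => ∑ i : Fin m, v t i • (EuclideanSpace.single i 1 : Rm m) := by
    funext t
    ext l
    simp [Pi.single_apply]
  have h1 : T v = ∑ β : Fin n → Fin m, (∏ t, v t (β t)) •
      T fun t => EuclideanSpace.single (β t) 1 := by
    conv_lhs => rw [hv]
    rw [T.map_sum]
    exact Finset.sum_congr rfl fun β _ => T.map_smul_univ _ _
  rw [h1]
  calc _ ≤ ∑ _β : Fin n → Fin m, (∏ t, ‖v t‖) * c := by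
        refine norm_sum_le_of_le _ fun β _ => ?_
        rw [norm_smul, norm_prod]
        gcongr with t
        · exact PiLp.norm_apply_le (v t) (β t)
        · exact h β
    _ = _ := by
        simp only [Finset.sum_const, Finset.card_univ, Fintype.card_pi, Fintype.card_fin,
          Finset.prod_const, nsmul_eq_mul]
        push_cast
        ring

/-- Symbol estimates are invariant under dilations, so every scale can be moved to the unit annulus
with the same constants. -/
theorem IsSymbol.comp_smul {N : ℕ} {k : Rm m → ℂ} (hk : IsSymbol N k) {r : ℝ} (hr : 0 < r) :
    IsSymbol N fun ξ => k (r • ξ) := by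
  let g : Rm m ≃L[ℝ] Rm m := ContinuousLinearEquiv.smulLeft (Units.mk0 r hr.ne')
  have hg (ξ : Rm m) : g ξ = r • ξ := rfl
  have hpre : g ⁻¹' {0}ᶜ = {0}ᶜ := by
    ext ξ
    simp
  refine ⟨?_, fun n hn ξ hξ => ?_⟩
  · have h1 := hk.contDiffOn.comp_continuousLinearMap (g : Rm m →L[ℝ] Rm m)
    change ContDiffOn ℝ N _ (g ⁻¹' {0}ᶜ) at h1
    rw [hpre] at h1
    exact h1
  · have hrξ : r • ξ ≠ 0 := smul_ne_zero hr.ne' hξ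
    have h1 := g.iteratedFDerivWithin_comp_right k (s := Set.univ) uniqueDiffOn_univ
      (x := ξ) (Set.mem_univ _) n
    rw [Set.preimage_univ, iteratedFDerivWithin_univ, iteratedFDerivWithin_univ] at h1
    have h2 : iteratedFDeriv ℝ n (fun ξ => k (r • ξ)) ξ = r ^ n • iteratedFDeriv ℝ n k (r • ξ) := by
      refine h1.trans ?_
      ext v
      have h3 := (iteratedFDeriv ℝ n k (r • ξ)).map_smul_univ (fun _ => r) v
      change iteratedFDeriv ℝ n k (r • ξ) (fun i => r • v i) = _
      rw [h3]
      simp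
    rw [h2, norm_smul, Real.norm_of_nonneg (by positivity)]
    calc _ ≤ r ^ n * ((m : ℝ) ^ n * (‖r • ξ‖ ^ n)⁻¹) := by gcongr; exact hk.bound n hn _ hrξ
      _ = _ := by
        rw [norm_smul, Real.norm_of_nonneg hr.le, mul_pow]
        have : 0 < ‖ξ‖ := norm_pos_iff.mpr hξ
        field_simp

/-- The annulus on which symbols are localized. -/
def annulus (m : ℕ) : Set (Rm m) := {ξ | 1 ≤ ‖ξ‖ ∧ ‖ξ‖ ≤ 2}

theorem IsSymbol.contDiff_mul {N : ℕ} {k b : Rm m → ℂ} (hk : IsSymbol N k) (hb : ContDiff ℝ N b)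
    (hbs : tsupport b ⊆ annulus m) : ContDiff ℝ N fun ξ => k ξ * b ξ := by
  rw [contDiff_iff_contDiffAt]
  intro ξ
  by_cases hξ : ξ = 0
  · have h1 : ξ ∉ tsupport b := fun h => by
      have := (hbs h).1
      rw [hξ, norm_zero] at this
      linarith
    have h2 : (fun ξ => k ξ * b ξ) =ᶠ[nhds ξ] fun _ => 0 := by
      filter_upwards [notMem_tsupport_iff_eventuallyEq.mp h1] with x hx
      rw [hx]
      simp
    exact contDiffAt_const.congr_of_eventuallyEq h2
  · exact (hk.contDiffOn.contDiffAt (isOpen_compl_singleton.mem_nhds hξ)).mul hb.contDiffAt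

theorem tsupport_mul_subset_annulus {k b : Rm m → ℂ} (hbs : tsupport b ⊆ annulus m) :
    tsupport (fun ξ => k ξ * b ξ) ⊆ annulus m :=
  (tsupport_mul_subset_right (f := k)).trans hbs

/-- Leibniz rule; on the annulus |ξ| ≥ 1, so the symbol bounds become constants and B depends only
on the localizing function. -/
theorem IsSymbol.exists_bound_mul {N : ℕ} {b : Rm m → ℂ} (hb : ContDiff ℝ N b)
    (hbs : tsupport b ⊆ annulus m) : ∃ B : ℝ, 0 ≤ B ∧ ∀ k : Rm m → ℂ, IsSymbol N k →
      ∀ n ≤ N, ∀ ξ, ‖iteratedFDeriv ℝ n (fun ξ => k ξ * b ξ) ξ‖ ≤ B := by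
  have hcs : HasCompactSupport b := HasCompactSupport.of_support_subset_isCompact
    (isCompact_closedBall (0 : Rm m) 2) ((subset_tsupport b).trans fun ξ h => by
      simpa using (hbs h).2)
  have hB (n : ℕ) : ∃ B : ℝ, n ≤ N → ∀ ξ, ‖iteratedFDeriv ℝ n b ξ‖ ≤ B := by
    by_cases hn : n ≤ N
    · obtain ⟨B, hB⟩ := (hcs.iteratedFDeriv n).exists_bound_of_continuous
        (hb.continuous_iteratedFDeriv (by exact_mod_cast hn))
      exact ⟨B, fun _ => hB⟩
    · exact ⟨0, fun h => absurd h hn⟩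
  choose B hB using hB
  have hB0 (n : ℕ) (hn : n ≤ N) : 0 ≤ B n := (norm_nonneg _).trans (hB n hn 0)
  let T (n : ℕ) : ℝ := ∑ i ∈ Finset.range (n + 1), (n.choose i : ℝ) * (m : ℝ) ^ i * |B (n - i)|
  have hT0 (n : ℕ) : 0 ≤ T n := Finset.sum_nonneg fun i _ => by positivity
  refine ⟨∑ n ∈ Finset.range (N + 1), T n, Finset.sum_nonneg fun n _ => hT0 n,
    fun k hk n hn ξ => ?_⟩
  refine le_trans ?_ (Finset.single_le_sum (fun n _ => hT0 n)
    (Finset.mem_range.mpr (Nat.lt_succ_of_le hn)))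
  by_cases hξ : ξ ∈ annulus m
  · have hξ0 : ξ ≠ 0 := by
      rintro rfl
      have := hξ.1
      rw [norm_zero] at this
      linarith
    have hopen : IsOpen ({0}ᶜ : Set (Rm m)) := isOpen_compl_singleton
    have h1 := norm_iteratedFDerivWithin_mul_le hk.contDiffOn (hb.contDiffOn (s := {0}ᶜ))
      hopen.uniqueDiffOn (x := ξ) hξ0 (n := n) (by exact_mod_cast hn)
    simp only [iteratedFDerivWithin_of_isOpen _ hopen hξ0] at h1
    refine h1.trans (Finset.sum_le_sum fun i hi => ?_)
    have hin : i ≤ n := Nat.lt_succ_iff.mp (Finset.mem_range.mp hi)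
    have h2 := hk.bound i (hin.trans hn) ξ hξ0
    have h3 : (‖ξ‖ ^ i)⁻¹ ≤ 1 := inv_le_one_of_one_le₀ (one_le_pow₀ hξ.1)
    gcongr
    · exact h2.trans (mul_le_of_le_one_right (by positivity) h3)
    · exact (hB _ ((Nat.sub_le _ _).trans hn) ξ).trans (le_abs_self _)
  · have h1 : iteratedFDeriv ℝ n (fun ξ => k ξ * b ξ) ξ = 0 := by
      by_contra h
      exact hξ (tsupport_mul_subset_annulus hbs (support_iteratedFDeriv_subset n h))
    rw [h1, norm_zero]
    exact hT0 n

/-- Smoothness of order N and compact support give decay of order N of the transform, uniformly over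
all symbols. -/
theorem IsSymbol.exists_fourier_decay {N : ℕ} {b : Rm m → ℂ} (hb : ContDiff ℝ N b)
    (hbs : tsupport b ⊆ annulus m) : ∃ B : ℝ, 0 ≤ B ∧ ∀ k : Rm m → ℂ, IsSymbol N k →
      ∀ y, ‖𝓕 (fun ξ => k ξ * b ξ) y‖ ≤ B * (1 + ‖y‖) ^ (-(N : ℝ)) := by
  obtain ⟨B, hB0, hB⟩ := IsSymbol.exists_bound_mul hb hbs
  set V : ℝ := volume.real (Metric.closedBall (0 : Rm m) 2) with hV
  have hV0 : 0 ≤ V := measureReal_nonneg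
  let C (n : ℕ) : ℝ := 2 ^ n * ((n + 1) * (B * V))
  refine ⟨2 ^ (N - 1) * (C 0 + C N), by positivity, fun k hk y => ?_⟩
  set χ : Rm m → ℂ := fun ξ => k ξ * b ξ with hχ
  have hχs : tsupport χ ⊆ Metric.closedBall 0 2 := (tsupport_mul_subset_annulus hbs).trans
    fun ξ h => by simpa using h.2
  have hcs : HasCompactSupport χ := HasCompactSupport.of_support_subset_isCompact
    (isCompact_closedBall (0 : Rm m) 2) ((subset_tsupport χ).trans hχs)
  have hsm : ContDiff ℝ N χ := hk.contDiff_mul hb hbs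
  have hint (n : ℕ) (hn : n ≤ N) : Integrable (fun ξ => ‖iteratedFDeriv ℝ n χ ξ‖) :=
    ((hsm.continuous_iteratedFDeriv (by exact_mod_cast hn)).integrable_of_hasCompactSupport
      (hcs.iteratedFDeriv n)).norm
  have hval (n : ℕ) (hn : n ≤ N) : ∫ ξ, ‖iteratedFDeriv ℝ n χ ξ‖ ≤ B * V := by
    have h1 : Integrable ((Metric.closedBall (0 : Rm m) 2).indicator fun _ => B) :=
      (integrable_indicator_iff measurableSet_closedBall).mpr
        (integrableOn_const (isCompact_closedBall _ _).measure_lt_top.ne)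
    refine (integral_mono (hint n hn) h1 fun ξ => ?_).trans_eq ?_
    · by_cases hξ : ξ ∈ Metric.closedBall (0 : Rm m) 2
      · simp only [Set.indicator_of_mem hξ]
        exact hB k hk n hn ξ
      · have h2 : iteratedFDeriv ℝ n χ ξ = 0 := by
          by_contra h
          exact hξ (hχs (support_iteratedFDeriv_subset n h))
        simp [Set.indicator_of_notMem hξ, h2]
    · rw [integral_indicator_const _ measurableSet_closedBall, smul_eq_mul, mul_comm]
  have hF (n : ℕ) (hn : n ≤ N) : ‖y‖ ^ n * ‖𝓕 χ y‖ ≤ C n := by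
    have h1 := Real.pow_mul_norm_iteratedFDeriv_fourier_le (K := 0) (N := N) (f := χ)
      (by exact_mod_cast hsm) (fun a n ha hn => by
        have ha0 : a = 0 := by simpa using ha
        simpa [ha0] using hint n (by exact_mod_cast hn)) (k := 0) (n := n) le_rfl
        (by exact_mod_cast hn) y
    simp only [norm_iteratedFDeriv_zero, Nat.cast_zero, mul_zero, zero_add, pow_zero, one_mul,
      Finset.range_one, Finset.sum_product, Finset.sum_singleton] at h1
    refine h1.trans ?_
    simp only [C]
    gcongr
    refine (Finset.sum_le_sum fun l hl => hval l ?_).trans_eq ?_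
    · have := Finset.mem_range.mp hl
      omega
    · simp
  have hpos : 0 < (1 + ‖y‖) ^ N := by positivity
  rw [Real.rpow_neg (by positivity), Real.rpow_natCast, ← div_eq_mul_inv, le_div_iff₀ hpos]
  have h1 := add_pow_le zero_le_one (norm_nonneg y) N
  have h2 := hF 0 (Nat.zero_le _)
  have h3 := hF N le_rfl
  rw [pow_zero, one_mul] at h2
  rw [one_pow] at h1
  calc _ ≤ ‖𝓕 χ y‖ * (2 ^ (N - 1) * (1 + ‖y‖ ^ N)) := by gcongr
    _ = 2 ^ (N - 1) * (‖𝓕 χ y‖ + ‖y‖ ^ N * ‖𝓕 χ y‖) := by ring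
    _ ≤ _ := by gcongr

/-- Fourier inversion for a localized symbol. -/
theorem IsSymbol.eq_integral_fourier {N : ℕ} {k b : Rm m → ℂ} (hk : IsSymbol N k)
    (hb : ContDiff ℝ N b) (hbs : tsupport b ⊆ annulus m) (hN : m < N) :
    Continuous (𝓕 fun ξ => k ξ * b ξ) ∧ Integrable (𝓕 fun ξ => k ξ * b ξ) ∧
    ∀ ξ, k ξ * b ξ = ∫ y, 𝓕 (fun ξ => k ξ * b ξ) y *
      Complex.exp ((2 * Real.pi * inner ℝ y ξ : ℝ) * Complex.I) := by
  obtain ⟨B, hB0, hB⟩ := IsSymbol.exists_fourier_decay hb hbs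
  set χ : Rm m → ℂ := fun ξ => k ξ * b ξ with hχ
  have hsm : ContDiff ℝ N χ := hk.contDiff_mul hb hbs
  have hcs : HasCompactSupport χ := HasCompactSupport.of_support_subset_isCompact
    (isCompact_closedBall (0 : Rm m) 2) ((subset_tsupport χ).trans
      ((tsupport_mul_subset_annulus hbs).trans fun ξ h => by simpa using h.2))
  have hi : Integrable χ := hsm.continuous.integrable_of_hasCompactSupport hcs
  have hc : Continuous (𝓕 χ) := VectorFourier.fourierIntegral_continuous Real.continuous_fourierChar
    (by exact continuous_inner) hi
  have hi' : Integrable (𝓕 χ) := by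
    refine ((integrable_one_add_norm (E := Rm m) (r := N) (by simpa using hN)).const_mul B).mono'
      hc.aestronglyMeasurable (Filter.Eventually.of_forall (hB k hk))
  refine ⟨hc, hi', fun ξ => ?_⟩
  have h1 := congrFun (hsm.continuous.fourierInv_fourier_eq hi hi') ξ
  rw [Real.fourierInv_eq'] at h1
  change χ ξ = _
  rw [← h1]
  refine integral_congr_ae (Filter.Eventually.of_forall fun y => ?_)
  simp only [smul_eq_mul]
  rw [mul_comm]

end Symbol

end SingularBL

end

noncomputable section

namespace SingularBL

section Calderon

variable {m : ℕ}

/-! ### The frequencies have no common zero on the cube -/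

theorem Frame.freq_smul (A : Frame m) (r : ℝ) (ξ : Rm m) (c : Fin 2 × Fin m) :
    A.freq (r • ξ) c = r * A.freq ξ c := by
  rw [Frame.freq, map_smul]
  rfl

theorem Frame.contDiff_freq (A : Frame m) {n : WithTop ℕ∞} (c : Fin 2 × Fin m) :
    ContDiff ℝ n fun ξ => A.freq ξ c :=
  ((EuclideanSpace.proj (𝕜 := ℝ) c).comp (transposeCLM A.proj)).contDiff

/-- Orthogonality to the kernel, tested at the opposite vertex, makes the other m frequencies vanish
as well. Then Π^T ξ = 0, and Π^T is injective. -/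
theorem Frame.eq_zero_of_freq (A : Frame m) (a : Cube m) {ξ : Rm m}
    (h : ∀ i, A.freq ξ (a i, i) = 0) : ξ = 0 := by
  have h1 (i : Fin m) : A.freq ξ (opp a i, i) = 0 := by
    obtain ⟨q, hq⟩ := (A.bij (opp a)).2 (EuclideanSpace.single i 1)
    have hq' (l : Fin m) : A.emb q (opp a l, l) = if l = i then 1 else 0 := by
      have := congrArg (fun y : Rm m => y l) hq
      simpa [Pi.single_apply] using this
    have h2 := A.sum_freq_mul_emb ξ q
    have h3 : ∑ c, A.freq ξ c * A.emb q c = ∑ l, (A.freq ξ (a l, l) * A.emb q (a l, l) +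
        A.freq ξ (opp a l, l) * A.emb q (opp a l, l)) := by
      rw [Fintype.sum_prod_type_right]
      refine Finset.sum_congr rfl fun l _ => ?_
      rw [Fin.sum_univ_two]
      rcases fin_two_eq_or (a l) 0 with h3 | h3 <;> simp [h3, add_comm]
    rw [h3] at h2
    simpa only [h, hq', zero_mul, zero_add, mul_ite, mul_one, mul_zero, Finset.sum_ite_eq',
      Finset.mem_univ, if_true] using h2
  have h2 : transposeCLM A.proj ξ = 0 := by
    ext ⟨b, i⟩
    rcases fin_two_eq_or b (a i) with rfl | rfl
    · exact h i
    · exact h1 i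
  obtain ⟨x, rfl⟩ := A.surj ξ
  have h3 := inner_transposeCLM A.proj x (A.proj x)
  rw [h2, inner_zero_right] at h3
  exact inner_self_eq_zero.mp h3.symm

/-- The multiplier `-4π² τ_i^0 τ_i^1`. -/
def Frame.pairPoly (A : Frame m) (i : Fin m) (ξ : Rm m) : ℝ :=
  -(4 * Real.pi ^ 2) * A.freq ξ (0, i) * A.freq ξ (1, i)

theorem Frame.contDiff_pairPoly (A : Frame m) {n : WithTop ℕ∞} (i : Fin m) :
    ContDiff ℝ n (A.pairPoly i) :=
  (contDiff_const.mul (A.contDiff_freq _)).mul (A.contDiff_freq _)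

/-- If all products vanish, choosing a vanishing factor for each index gives a vertex of the cube
where all frequencies vanish. -/
theorem Frame.sum_pairPoly_sq_pos (A : Frame m) {ξ : Rm m} (hξ : ξ ≠ 0) :
    0 < ∑ i, A.pairPoly i ξ ^ 2 := by
  refine lt_of_le_of_ne (Finset.sum_nonneg fun i _ => sq_nonneg _) fun h => hξ ?_
  have h1 (i : Fin m) : ∃ a : Fin 2, A.freq ξ (a, i) = 0 := by
    have h2 := (Finset.sum_eq_zero_iff_of_nonneg fun i _ => sq_nonneg (A.pairPoly i ξ)).mp
      h.symm i (Finset.mem_univ i)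
    have hpi : (-(4 * Real.pi ^ 2)) ≠ 0 := by
      have := Real.pi_pos
      have : 0 < 4 * Real.pi ^ 2 := by positivity
      linarith
    rw [sq_eq_zero_iff, Frame.pairPoly, mul_eq_zero, mul_eq_zero] at h2
    rcases h2 with (h2 | h2) | h2
    · exact absurd h2 hpi
    · exact ⟨0, h2⟩
    · exact ⟨1, h2⟩
  choose a ha using h1
  exact A.eq_zero_of_freq a ha

/-! ### The localization -/

/-- A smooth bump function supported in `[1, 3]`. -/
def bump : ContDiffBump (2 : ℝ) := ⟨1 / 2, 1, by norm_num, by norm_num⟩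

theorem bump_eq_zero {r : ℝ} (h : r ≤ 1 ∨ 3 ≤ r) : bump r = 0 := by
  refine bump.zero_of_le_dist ?_
  change 1 ≤ dist r 2
  rw [Real.dist_eq]
  rcases h with h | h
  · rw [abs_of_nonpos (by linarith)]
    linarith
  · rw [abs_of_nonneg (by linarith)]
    linarith

/-- The localized coefficient functions. -/
def Frame.coeff (A : Frame m) (i : Fin m) (ξ : Rm m) : ℂ :=
  (bump (‖ξ‖ ^ 2) * (A.pairPoly i ξ / ∑ l, A.pairPoly l ξ ^ 2) *
    Real.exp (4 * Real.pi ^ 2 * A.energy (fun _ => 1) ξ) : ℝ)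

theorem Frame.tsupport_coeff (A : Frame m) (i : Fin m) : tsupport (A.coeff i) ⊆ annulus m := by
  refine closure_minimal (fun ξ hξ => ?_) ?_
  · by_contra h
    refine hξ ?_
    have h1 : ‖ξ‖ ^ 2 ≤ 1 ∨ 3 ≤ ‖ξ‖ ^ 2 := by
      have h0 := norm_nonneg ξ
      by_cases h2 : 1 ≤ ‖ξ‖
      · right
        have h3 : ¬ ‖ξ‖ ≤ 2 := fun h4 => h ⟨h2, h4⟩
        nlinarith
      · left
        nlinarith
    simp [Frame.coeff, bump_eq_zero h1]
  · exact (isClosed_le continuous_const continuous_norm).inter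
      (isClosed_le continuous_norm continuous_const)

theorem Frame.contDiff_coeff (A : Frame m) (i : Fin m) (N : ℕ) : ContDiff ℝ N (A.coeff i) := by
  rw [contDiff_iff_contDiffAt]
  intro ξ
  by_cases hξ : ξ = 0
  · have h1 : ξ ∉ tsupport (A.coeff i) := fun h => by
      have := (A.tsupport_coeff i h).1
      rw [hξ, norm_zero] at this
      linarith
    exact contDiffAt_const.congr_of_eventuallyEq (notMem_tsupport_iff_eventuallyEq.mp h1)
  · have h1 : ContDiffAt ℝ N (fun ξ : Rm m => bump (‖ξ‖ ^ 2)) ξ :=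
      bump.contDiffAt.comp ξ (contDiff_norm_sq ℝ).contDiffAt
    have h2 : ContDiffAt ℝ N (fun ξ => A.pairPoly i ξ / ∑ l, A.pairPoly l ξ ^ 2) ξ :=
      (A.contDiff_pairPoly i).contDiffAt.div
        (ContDiff.sum fun l _ => (A.contDiff_pairPoly l).pow 2).contDiffAt
        (A.sum_pairPoly_sq_pos hξ).ne'
    have h3 : ContDiff ℝ N (fun ξ => 4 * Real.pi ^ 2 * A.energy (fun _ => 1) ξ) := by
      refine contDiff_const.mul (ContDiff.sum fun c _ => ContDiff.pow ?_ 2)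
      exact contDiff_const.mul (A.contDiff_freq c)
    exact Complex.ofRealCLM.contDiff.contDiffAt.comp ξ ((h1.mul h2).mul h3.exp.contDiffAt)

/-- The coefficients carry P_i / ∑ P_l², which resolves the identity away from the origin, and an
exponential that cancels the Gaussian. -/
theorem Frame.sum_coeff_mul (A : Frame m) (ξ : Rm m) :
    ∑ i, A.coeff i ξ * (A.pairPoly i ξ * A.gauss (fun _ => 1) 1 ξ : ℝ) =
      (bump (‖ξ‖ ^ 2) : ℝ) := by
  simp only [Frame.coeff]
  simp only [← Complex.ofReal_mul]
  rw [← Complex.ofReal_sum]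
  congr 1
  by_cases hξ : ξ = 0
  · subst hξ
    simp [bump_eq_zero]
  · have hpos := A.sum_pairPoly_sq_pos hξ
    have h1 : Real.exp (4 * Real.pi ^ 2 * A.energy (fun _ => 1) ξ) *
        A.gauss (fun _ => 1) 1 ξ = 1 := by
      rw [Frame.gauss, ← Real.exp_add]
      simp
    have h2 (i : Fin m) : bump (‖ξ‖ ^ 2) * (A.pairPoly i ξ / ∑ l, A.pairPoly l ξ ^ 2) *
        Real.exp (4 * Real.pi ^ 2 * A.energy (fun _ => 1) ξ) *
          (A.pairPoly i ξ * A.gauss (fun _ => 1) 1 ξ) =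
        bump (‖ξ‖ ^ 2) / (∑ l, A.pairPoly l ξ ^ 2) * A.pairPoly i ξ ^ 2 := by
      calc _ = bump (‖ξ‖ ^ 2) * (A.pairPoly i ξ / ∑ l, A.pairPoly l ξ ^ 2) * A.pairPoly i ξ *
            (Real.exp (4 * Real.pi ^ 2 * A.energy (fun _ => 1) ξ) *
              A.gauss (fun _ => 1) 1 ξ) := by ring
        _ = _ := by rw [h1]; ring
    simp only [h2]
    rw [← Finset.mul_sum, div_mul_cancel₀ _ hpos.ne']

/-- The piece of a symbol at the frequency scale `1 / √v`. -/
def scalePiece (k : Rm m → ℂ) (v : ℝ) (ξ : Rm m) : ℂ := k ξ * ((bump (v * ‖ξ‖ ^ 2) / v : ℝ) : ℂ)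

/-- The symbol at scale `1 / √v`, normalized and localized. -/
def Frame.localSymbol (A : Frame m) (i : Fin m) (k : Rm m → ℂ) (v : ℝ) (ξ : Rm m) : ℂ :=
  k ((Real.sqrt v)⁻¹ • ξ) * A.coeff i ξ

/-- The identity for the bump function, rescaled by √v. The products have degree two and contribute
a factor v, which explains the division by v in `scalePiece`. -/
theorem Frame.scalePiece_eq (A : Frame m) (k : Rm m → ℂ) {v : ℝ} (hv : 0 < v) (ξ : Rm m) :
    scalePiece k v ξ = ∑ i, A.localSymbol i k v (Real.sqrt v • ξ) *
      (A.pairPoly i ξ * A.gauss (fun _ => 1) v ξ : ℝ) := by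
  have hsv : 0 < Real.sqrt v := Real.sqrt_pos.mpr hv
  have hsq : Real.sqrt v ^ 2 = v := Real.sq_sqrt hv.le
  have h1 := A.sum_coeff_mul (Real.sqrt v • ξ)
  have h2 : A.gauss (fun _ => 1) 1 (Real.sqrt v • ξ) = A.gauss (fun _ => 1) v ξ := by
    simp only [Frame.gauss, Frame.energy, A.freq_smul, one_mul, mul_one, mul_pow, hsq]
    rw [← Finset.mul_sum, ← mul_assoc]
  have h3 (i : Fin m) : A.pairPoly i (Real.sqrt v • ξ) = v * A.pairPoly i ξ := by
    simp only [Frame.pairPoly, A.freq_smul]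
    calc _ = Real.sqrt v ^ 2 * (-(4 * Real.pi ^ 2) * A.freq ξ (0, i) * A.freq ξ (1, i)) := by ring
      _ = _ := by rw [hsq]
  have h4 : ‖Real.sqrt v • ξ‖ ^ 2 = v * ‖ξ‖ ^ 2 := by
    rw [norm_smul, Real.norm_of_nonneg hsv.le, mul_pow, hsq]
  rw [h2, h4] at h1
  simp only [h3] at h1
  rw [scalePiece]
  simp only [Frame.localSymbol, smul_smul, inv_mul_cancel₀ hsv.ne', one_smul]
  rw [Complex.ofReal_div, ← h1, Finset.sum_div, Finset.mul_sum]
  refine Finset.sum_congr rfl fun i _ => ?_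
  have : (v : ℂ) ≠ 0 := by exact_mod_cast hv.ne'
  push_cast
  field_simp

/-- Since σ is a right inverse of Π, ⟨y, ξ⟩ = ⟨σ y, Π^T ξ⟩. A character in the Fourier expansion of
the coefficient is thus the modulation of a `pairSymbol` with shift -σ y. -/
theorem Frame.localSymbol_mul_eq (A : Frame m) {N : ℕ} (hN : m < N) {σ : Rm m →ₗ[ℝ] R2m m}
    (hσ : ∀ y, A.proj (σ y) = y) (i : Fin m) {k : Rm m → ℂ} (hk : IsSymbol N k) {v : ℝ}
    (hv : 0 < v) (ξ : Rm m) :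
    A.localSymbol i k v (Real.sqrt v • ξ) * (A.pairPoly i ξ * A.gauss (fun _ => 1) v ξ : ℝ) =
      ∫ y, 𝓕 (A.localSymbol i k v) y * A.pairSymbol i (fun _ => 1) (-σ y) v ξ := by
  have hsv : 0 < Real.sqrt v := Real.sqrt_pos.mpr hv
  have h1 := ((hk.comp_smul (inv_pos.mpr hsv)).eq_integral_fourier (A.contDiff_coeff i N)
    (A.tsupport_coeff i) hN).2.2 (Real.sqrt v • ξ)
  change A.localSymbol i k v (Real.sqrt v • ξ) =
    ∫ y, 𝓕 (A.localSymbol i k v) y * _ at h1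
  rw [h1, ← integral_mul_const]
  refine integral_congr_ae (Filter.Eventually.of_forall fun y => ?_)
  have h2 : A.chi (WithLp.toLp 2 fun c => Real.sqrt v * 1 * (-σ y) c) ξ =
      Complex.exp ((2 * Real.pi * inner ℝ y (Real.sqrt v • ξ) : ℝ) * Complex.I) := by
    have h3 : inner ℝ y (Real.sqrt v • ξ) = -∑ c, Real.sqrt v * 1 * (-σ y) c * A.freq ξ c := by
      rw [inner_smul_right, ← hσ y, ← inner_transposeCLM, hσ y, PiLp.inner_apply, Finset.mul_sum,
        ← Finset.sum_neg_distrib]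
      refine Finset.sum_congr rfl fun c _ => ?_
      simp only [Frame.freq, RCLike.inner_apply, conj_trivial, PiLp.neg_apply]
      ring
    rw [Frame.chi, h3]
    congr 1
    push_cast
    ring
  simp only [Frame.pairSymbol, h2, Frame.pairPoly]
  ring

theorem Frame.enorm_scalePiece_le (A : Frame m) {N : ℕ} (hN : m < N) {σ : Rm m →ₗ[ℝ] R2m m}
    (hσ : ∀ y, A.proj (σ y) = y) (Φ : 𝓢(R2m m, ℂ)) {k : Rm m → ℂ} (hk : IsSymbol N k) {v : ℝ}
    (hv : 0 < v) : ‖A.symbolForm Φ (scalePiece k v)‖ₑ ≤ ∑ i, ∫⁻ y, ‖𝓕 (A.localSymbol i k v) y‖ₑ *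
      ‖A.symbolForm Φ (A.pairSymbol i (fun _ => 1) (-σ y) v)‖ₑ := by
  have hsv : 0 < Real.sqrt v := Real.sqrt_pos.mpr hv
  have hinv (i : Fin m) := (hk.comp_smul (inv_pos.mpr hsv)).eq_integral_fourier
    (A.contDiff_coeff i N) (A.tsupport_coeff i) hN
  have hcont (i : Fin m) : Continuous (𝓕 (A.localSymbol i k v)) := (hinv i).1
  have hint (i : Fin m) : Integrable (𝓕 (A.localSymbol i k v)) := (hinv i).2.1
  have hσc : Continuous fun y => -σ y := σ.continuous_of_finiteDimensional.neg
  have hm (i : Fin m) : Measurable fun q : Rm m × Rm m =>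
      𝓕 (A.localSymbol i k v) q.1 * A.pairSymbol i (fun _ => 1) (-σ q.1) v q.2 := by
    have h0 : Measurable fun q : Rm m × Rm m => ((v, -σ q.1), q.2) :=
      (measurable_const.prodMk (hσc.measurable.comp measurable_fst)).prodMk measurable_snd
    have h1 := (A.measurable_pairSymbol i fun _ => 1).comp h0
    have h2 : Measurable fun q : Rm m × Rm m => 𝓕 (A.localSymbol i k v) q.1 :=
      (hcont i).measurable.comp measurable_fst
    exact h2.mul h1
  have hB (i : Fin m) : ∃ B : ℝ, 0 ≤ B ∧ ∀ y ξ, ‖A.pairSymbol i (fun _ => 1) (-σ y) v ξ‖ ≤ B := by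
    obtain ⟨B, hB0, hB⟩ := Frame.norm_monoSymbol_le (m := m) {(0, i), (1, i)} hv
    refine ⟨4 * Real.pi ^ 2 * B, by positivity, fun y ξ => ?_⟩
    have h1 := A.norm_pairSymbol i (fun _ => 1) (-σ y) v ξ
    rw [one_pow, one_mul] at h1
    rw [h1]
    gcongr
    exact hB A _ v le_rfl ξ
  choose B hB0 hB using hB
  have hb (i : Fin m) (y ξ : Rm m) : ‖𝓕 (A.localSymbol i k v) y *
      A.pairSymbol i (fun _ => 1) (-σ y) v ξ‖ ≤ ‖𝓕 (A.localSymbol i k v) y‖ * B i := by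
    rw [norm_mul]
    gcongr
    exact hB i y ξ
  have hM (i : Fin m) : (fun ξ => A.localSymbol i k v (Real.sqrt v • ξ) *
      (A.pairPoly i ξ * A.gauss (fun _ => 1) v ξ : ℝ)) = fun ξ => ∫ y, 𝓕 (A.localSymbol i k v) y *
        A.pairSymbol i (fun _ => 1) (-σ y) v ξ :=
    funext fun ξ => A.localSymbol_mul_eq hN hσ i hk hv ξ
  have e : scalePiece k v = fun ξ => ∑ i, ∫ y, 𝓕 (A.localSymbol i k v) y *
        A.pairSymbol i (fun _ => 1) (-σ y) v ξ := by
    funext ξ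
    rw [A.scalePiece_eq k hv ξ]
    exact Finset.sum_congr rfl fun i _ => congrFun (hM i) ξ
  have hmi (i : Fin m) : Measurable fun ξ => ∫ y, 𝓕 (A.localSymbol i k v) y *
      A.pairSymbol i (fun _ => 1) (-σ y) v ξ :=
    ((hm i).comp measurable_swap).stronglyMeasurable.integral_prod_right'.measurable
  have hbi (i : Fin m) (ξ : Rm m) : ‖∫ y, 𝓕 (A.localSymbol i k v) y *
      A.pairSymbol i (fun _ => 1) (-σ y) v ξ‖ ≤ ∫ y, ‖𝓕 (A.localSymbol i k v) y‖ * B i :=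
    norm_integral_le_of_norm_le ((hint i).norm.mul_const _)
      (Filter.Eventually.of_forall fun y => hb i y ξ)
  rw [e, A.symbolForm_sum Finset.univ Φ (fun i _ => hmi i) fun i _ => ⟨_, hbi i⟩]
  refine (enorm_sum_le _ _).trans (Finset.sum_le_sum fun i _ => ?_)
  refine (A.enorm_symbolForm_integral_le Φ
    (M := fun y ξ => 𝓕 (A.localSymbol i k v) y * A.pairSymbol i (fun _ => 1) (-σ y) v ξ)
    (hm i) ((hint i).norm.mul_const (B i)) (Filter.Eventually.of_forall (hb i))).trans_eq ?_
  refine lintegral_congr fun y => ?_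
  rw [A.symbolForm_const_mul, enorm_mul]

end Calderon

end SingularBL

end

noncomputable section

namespace SingularBL

/-! ### Assembling the pieces of a symbol over all scales -/

section RealBound

variable {m : ℕ}

/-- With all scales equal to 1, D only has to bound the entries of finitely many changes of
coordinates. -/
theorem Frame.exists_isConfig (A : Frame m) : ∃ D : ℝ, 1 ≤ D ∧ ∀ F : Cube m → 𝓢(Rm m, ℝ),
    A.Normalized F → IsConfig ∅ D A (fun _ => 1) F := by
  choose q hq using fun (j : Cube m) (i : Fin m) => (A.bij j).2 (EuclideanSpace.single i 1)
  have h0 (j : Cube m) (i : Fin m) : 0 ≤ ∑ c, |A.emb (q j i) c| :=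
    Finset.sum_nonneg fun _ _ => abs_nonneg _
  have h1 (j : Cube m) : 0 ≤ ∑ i, ∑ c, |A.emb (q j i) c| := Finset.sum_nonneg fun i _ => h0 j i
  have h2 : 0 ≤ ∑ j, ∑ i, ∑ c, |A.emb (q j i) c| := Finset.sum_nonneg fun j _ => h1 j
  refine ⟨1 + ∑ j, ∑ i, ∑ c, |A.emb (q j i) c|, by linarith, fun F hF =>
    ⟨fun _ => one_pos, fun j i p hp c => ?_, by simp, by simp, hF⟩⟩
  have hpq : p = q j i := (A.bij j).1 (hp.trans (hq j i).symm)
  have h3 : |A.emb (q j i) c| ≤ ∑ c, |A.emb (q j i) c| :=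
    Finset.single_le_sum (f := fun c => |A.emb (q j i) c|) (fun _ _ => abs_nonneg _)
      (Finset.mem_univ c)
  have h4 := Finset.single_le_sum (f := fun i => ∑ c, |A.emb (q j i) c|) (fun i _ => h0 j i)
    (Finset.mem_univ i)
  have h5 := Finset.single_le_sum (f := fun j => ∑ i, ∑ c, |A.emb (q j i) c|) (fun j _ => h1 j)
    (Finset.mem_univ j)
  simp only at h4 h5
  rw [hpq, mul_one, mul_one]
  linarith

/-- The normalizing constant in the resolution of a symbol into pieces. -/
def bumpConst : ℝ := ∫ r in Set.Ioi (0 : ℝ), bump r / r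

theorem bump_div_nonneg {r : ℝ} (hr : 0 < r) : 0 ≤ bump r / r := div_nonneg bump.nonneg hr.le

theorem continuous_bump : Continuous (bump : ℝ → ℝ) := bump.continuous

theorem integrableOn_bump_div : IntegrableOn (fun r : ℝ => bump r / r) (Set.Ioi 0) := by
  have h1 : Integrable (bump : ℝ → ℝ) :=
    continuous_bump.integrable_of_hasCompactSupport bump.hasCompactSupport
  refine Integrable.mono' (h1.integrableOn (s := Set.Ioi 0))
    (continuous_bump.measurable.div measurable_id).aestronglyMeasurable ?_
  filter_upwards [ae_restrict_mem measurableSet_Ioi] with r hr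
  have hr' : 0 < r := hr
  rw [Real.norm_of_nonneg (bump_div_nonneg hr')]
  by_cases h : r ≤ 1
  · simp [bump_eq_zero (Or.inl h)]
  · exact div_le_self bump.nonneg (not_le.mp h).le

theorem bumpConst_pos : 0 < bumpConst := by
  rw [bumpConst, setIntegral_pos_iff_support_of_nonneg_ae _ integrableOn_bump_div]
  · refine lt_of_lt_of_le ?_ (measure_mono (s := Set.Ioo (3 / 2 : ℝ) (5 / 2)) fun r hr => ?_)
    · rw [Real.volume_Ioo]
      norm_num
    · have h1 : bump r = 1 := bump.one_of_mem_closedBall (by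
        change dist r 2 ≤ 1 / 2
        rw [Real.dist_eq, abs_le]
        constructor <;> linarith [hr.1, hr.2])
      have hr0 : 0 < r := by linarith [hr.1]
      refine ⟨?_, hr0⟩
      rw [Function.mem_support, h1]
      positivity
  · filter_upwards [ae_restrict_mem measurableSet_Ioi] with r hr
    exact bump_div_nonneg hr

/-- Dilation invariance of dv/v: the pieces at all scales add up to the same constant for every ξ ≠
0. -/
theorem integral_bump_scale {b : ℝ} (hb : 0 < b) :
    IntegrableOn (fun v : ℝ => bump (v * b) / v) (Set.Ioi 0) ∧
      ∫ v in Set.Ioi (0 : ℝ), bump (v * b) / v = bumpConst := by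
  have e : (fun v : ℝ => bump (v * b) / v) = fun v => b * (bump (v * b) / (v * b)) := by
    funext v
    field_simp
  rw [e]
  constructor
  · have h1 := (integrableOn_Ioi_comp_mul_right_iff (fun r : ℝ => bump r / r) 0 hb).mpr
      (by rw [zero_mul]; exact integrableOn_bump_div)
    exact Integrable.const_mul h1 b
  · rw [integral_const_mul, integral_comp_mul_right_Ioi (fun r : ℝ => bump r / r) 0 hb, zero_mul,
      smul_eq_mul, mul_inv_cancel_left₀ hb.ne', bumpConst]

theorem IsSymbol.norm_le_one {N : ℕ} {k : Rm m → ℂ} (hk : IsSymbol N k) {ξ : Rm m} (hξ : ξ ≠ 0) :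
    ‖k ξ‖ ≤ 1 := by
  simpa using hk.bound 0 (Nat.zero_le _) ξ hξ

theorem ae_ne_zero (hm : 1 ≤ m) : ∀ᵐ ξ : Rm m, ξ ≠ 0 := by
  have : Nonempty (Fin m) := ⟨⟨0, hm⟩⟩
  have : Nontrivial (Rm m) := inferInstance
  exact compl_mem_ae_iff.mpr (measure_singleton 0)

/-- A symbol is dominated by its pieces at all scales. -/
theorem Frame.enorm_symbolForm_le_scalePiece (A : Frame m) (hm : 1 ≤ m) (Φ : 𝓢(R2m m, ℂ)) {N : ℕ}
    {k : Rm m → ℂ} (hkm : Measurable k) (hk : IsSymbol N k) :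
    ENNReal.ofReal bumpConst * ‖A.symbolForm Φ k‖ₑ ≤
      ∫⁻ v in Set.Ioi (0 : ℝ), ‖A.symbolForm Φ (scalePiece k v)‖ₑ := by
  have hW := A.integrable_fourier_transpose Φ
  have hbm : Measurable fun q : Rm m × ℝ => bump (q.2 * ‖q.1‖ ^ 2) / q.2 := by
    have h1 := continuous_bump.measurable
    have h2 : Measurable fun q : Rm m × ℝ => q.2 * ‖q.1‖ ^ 2 := by fun_prop
    exact (h1.comp h2).div measurable_snd
  have hmeas : Measurable fun q : Rm m × ℝ =>
      𝓕 Φ (-transposeCLM A.proj q.1) * scalePiece k q.2 q.1 := by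
    have h1 := (A.continuous_fourier_transpose Φ).measurable
    have h2 : Measurable fun q : Rm m × ℝ => scalePiece k q.2 q.1 :=
      (hkm.comp measurable_fst).mul hbm.complex_ofReal
    exact (h1.comp measurable_fst).mul h2
  have hval {ξ : Rm m} (hξ : ξ ≠ 0) : IntegrableOn (fun v => scalePiece k v ξ) (Set.Ioi 0) ∧
      ∫ v in Set.Ioi (0 : ℝ), scalePiece k v ξ = bumpConst * k ξ := by
    have h1 := integral_bump_scale (b := ‖ξ‖ ^ 2) (by have := norm_pos_iff.mpr hξ; positivity)
    constructor
    · exact Integrable.const_mul h1.1.ofReal (k ξ)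
    · simp only [scalePiece]
      rw [integral_const_mul, integral_complex_ofReal, h1.2, mul_comm]
  have hint : Integrable (Function.uncurry fun ξ v =>
      𝓕 Φ (-transposeCLM A.proj ξ) * scalePiece k v ξ)
      (volume.prod (volume.restrict (Set.Ioi (0 : ℝ)))) := by
    refine (integrable_prod_iff hmeas.aestronglyMeasurable).mpr ⟨?_, ?_⟩
    · filter_upwards [ae_ne_zero hm] with ξ hξ
      exact Integrable.const_mul (hval hξ).1 _
    · refine (hW.norm.mul_const bumpConst).mono'
        (hmeas.norm.stronglyMeasurable.integral_prod_right').aestronglyMeasurable ?_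
      filter_upwards [ae_ne_zero hm] with ξ hξ
      have h1 := (integral_bump_scale (b := ‖ξ‖ ^ 2)
        (by have := norm_pos_iff.mpr hξ; positivity)).2
      have h2 : ∫ v in Set.Ioi (0 : ℝ), ‖𝓕 Φ (-transposeCLM A.proj ξ) * scalePiece k v ξ‖ =
          ‖𝓕 Φ (-transposeCLM A.proj ξ)‖ * ‖k ξ‖ * bumpConst := by
        rw [← h1, ← integral_const_mul]
        refine setIntegral_congr_fun measurableSet_Ioi fun v hv => ?_
        have hv' : 0 < v := hv
        simp only [scalePiece, norm_mul, Complex.norm_real]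
        rw [Real.norm_of_nonneg (div_nonneg bump.nonneg hv'.le), mul_assoc]
      rw [h2, Real.norm_of_nonneg (mul_nonneg (by positivity) bumpConst_pos.le)]
      have := bumpConst_pos.le
      gcongr
      exact mul_le_of_le_one_right (norm_nonneg _) (hk.norm_le_one hξ)
  have e : (bumpConst : ℂ) * A.symbolForm Φ k =
      ∫ v in Set.Ioi (0 : ℝ), A.symbolForm Φ (scalePiece k v) := by
    simp only [Frame.symbolForm]
    rw [← integral_integral_swap hint, ← integral_const_mul]
    refine integral_congr_ae ?_
    filter_upwards [ae_ne_zero hm] with ξ hξ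
    rw [integral_const_mul, (hval hξ).2]
    ring
  have h1 : ENNReal.ofReal bumpConst = ‖(bumpConst : ℂ)‖ₑ := by
    rw [← ofReal_norm, Complex.norm_real, Real.norm_of_nonneg bumpConst_pos.le]
  rw [h1, ← enorm_mul, e]
  exact enorm_integral_le_lintegral_enorm _

/-- The singular Brascamp–Lieb inequality for normalized real-valued functions. -/
theorem Frame.exists_symbolForm_bound (A : Frame m) (hm : 1 ≤ m) :
    ∃ C : ℝ, 0 ≤ C ∧ ∀ k : Rm m → ℂ, Measurable k → IsSymbol (3 * m + 1) k →
      ∀ F : Cube m → 𝓢(Rm m, ℝ), A.Normalized F → ‖A.symbolForm (cubeSchwartz F) k‖ ≤ C := by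
  obtain ⟨D, hD, hconf⟩ := A.exists_isConfig
  obtain ⟨σ, hσ'⟩ := A.proj.exists_rightInverse_of_surjective (LinearMap.range_eq_top.mpr A.surj)
  have hσ (y : Rm m) : A.proj (σ y) = y := LinearMap.congr_fun hσ' y
  choose C hC using fun i : Fin m =>
    SquareBound.pairSymbol (S := ∅) hD (i := i) (squareBound hD _)
  choose B hB0 hB using fun i : Fin m =>
    IsSymbol.exists_fourier_decay (A.contDiff_coeff i (3 * m + 1)) (A.tsupport_coeff i)
  have hσc : Continuous fun y => -σ y := σ.continuous_of_finiteDimensional.neg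
  -- w is the decay of the Fourier coefficients and u the cost of the shift -σ y. Their orders -(3m
  -- + 1) and 2m leave -(m + 1), which is integrable on ℝ^m.
  let w (i : Fin m) (y : Rm m) : ENNReal :=
    ENNReal.ofReal (B i * (1 + ‖y‖) ^ (-((3 * m + 1 : ℕ) : ℝ)))
  let u (y : Rm m) : ENNReal := ENNReal.ofReal (A.jac * (1 + ‖-σ y‖) ^ (2 * m))
  have hK (i : Fin m) : ∫⁻ y, w i y * (u y * C i) ≠ ⊤ := by
    let σ' : Rm m →L[ℝ] R2m m := LinearMap.toContinuousLinearMap σ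
    have hσb (y : Rm m) : 1 + ‖-σ y‖ ≤ (1 + ‖σ'‖) * (1 + ‖y‖) := by
      have h1 : ‖σ y‖ ≤ ‖σ'‖ * ‖y‖ := σ'.le_opNorm y
      rw [norm_neg]
      nlinarith [norm_nonneg y, norm_nonneg σ']
    have hi : Integrable fun y : Rm m => B i * (A.jac * (1 + ‖σ'‖) ^ (2 * m)) *
        (1 + ‖y‖) ^ (-((m + 1 : ℕ) : ℝ)) := (integrable_one_add_norm (by simp)).const_mul _
    have hJ := A.jac_pos.le
    have hle (y : Rm m) : w i y * (u y * C i) ≤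
        ENNReal.ofReal (B i * (A.jac * (1 + ‖σ'‖) ^ (2 * m)) *
          (1 + ‖y‖) ^ (-((m + 1 : ℕ) : ℝ))) * C i := by
      rw [← mul_assoc, ← ENNReal.ofReal_mul (mul_nonneg (hB0 i) (by positivity))]
      refine mul_le_mul' (ENNReal.ofReal_le_ofReal ?_) le_rfl
      have hBi := hB0 i
      calc _ ≤ B i * (1 + ‖y‖) ^ (-((3 * m + 1 : ℕ) : ℝ)) *
            (A.jac * ((1 + ‖σ'‖) * (1 + ‖y‖)) ^ (2 * m)) := by
            gcongr
            exact hσb y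
        _ = B i * (A.jac * (1 + ‖σ'‖) ^ (2 * m)) *
            ((1 + ‖y‖) ^ (-((3 * m + 1 : ℕ) : ℝ)) * (1 + ‖y‖) ^ (2 * m)) := by
            rw [mul_pow]
            ring
        _ = _ := by
            rw [← Real.rpow_natCast (1 + ‖y‖) (2 * m), ← Real.rpow_add (by positivity)]
            congr 2
            push_cast
            ring
    refine ((lintegral_mono hle).trans_lt ?_).ne
    rw [lintegral_mul_const' _ _ ENNReal.coe_ne_top]
    exact ENNReal.mul_lt_top hi.lintegral_lt_top ENNReal.coe_lt_top
  set K : ENNReal := ∑ i, ∫⁻ y, w i y * (u y * C i) with hKdef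
  have hKtop : K ≠ ⊤ := (ENNReal.sum_lt_top.mpr fun i _ => (hK i).lt_top).ne
  refine ⟨bumpConst⁻¹ * K.toReal, mul_nonneg (inv_nonneg.mpr bumpConst_pos.le)
    ENNReal.toReal_nonneg, fun k hkm hk F hF => ?_⟩
  set Φ := cubeSchwartz F with hΦ
  have hmG (i : Fin m) : Measurable fun q : ℝ × Rm m =>
      ‖A.symbolForm Φ (A.pairSymbol i (fun _ => 1) (-σ q.2) q.1)‖ₑ := by
    have h0 : Measurable fun q : ℝ × Rm m => (q.1, -σ q.2) :=
      measurable_fst.prodMk (hσc.measurable.comp measurable_snd)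
    exact ((A.measurable_symbolForm_pair Φ i fun _ => 1).comp h0).enorm
  have hwm (i : Fin m) : Measurable (w i) := by
    refine Measurable.ennreal_ofReal ?_
    have h1 : Continuous fun y : Rm m => (1 + ‖y‖) ^ (-((3 * m + 1 : ℕ) : ℝ)) :=
      Continuous.rpow_const (by fun_prop) fun y => Or.inl (by positivity)
    exact h1.measurable.const_mul _
  have hpiece (i : Fin m) : ∫⁻ v in Set.Ioi (0 : ℝ), ∫⁻ y, w i y *
      ‖A.symbolForm Φ (A.pairSymbol i (fun _ => 1) (-σ y) v)‖ₑ ≤ ∫⁻ y, w i y * (u y * C i) := by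
    refine lintegral_lintegral_mul_le (μ := volume.restrict (Set.Ioi (0 : ℝ))) (ν := volume)
      (G := fun v y => ‖A.symbolForm Φ (A.pairSymbol i (fun _ => 1) (-σ y) v)‖ₑ)
      (hwm i) (hmG i) fun y => ?_
    have h1 := hC i A (fun _ => 1) F (hconf F hF) (-σ y)
    simpa only [one_pow, one_smul] using h1
  have hdecay (i : Fin m) {v : ℝ} (hv : 0 < v) (y : Rm m) :
      ‖𝓕 (A.localSymbol i k v) y‖ₑ ≤ w i y := by
    rw [← ofReal_norm]
    exact ENNReal.ofReal_le_ofReal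
      (hB i _ (hk.comp_smul (inv_pos.mpr (Real.sqrt_pos.mpr hv))) y)
  have main : ENNReal.ofReal bumpConst * ‖A.symbolForm Φ k‖ₑ ≤ K := by
    refine (A.enorm_symbolForm_le_scalePiece hm Φ hkm hk).trans ?_
    have hpt (v : ℝ) (hv : v ∈ Set.Ioi (0 : ℝ)) : ‖A.symbolForm Φ (scalePiece k v)‖ₑ ≤
        ∑ i, ∫⁻ y, w i y * ‖A.symbolForm Φ (A.pairSymbol i (fun _ => 1) (-σ y) v)‖ₑ :=
      (A.enorm_scalePiece_le (by omega) hσ Φ hk hv).trans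
        (Finset.sum_le_sum fun i _ => lintegral_mono fun y =>
          mul_le_mul' (hdecay i hv y) le_rfl)
    refine (setLIntegral_mono' measurableSet_Ioi hpt).trans ?_
    have hms (i : Fin m) : Measurable fun v : ℝ => ∫⁻ y, w i y *
        ‖A.symbolForm Φ (A.pairSymbol i (fun _ => 1) (-σ y) v)‖ₑ :=
      (((hwm i).comp measurable_snd).mul (hmG i)).lintegral_prod_right'
    rw [lintegral_finsetSum _ fun i _ => hms i]
    exact Finset.sum_le_sum fun i _ => hpiece i
  have h1 := ENNReal.toReal_mono hKtop main
  rw [ENNReal.toReal_mul, ENNReal.toReal_ofReal bumpConst_pos.le, toReal_enorm] at h1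
  rw [inv_mul_eq_div, le_div_iff₀ bumpConst_pos, mul_comm]
  exact h1

end RealBound

end SingularBL

end

noncomputable section

namespace SingularBL

/-! ### From normalized real functions to the full inequality -/

section Conclusion

variable {m : ℕ}

/-- The form is the pairing of the Fourier transform of the test function with the symbol. -/
theorem pullback_eq_symbolForm (A : Frame m) {K : 𝓢'(Rm m, ℂ)} {k : Rm m → ℂ}
    (hK : ∀ φ : 𝓢(Rm m, ℂ), 𝓕 K φ = ∫ ξ, k ξ * φ ξ) (Φ : 𝓢(R2m m, ℂ)) :
    pullback A.proj A.surj K Φ = A.symbolForm Φ k := by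
  have h1 := hK (𝓕⁻ (pushforward A.proj A.surj Φ))
  rw [TemperedDistribution.fourier_apply, FourierTransform.fourier_fourierInv_eq] at h1
  rw [pullback_apply, h1, Frame.symbolForm]
  refine integral_congr_ae (Filter.Eventually.of_forall fun ξ => ?_)
  simp only
  rw [SchwartzMap.fourierInv_coe, Real.fourierInv_eq_fourier_neg, ← SchwartzMap.fourier_coe,
    fourier_pushforward, map_neg, mul_comm]

theorem exists_frame (L : R2m m →ₗ[ℝ] Rm m) (hL : Function.Surjective L)
    (h : ∀ j : Cube m, ∀ x ∈ LinearMap.ker L, cubeProj j x = 0 → x = 0) :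
    ∃ A : Frame m, A.proj = L := by
  obtain ⟨ℓ, hℓ, hker⟩ := exists_ker_param L hL
  have hmem (p : Rm m) : ℓ p ∈ LinearMap.ker L := hker ▸ LinearMap.mem_range_self ℓ p
  refine ⟨⟨ℓ, L, hL, hmem, fun j => ?_⟩, rfl⟩
  have hinj : Function.Injective (cubeProj j ∘ₗ ℓ) := by
    rw [injective_iff_map_eq_zero]
    intro p hp
    exact (map_eq_zero_iff ℓ hℓ).mp (h j _ (hmem p) hp)
  exact ⟨hinj, LinearMap.injective_iff_surjective.mp hinj⟩

theorem lintegral_enorm_pow_eq (f : Rm m → ℂ) :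
    ∫⁻ y, ‖f y‖ₑ ^ (2 ^ m) = eLpNorm f (2 ^ m) volume ^ (2 ^ m) := by
  have h := eLpNorm_nnreal_pow_eq_lintegral (μ := (volume : Measure (Rm m))) (f := f)
    (p := 2 ^ m) (by positivity)
  have h1 : (((2 ^ m : NNReal) : NNReal) : ℝ) = ((2 ^ m : ℕ) : ℝ) := by simp
  have h2 : (((2 ^ m : NNReal) : NNReal) : ENNReal) = 2 ^ m := by simp
  rw [h1, h2] at h
  simp only [ENNReal.rpow_natCast] at h
  exact h.symm

theorem Frame.exists_lintegral_vertex_le (A : Frame m) (j : Cube m) :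
    ∃ d : ℝ, 0 < d ∧ ∀ g : Rm m → ENNReal, Measurable g →
      ∫⁻ p, g (cubeProj j (A.emb p)) ≤ ENNReal.ofReal d ^ (2 ^ m) * ∫⁻ y, g y := by
  let e : Rm m ≃L[ℝ] Rm m :=
    (LinearEquiv.ofBijective (cubeProj j ∘ₗ A.emb) (A.bij j)).toContinuousLinearEquiv
  have hmap : (volume.map e).IsAddHaarMeasure := e.isAddHaarMeasure_map volume
  set c := Measure.addHaarScalarFactor (volume.map e) (volume : Measure (Rm m)) with hc
  have hν : volume.map e = c • (volume : Measure (Rm m)) :=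
    Measure.isAddLeftInvariant_eq_smul _ _
  -- Since 1 + c ≥ 1, its power 2^m dominates the Jacobian factor c, which avoids taking a root.
  refine ⟨1 + c, by positivity, fun g hg => ?_⟩
  have h1 : ∫⁻ p, g (cubeProj j (A.emb p)) = c * ∫⁻ y, g y := by
    have h2 := lintegral_map (μ := volume) hg e.continuous.measurable
    rw [hν, lintegral_smul_measure] at h2
    exact h2.symm
  rw [h1]
  refine mul_le_mul' ?_ le_rfl
  have h3 : (c : ℝ) ≤ (1 + c) ^ (2 ^ m) :=
    (le_add_of_nonneg_left zero_le_one).trans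
      (le_self_pow₀ (le_add_of_nonneg_right c.2) (by positivity))
  rw [← ENNReal.ofReal_pow (by positivity), ← ENNReal.ofReal_coe_nnreal]
  exact ENNReal.ofReal_le_ofReal h3

theorem cubeSchwartz_smul (b : Cube m → ℝ) (F : Cube m → 𝓢(Rm m, ℝ)) :
    cubeSchwartz (fun j => b j • F j) = ((∏ j, b j : ℝ) : ℂ) • cubeSchwartz F := by
  ext x
  simp only [cubeSchwartz, cubeProd_apply, smul_apply, SchwartzMap.postcompCLM_apply,
    Complex.ofRealCLM_apply, smul_eq_mul]
  push_cast
  rw [← Finset.prod_mul_distrib]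

/-- The normalized estimate and homogeneity. Strictly positive upper bounds a_j in place of the
norms permit the division even when some F_j vanishes. -/
theorem exists_real_bound (A : Frame m) (hm : 1 ≤ m) : ∃ C : ℝ, 0 ≤ C ∧ ∀ K : 𝓢'(Rm m, ℂ),
    ∀ k : Rm m → ℂ, (∀ φ : 𝓢(Rm m, ℂ), 𝓕 K φ = ∫ ξ, k ξ * φ ξ) → Measurable k →
      IsSymbol (3 * m + 1) k → ∀ (F : Cube m → 𝓢(Rm m, ℝ)) (a : Cube m → ℝ), (∀ j, 0 < a j) →
        (∀ j, ∫⁻ y, ‖F j y‖ₑ ^ (2 ^ m) ≤ ENNReal.ofReal (a j) ^ (2 ^ m)) →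
          ‖pullback A.proj A.surj K (cubeSchwartz F)‖ ≤ C * ∏ j, a j := by
  obtain ⟨C, hC, hbound⟩ := A.exists_symbolForm_bound hm
  choose d hd0 hd using A.exists_lintegral_vertex_le
  refine ⟨C * ∏ j, d j, mul_nonneg hC (Finset.prod_nonneg fun j _ => (hd0 j).le),
    fun K k hK hkm hk F a ha hF => ?_⟩
  have hb (j : Cube m) : 0 < d j * a j := mul_pos (hd0 j) (ha j)
  have hnorm : A.Normalized fun j => (d j * a j)⁻¹ • F j := by
    intro j
    have hg : Measurable fun y : Rm m => ‖F j y‖ₑ ^ (2 ^ m) :=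
      (F j).continuous.measurable.enorm.pow_const _
    have h1 (p : Rm m) : ‖((d j * a j)⁻¹ • F j) (cubeProj j (A.emb p))‖ₑ ^ (2 ^ m) =
        ENNReal.ofReal (d j * a j)⁻¹ ^ (2 ^ m) * ‖F j (cubeProj j (A.emb p))‖ₑ ^ (2 ^ m) := by
      rw [smul_apply, enorm_smul, mul_pow,
        Real.enorm_of_nonneg (inv_nonneg.mpr (hb j).le)]
    simp only [h1]
    rw [lintegral_const_mul' _ _ (ENNReal.pow_ne_top ENNReal.ofReal_ne_top)]
    calc _ ≤ ENNReal.ofReal (d j * a j)⁻¹ ^ (2 ^ m) *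
          (ENNReal.ofReal (d j) ^ (2 ^ m) * ENNReal.ofReal (a j) ^ (2 ^ m)) :=
          mul_le_mul' le_rfl ((hd j _ hg).trans (mul_le_mul' le_rfl (hF j)))
      _ = 1 := by
          rw [← mul_pow, ← mul_pow, ← ENNReal.ofReal_mul (hd0 j).le,
            ← ENNReal.ofReal_mul (inv_nonneg.mpr (hb j).le), inv_mul_cancel₀ (hb j).ne',
            ENNReal.ofReal_one, one_pow]
  have h2 := hbound k hkm hk _ hnorm
  rw [← pullback_eq_symbolForm A hK, cubeSchwartz_smul, map_smul, norm_smul, Complex.norm_real,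
    Finset.prod_inv_distrib, norm_inv,
    Real.norm_of_nonneg (Finset.prod_nonneg fun j _ => (hb j).le),
    inv_mul_le_iff₀ (Finset.prod_pos fun j _ => hb j), Finset.prod_mul_distrib] at h2
  linarith

/-- The real and the imaginary part of a Schwartz function. -/
def realPart (b : Fin 2) (f : 𝓢(Rm m, ℂ)) : 𝓢(Rm m, ℝ) :=
  f.postcompCLM (if b = 0 then Complex.reCLM else Complex.imCLM)

theorem enorm_realPart_le (b : Fin 2) (f : 𝓢(Rm m, ℂ)) (y : Rm m) : ‖realPart b f y‖ₑ ≤ ‖f y‖ₑ := by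
  rw [enorm_le_iff_norm_le, realPart, SchwartzMap.postcompCLM_apply]
  split_ifs
  · exact Complex.abs_re_le_norm _
  · exact Complex.abs_im_le_norm _

/-- Multilinearity in the decomposition into real and imaginary parts. The coefficients are powers
of i, so each term has modulus 1 in front. -/
theorem cubeProd_eq_sum (F : Cube m → 𝓢(Rm m, ℂ)) :
    cubeProd F = ∑ s : Cube m → Fin 2, (∏ j, Complex.I ^ (s j : ℕ)) •
      cubeSchwartz fun j => realPart (s j) (F j) := by
  ext x
  have h1 (j : Cube m) : F j (cubeProj j x) =
      ∑ b : Fin 2, Complex.I ^ (b : ℕ) * (realPart b (F j) (cubeProj j x) : ℂ) := by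
    simp only [Fin.sum_univ_two, realPart, SchwartzMap.postcompCLM_apply]
    simp only [Fin.isValue, if_true, one_ne_zero, if_false, Fin.val_zero, Fin.val_one, pow_zero,
      pow_one, one_mul, Complex.reCLM_apply, Complex.imCLM_apply]
    rw [mul_comm, Complex.re_add_im]
  rw [cubeProd_apply, sum_apply]
  simp only [h1]
  rw [Fintype.prod_sum]
  refine Finset.sum_congr rfl fun s _ => ?_
  rw [Finset.prod_mul_distrib]
  rfl

/-- The singular Brascamp–Lieb inequality. -/
theorem exists_bound_of_ker_injective (hm : 1 ≤ m) (L : R2m m →ₗ[ℝ] Rm m)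
    (hL : Function.Surjective L)
    (h : ∀ j : Cube m, ∀ x ∈ LinearMap.ker L, cubeProj j x = 0 → x = 0) :
    ∃ C : ℝ, ∀ K : 𝓢'(Rm m, ℂ), IsCZKernel (3 * m + 1) K → ∀ F : Cube m → 𝓢(Rm m, ℂ),
      ‖singularForm L hL K F‖ ≤ C * ∏ j, (eLpNorm (F j) (2 ^ m) volume).toReal := by
  obtain ⟨A, rfl⟩ := exists_frame L hL h
  obtain ⟨C, hC, hbound⟩ := exists_real_bound A hm
  refine ⟨∑ _ : Cube m → Fin 2, C, fun K hK F => ?_⟩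
  obtain ⟨k, hkm, hKk, hkc, hkb⟩ := hK
  have hk : IsSymbol (3 * m + 1) k :=
    ⟨hkc, fun n hn ξ hξ => norm_multilinear_le _ (by positivity) fun β => hkb n hn β ξ hξ⟩
  set a : Cube m → ℝ := fun j => (eLpNorm (F j) (2 ^ m) volume).toReal with ha
  have ha0 (j : Cube m) : 0 ≤ a j := ENNReal.toReal_nonneg
  -- The norms may be zero, so they are increased by ε, which tends to 0 at the end.
  have hpos (ε : ℝ) (hε : 0 < ε) : ‖singularForm A.proj hL K F‖ ≤
      (∑ _ : Cube m → Fin 2, C) * ∏ j, (a j + ε) := by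
    rw [singularForm, cubeProd_eq_sum, map_sum, Finset.sum_mul]
    refine (norm_sum_le _ _).trans (Finset.sum_le_sum fun s _ => ?_)
    rw [map_smul, norm_smul, norm_prod]
    simp only [norm_pow, Complex.norm_I, one_pow, Finset.prod_const_one, one_mul]
    refine hbound K k hKk hkm hk _ _ (fun j => add_pos_of_nonneg_of_pos (ha0 j) hε) fun j => ?_
    calc ∫⁻ y, ‖realPart (s j) (F j) y‖ₑ ^ (2 ^ m)
        ≤ ∫⁻ y, ‖F j y‖ₑ ^ (2 ^ m) :=
          lintegral_mono fun y => pow_le_pow_left' (enorm_realPart_le _ _ y) _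
      _ = eLpNorm (F j) (2 ^ m) volume ^ (2 ^ m) := lintegral_enorm_pow_eq _
      _ = ENNReal.ofReal (a j) ^ (2 ^ m) := by
          rw [ha, ENNReal.ofReal_toReal ((F j).memLp (2 ^ m) volume).eLpNorm_ne_top]
      _ ≤ _ := by
          gcongr
          linarith
  have hcont : Continuous fun ε : ℝ => (∑ _ : Cube m → Fin 2, C) * ∏ j, (a j + ε) := by fun_prop
  have hlim := (hcont.tendsto 0).mono_left (nhdsWithin_le_nhds (s := Set.Ioi 0))
  simp only [add_zero] at hlim
  exact ge_of_tendsto hlim (eventually_nhdsWithin_of_forall hpos)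

end Conclusion

end SingularBL

end

/-! ### The equivalence of the three conditions -/

theorem theorem1 (m : ℕ) (hm : 1 ≤ m) :
    ∃ N : ℕ, ∀ (L : SingularBL.R2m m →ₗ[ℝ] SingularBL.Rm m) (hL : Function.Surjective L),
      List.TFAE [
        -- (1) the dimension condition on `ker Π`
        (∀ V : Submodule ℝ (SingularBL.R2m m), V ≤ LinearMap.ker L →
            (Module.finrank ℝ V : ℝ) ≤ ∑ j : SingularBL.Cube m,
              ((2 : ℝ) ^ m)⁻¹ * Module.finrank ℝ (V.map (SingularBL.cubeProj j))) ∧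
          (Module.finrank ℝ (LinearMap.ker L) : ℝ) = ∑ j : SingularBL.Cube m,
            ((2 : ℝ) ^ m)⁻¹ *
              Module.finrank ℝ ((LinearMap.ker L).map (SingularBL.cubeProj j)),
        -- (2) all the maps `Π Π_j^T` are invertible
        ∀ j : SingularBL.Cube m,
          Function.Bijective (L ∘ₗ LinearMap.adjoint (SingularBL.cubeProj j)),
        -- (3) the singular Brascamp-Lieb inequality
        ∃ C : ℝ, ∀ K : 𝓢'(SingularBL.Rm m, ℂ), SingularBL.IsCZKernel N K →
          ∀ F : SingularBL.Cube m → 𝓢(SingularBL.Rm m, ℂ),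
            ‖SingularBL.singularForm L hL K F‖ ≤
              C * ∏ j, (eLpNorm (F j) (2 ^ m) volume).toReal] := by
  refine ⟨3 * m + 1, fun L hL => ?_⟩
  rw [SingularBL.dimension_condition_iff, SingularBL.forall_bijective_iff]
  -- Both conditions have been rewritten as injectivity of every cubical projection on ker Π.
  tfae_have 1 ↔ 2 := Iff.rfl
  tfae_have 3 → 1 := fun h j => SingularBL.ker_injective_of_bound _ L hL h j
  tfae_have 1 → 3 := fun h => SingularBL.exists_bound_of_ker_injective hm L hL h
  tfae_finish
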